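/- Let $f$ be a homogeneous polynomial of degree $d$ in $n$ variables with real coefficients. Write $\|f\|_2=\sup_{\|x\|_2=1}|f(x)|$. A pseudo-expectation of degree $q$ on the unit sphere is a linear functional $\widetilde{\mathbb E}$ on the real polynomials of degree at most $q$ in $x=(x_1,\dots,x_n)$ such that $\widetilde{\mathbb E}[1]=1$, $\widetilde{\mathbb E}[p^2]\ge 0$ whenever $2\deg p\le q$, and $\widetilde{\mathbb E}[p\cdot(\|x\|_2^2-1)]=0$ whenever $\deg p+2\le q$. For a polynomial $g$ of degree at most $q$, let $\mathrm{sos}_q(g)$ be the supremum of $\widetilde{\mathbb E}[g]$ over all pseudo-expectations of degree $q$ on the unit sphere. **Theorem.** There are an absolute constant $C\in\mathbb N$ and a single algorithm $\mathcal A$ such that the following holds for every $d\ge 2$, every positive integer $q$ divisible by $2d$, every $n\ge q$, and every homogeneous polynomial $f$ of degree $d$ in $n$ variables with real coefficients. 1. The supremum $\mathrm{sos}_q(f^{q/d})$ is over a non-empty bounded set, and $$\mathrm{sos}_q\bigl(f^{q/d}\bigr)^{d/q}\ \le\ C^{d}\,\Bigl(\frac nq\Bigr)^{d/2-1}\,\|f\|_2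 .$$ 2. On input $n$, $d$, $q$ and the table of the coefficients of $f$ (indexed by $[n]^d$, the entry at $(i_1,\dots,i_d)$ being the coefficient of $x_{i_1}\cdots x_{i_d}$), the algorithm $\mathcal A$ halts after at most $n^{Cq}$ steps and returns a vector $x\in\mathbb R^n$ with $\|x\|_2=1$ and $$\mathrm{sos}_q\bigl(f^{q/d}\bigr)^{d/q}\ \le\ C^{d}\,\Bigl(\frac nq\Bigr)^{d/2-1}\,|f(x)| .$$ Here an algorithm is a program for a real random access machine, independent of $n,d,q,f$: at unit cost it performs $+,-,\times,/,\sqrt{\ }$ and comparisons on real numbers, natural-number constants, addition, truncated subtraction and comparisons on indices, conversion of an index to a real, and indirect reads and writes of arrays. -/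

import Mathlib

noncomputable section

namespace SphereOpt

open MvPolynomial

/-! ### The optimum over the sphere and its sum-of-squares relaxation -/

/-- The norm of a polynomial: the supremum of `|f x|` over the Euclidean unit sphere of `ℝⁿ`. -/
def sphereNorm {n : ℕ} (f : MvPolynomial (Fin n) ℝ) : ℝ :=
  sSup {v : ℝ | ∃ x : EuclideanSpace ℝ (Fin n), ‖x‖ = 1 ∧ v = |eval (fun i => x i) f|}

/-- `E` is a pseudo-expectation of degree `q` that satisfies the constraint `‖x‖² = 1`.
Only the values of `E` on polynomials of degree at most `q` matter; a linear functional on that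
subspace always extends to all polynomials, so nothing is lost by taking `E` to be defined on all
of them. -/
structure IsPseudoExpectation {n : ℕ} (q : ℕ) (E : MvPolynomial (Fin n) ℝ →ₗ[ℝ] ℝ) : Prop where
  one : E 1 = 1
  sq_nonneg : ∀ p : MvPolynomial (Fin n) ℝ, 2 * p.totalDegree ≤ q → 0 ≤ E (p ^ 2)
  sphere : ∀ p : MvPolynomial (Fin n) ℝ, p.totalDegree + 2 ≤ q →
    E (p * (∑ i, X i ^ 2 - 1)) = 0

/-- The values that the degree-`q` pseudo-expectations on the sphere give to `g`. -/
def sosValues {n : ℕ} (q : ℕ) (g : MvPolynomial (Fin n) ℝ) : Set ℝ :=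
  {v : ℝ | ∃ E : MvPolynomial (Fin n) ℝ →ₗ[ℝ] ℝ, IsPseudoExpectation q E ∧ v = E g}

/-- The optimum of the level-`q` sum-of-squares relaxation of maximising `g` over the sphere. -/
def sosOpt {n : ℕ} (q : ℕ) (g : MvPolynomial (Fin n) ℝ) : ℝ :=
  sSup (sosValues q g)

/-! ### A real random access machine -/

/-- A memory configuration: index registers, real registers, and countably many unbounded arrays
of indices and of reals. -/
structure Store where
  nreg : ℕ → ℕ
  rreg : ℕ → ℝ
  narr : ℕ → ℕ → ℕ
  rarr : ℕ → ℕ → ℝ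

/-- The elementary instructions. The arguments `i j k` are register names, `a` is the name of an
array, and array cells are addressed by the content of an index register. -/
inductive Instr where
  | skip
  | natConst (i c : ℕ)
  | natAdd (i j k : ℕ)
  | natSub (i j k : ℕ)
  | natLoad (i a j : ℕ)
  | natStore (a j i : ℕ)
  | realOfNat (i j : ℕ)
  | realAdd (i j k : ℕ)
  | realSub (i j k : ℕ)
  | realMul (i j k : ℕ)
  | realDiv (i j k : ℕ)
  | realSqrt (i j : ℕ)
  | realLoad (i a j : ℕ)
  | realStore (a j i : ℕ)

/-- The effect of an elementary instruction. Subtraction of indices is truncated, division by `0`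
and the square root of a negative real give `0`. -/
def Instr.exec (s : Store) : Instr → Store
  | .skip => s
  | .natConst i c => { s with nreg := Function.update s.nreg i c }
  | .natAdd i j k => { s with nreg := Function.update s.nreg i (s.nreg j + s.nreg k) }
  | .natSub i j k => { s with nreg := Function.update s.nreg i (s.nreg j - s.nreg k) }
  | .natLoad i a j => { s with nreg := Function.update s.nreg i (s.narr a (s.nreg j)) }
  | .natStore a j i =>
      { s with narr := Function.update s.narr a
                 (Function.update (s.narr a) (s.nreg j) (s.nreg i)) }
  | .realOfNat i j => { s with rreg := Function.update s.rreg i (s.nreg j : ℝ) }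
  | .realAdd i j k => { s with rreg := Function.update s.rreg i (s.rreg j + s.rreg k) }
  | .realSub i j k => { s with rreg := Function.update s.rreg i (s.rreg j - s.rreg k) }
  | .realMul i j k => { s with rreg := Function.update s.rreg i (s.rreg j * s.rreg k) }
  | .realDiv i j k => { s with rreg := Function.update s.rreg i (s.rreg j / s.rreg k) }
  | .realSqrt i j => { s with rreg := Function.update s.rreg i (Real.sqrt (s.rreg j)) }
  | .realLoad i a j => { s with rreg := Function.update s.rreg i (s.rarr a (s.nreg j)) }
  | .realStore a j i =>
      { s with rarr := Function.update s.rarr a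
                 (Function.update (s.rarr a) (s.nreg j) (s.rreg i)) }

/-- The tests: strict comparison of two index registers or of two real registers. -/
inductive Test where
  | natLt (i j : ℕ)
  | realLt (i j : ℕ)

def Test.Holds (s : Store) : Test → Prop
  | .natLt i j => s.nreg i < s.nreg j
  | .realLt i j => s.rreg i < s.rreg j

/-- Programs are finite texts. -/
inductive Program where
  | instr (c : Instr)
  | seq (P Q : Program)
  | branch (b : Test) (P Q : Program)
  | loop (b : Test) (P : Program)

/-- `Runs P s s' t`: started in `s`, the program `P` halts in `s'` after exactly `t` steps, where
each elementary instruction and each evaluation of a test is one step. -/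
inductive Runs : Program → Store → Store → ℕ → Prop
  | instr (c : Instr) (s : Store) : Runs (.instr c) s (c.exec s) 1
  | seq {P Q : Program} {s s' s'' : Store} {t u : ℕ} :
      Runs P s s' t → Runs Q s' s'' u → Runs (.seq P Q) s s'' (t + u)
  | branch_true {b : Test} {P Q : Program} {s s' : Store} {t : ℕ} :
      b.Holds s → Runs P s s' t → Runs (.branch b P Q) s s' (t + 1)
  | branch_false {b : Test} {P Q : Program} {s s' : Store} {t : ℕ} :
      ¬ b.Holds s → Runs Q s s' t → Runs (.branch b P Q) s s' (t + 1)
  | loop_true {b : Test} {P : Program} {s s' s'' : Store} {t u : ℕ} :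
      b.Holds s → Runs P s s' t → Runs (.loop b P) s' s'' u →
        Runs (.loop b P) s s'' (t + u + 1)
  | loop_false {b : Test} {P : Program} {s : Store} :
      ¬ b.Holds s → Runs (.loop b P) s s 1

/-- The coefficient table of a form of degree `d`. The cell with number `∑ j, I j * n ^ j`, for
`I : Fin d → Fin n`, holds the coefficient of the monomial `∏ j, X (I j)`; the cells from `n ^ d`
on hold `0`. -/
def coeffTable {n : ℕ} (d : ℕ) (f : MvPolynomial (Fin n) ℝ) (m : ℕ) : ℝ :=
  if h : m < n ^ d then
    f.coeff (∑ j : Fin d, Finsupp.single (finFunctionFinEquiv.symm ⟨m, h⟩ j) 1)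
  else 0

/-- The input: `n`, `d`, `q` in the index registers `0`, `1`, `2`, the coefficient table of `f` in
the real array `0`, and `0` everywhere else. -/
def inputStore (n d q : ℕ) (f : MvPolynomial (Fin n) ℝ) : Store where
  nreg := fun i => if i = 0 then n else if i = 1 then d else if i = 2 then q else 0
  rreg := fun _ => 0
  narr := fun _ _ => 0
  rarr := fun a m => if a = 0 then coeffTable d f m else 0

/-- The output: the vector in the first `n` cells of the real array `1`. -/
def outputVector (n : ℕ) (s : Store) : EuclideanSpace ℝ (Fin n) :=
  WithLp.toLp 2 (fun i : Fin n => s.rarr 1 i)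

end SphereOpt

end

noncomputable section
namespace SphereOpt
open MvPolynomial Finset

/-! ### Coefficient extraction by finite differences -/

/-! Write `d = e + 2`, `q = d * (2 * l)`, `s = e * l`, and let `T` be the symmetric tensor of `f`.
Read `f` as a form of degree `e` in outer variables whose coefficients are quadratic forms in inner
variables (`splitForm`), and let `H` be the `2 * l`-th power of this, of degree `2 * s` in the outer
variables. Identifying outer and inner variables turns `H` into `f ^ (2 * l)`, so `E (f ^ (2 * l))`
is the sum of `E (H_α * x ^ α)` over the exponents `α` of degree `2 * s`.

At a real outer point, `H` becomes the `2 * l`-th power of one quadratic form `Q`. Degree two is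
where sums of squares lose nothing: if `|Q y| ≤ c * ‖y‖²` for all `y`, then `c * ‖y‖² ± Q y` are
sums of squares of linear forms, and `E (u² * Q ^ (2 * l)) ≤ c ^ (2 * l) * E (u²)`
(`IsPseudoExpectation.sq_mul_quadForm_pow_le`). Homogeneity lets a mixed finite difference recover
the coefficient `H_α` from the values of `H` at the points with coordinates `k i / √(α i)`, `k i ≤ α
i` (`coeff_eq_sum_diffWeight`). The monomial `x ^ α` is split evenly into `u * v`, and `E (u * v *
h)` is bounded by the mean of `E (u² * h)` and `E (v² * h)`. With the weights that arise, the sum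
over the halves `δ` is `∑ E (x ^ (2δ)) / δ! = 1 / s!`; the number of `α` with a given half costs a
factor `(n / q) ^ s`, up to a constant to the power `q`, by a generating function at `t = q / n`.
The squared norm of the points is at most `2 * s`, and `(2 * s) ^ s / s!` is exponential in `s`.
This is `IsPseudoExpectation.eval_X_le` and `IsPseudoExpectation.pow_le`; the root of order `2 * l`
of `(n / q) ^ (e * l)` has exponent `e / 2 = d / 2 - 1`.

The bound `c` comes from values of `f` at finitely many explicit unit vectors (`candidate`). Power
iteration from the basis vectors finds a vector that nearly attains the norm of the matrix of `Q`;
that norm is then a value of the multilinear form of `T` at three distinct vectors, and polarization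
bounds it by values of `f` at their combinations (`abs_dotProduct_tensorMatrix_le`). So if `V` is at
least `|f|` at all candidates, then `V` bounds the relaxation. The algorithm tries all candidates
and keeps the best; its output gives the second item, and the first follows because `|f|` at a unit
vector is at most the norm of `f`.

Net points are encoded by numbers below `n ^ (2 * q)`, two base-`n` digits for each unit of a
numerator. The program is assembled from counted loops whose bounds are at most `n ^ (2 * q)`; its
size and nesting depth are constants, hence the running time (`Code.runs_compile`, `exists_runs`).
-/

lemma sum_neg_one_pow_choose_mul_pow_of_lt {a j : ℕ} (h : j < a) :
    ∑ k ∈ range (a + 1), ((-1 : ℝ) ^ (a - k) * (a.choose k : ℝ)) * (k : ℝ) ^ j = 0 := by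
  have h1 := congrFun (fwdDiff_iter_pow_eq_zero_of_lt (R := ℝ) h) 0
  rw [fwdDiff_iter_eq_sum_shift] at h1
  simpa [zsmul_eq_mul] using h1

lemma sum_neg_one_pow_choose_mul_pow_self (a : ℕ) :
    ∑ k ∈ range (a + 1), ((-1 : ℝ) ^ (a - k) * (a.choose k : ℝ)) * (k : ℝ) ^ a =
      (a.factorial : ℝ) := by
  have h1 := congrFun (fwdDiff_iter_eq_factorial (R := ℝ) (n := a)) 0
  rw [fwdDiff_iter_eq_sum_shift] at h1
  simpa [zsmul_eq_mul] using h1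

/-- The signed binomial weight of the node `k` in the mixed finite difference of order `α`. -/
def diffWeight {n : ℕ} (α k : Fin n → ℕ) : ℝ :=
  ∏ i, ((-1 : ℝ) ^ (α i - k i) * ((α i).choose (k i) : ℝ))

lemma sum_abs_diffWeight {n : ℕ} (α : Fin n → ℕ) :
    ∑ k ∈ Fintype.piFinset (fun i => range (α i + 1)), |diffWeight α k| = 2 ^ (∑ i, α i) := by
  have h : ∀ k, |diffWeight α k| = ∏ i, ((α i).choose (k i) : ℝ) := fun k => by
    simp [diffWeight, Finset.abs_prod, abs_mul, abs_pow]
  simp_rw [h]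
  rw [← Finset.prod_univ_sum (fun i => range (α i + 1)) (fun i j => ((α i).choose j : ℝ)),
    ← Finset.prod_pow_eq_pow_sum]
  refine Finset.prod_congr rfl fun i _ => ?_
  exact_mod_cast Nat.sum_range_choose (α i)

/-- A difference of order `α i` in the variable `i` kills all powers below `α i`. Every other
monomial of the same total degree has such a power in some variable, so homogeneity isolates one
coefficient. The ring `S` is general because the coefficients of interest are themselves
polynomials. -/
lemma sum_diffWeight_smul_eval {n r : ℕ} {S : Type*} [CommRing S] [Algebra ℝ S]
    (H : MvPolynomial (Fin n) S) (hH : H.IsHomogeneous r) (α : Fin n → ℕ)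
    (hα : ∑ i, α i = r) (a : Fin n → ℝ) :
    ∑ k ∈ Fintype.piFinset (fun i => range (α i + 1)),
        diffWeight α k • eval (fun i => algebraMap ℝ S (k i * a i)) H =
      (∏ i, ((α i).factorial * a i ^ α i : ℝ)) • coeff (Finsupp.equivFunOnFinite.symm α) H := by
  have key : ∀ β : Fin n →₀ ℕ, ∑ k ∈ Fintype.piFinset (fun i => range (α i + 1)),
      diffWeight α k * ∏ i, (k i * a i : ℝ) ^ β i =
      ∏ i, ∑ j ∈ range (α i + 1), ((-1 : ℝ) ^ (α i - j) * ((α i).choose j : ℝ)) *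
        ((j : ℝ) * a i) ^ β i := by
    intro β
    rw [Finset.prod_univ_sum (fun i => range (α i + 1)) (fun i j =>
      ((-1 : ℝ) ^ (α i - j) * ((α i).choose j : ℝ)) * ((j : ℝ) * a i) ^ β i)]
    refine Finset.sum_congr rfl fun k _ => ?_
    rw [diffWeight, ← Finset.prod_mul_distrib]
  have inner : ∀ i b, ∑ j ∈ range (α i + 1), ((-1 : ℝ) ^ (α i - j) * ((α i).choose j : ℝ)) *
        ((j : ℝ) * a i) ^ b = (∑ j ∈ range (α i + 1), ((-1 : ℝ) ^ (α i - j) *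
          ((α i).choose j : ℝ)) * (j : ℝ) ^ b) * a i ^ b := by
    intro i b
    rw [Finset.sum_mul]
    exact Finset.sum_congr rfl fun j _ => by rw [mul_pow]; ring
  have h1 : ∀ k : Fin n → ℕ, eval (fun i => algebraMap ℝ S (k i * a i)) H =
      ∑ β ∈ H.support, (∏ i, (k i * a i : ℝ) ^ β i) • coeff β H := by
    intro k
    rw [eval_eq']
    refine Finset.sum_congr rfl fun β _ => ?_
    rw [Algebra.smul_def, map_prod, mul_comm]
    simp only [map_pow]
  simp_rw [h1, Finset.smul_sum, smul_smul]
  rw [Finset.sum_comm]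
  simp_rw [← Finset.sum_smul, key, inner]
  rw [Finset.sum_eq_single (Finsupp.equivFunOnFinite.symm α)]
  · congr 1
    refine Finset.prod_congr rfl fun i _ => ?_
    simp [sum_neg_one_pow_choose_mul_pow_self]
  · intro β hβ hne
    have hdeg : ∑ i, β i = r := by
      have := hH (mem_support_iff.mp hβ)
      rw [Finsupp.weight_apply, Finsupp.sum_fintype _ _ (by simp)] at this
      simpa using this
    obtain ⟨i, hi⟩ : ∃ i, β i < α i := by
      by_contra! hcon
      apply hne
      have := (Finset.sum_eq_sum_iff_of_le (s := Finset.univ) (fun i _ => hcon i)).mp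
        (hα.trans hdeg.symm)
      ext i
      simpa using (this i (Finset.mem_univ i)).symm
    rw [Finset.prod_eq_zero (Finset.mem_univ i), zero_smul]
    rw [sum_neg_one_pow_choose_mul_pow_of_lt hi, zero_mul]
  · intro h
    rw [notMem_support_iff.mp h, smul_zero]

/-! ### Counting balanced splittings -/

/-- The reciprocal of the weight of the extraction of the coefficient with exponent `α`. -/
def extractionConst {n : ℕ} (α : Fin n → ℕ) : ℝ :=
  ∏ i, (Real.sqrt (α i) ^ α i / (α i).factorial)

lemma extractionConst_nonneg {n : ℕ} (α : Fin n → ℕ) : 0 ≤ extractionConst α :=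
  Finset.prod_nonneg fun _ _ => by positivity

lemma exp_natCast_le (a : ℕ) : Real.exp a ≤ 3 ^ a := by
  have : Real.exp a = Real.exp 1 ^ a := by rw [← Real.exp_nat_mul]; simp
  rw [this]
  have := Real.exp_one_lt_d9
  gcongr
  linarith

lemma pow_self_le_factorial (a : ℕ) : (a : ℝ) ^ a ≤ 3 ^ a * a.factorial := by
  have e1 := Real.pow_div_factorial_le_exp (x := (a : ℝ)) (by positivity) a
  rw [div_le_iff₀ (by positivity)] at e1
  exact e1.trans (mul_le_mul_of_nonneg_right (exp_natCast_le a) (by positivity))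

/-- The chain `b!² ≤ (2b)! ≤ (a+1)! ≤ 2^a * a!` and `a^a ≤ 3^a * a!` reduce the square of the
inequality to `6^a ≤ 9^a`. The hypothesis is what the larger half of `a` satisfies. -/
lemma sqrt_pow_div_factorial_le {a b : ℕ} (h : 2 * b ≤ a + 1) :
    Real.sqrt a ^ a / a.factorial ≤ 3 ^ a / b.factorial := by
  have h1 : ((b.factorial : ℝ)) ^ 2 ≤ 2 ^ a * a.factorial := by
    have e1 : b.factorial * b.factorial ≤ (b + b).factorial :=
      Nat.le_of_dvd (Nat.factorial_pos _) (Nat.factorial_mul_factorial_dvd_factorial_add b b)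
    have e2 : (b + b).factorial ≤ (a + 1).factorial := Nat.factorial_le (by omega)
    have e3 : (a + 1).factorial ≤ 2 ^ a * a.factorial := by
      rw [Nat.factorial_succ]
      exact Nat.mul_le_mul_right _ (Nat.lt_two_pow_self)
    have : b.factorial ^ 2 ≤ 2 ^ a * a.factorial := by
      rw [sq]; exact e1.trans (e2.trans e3)
    exact_mod_cast this
  have h2 := pow_self_le_factorial a
  rw [div_le_div_iff₀ (by positivity) (by positivity)]
  refine le_of_sq_le_sq ?_ (by positivity) |>.trans le_rfl
  rw [mul_pow, mul_pow, ← pow_mul, mul_comm a 2, pow_mul, Real.sq_sqrt (by positivity)]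
  calc (a : ℝ) ^ a * (b.factorial : ℝ) ^ 2
      ≤ (3 ^ a * a.factorial) * (2 ^ a * a.factorial) := by gcongr
    _ = 6 ^ a * (a.factorial : ℝ) ^ 2 := by
        rw [show (6 : ℝ) = 3 * 2 by norm_num, mul_pow]; ring
    _ ≤ (3 ^ a) ^ 2 * (a.factorial : ℝ) ^ 2 := by
        gcongr
        rw [← pow_mul, mul_comm a 2, pow_mul]
        gcongr
        norm_num

lemma extractionConst_le {n s : ℕ} {α δ : Fin n → ℕ} (hα : ∑ i, α i = 2 * s)
    (h : ∀ i, 2 * δ i ≤ α i + 1) :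
    extractionConst α ≤ 9 ^ s / ∏ i, ((δ i).factorial : ℝ) := by
  calc extractionConst α ≤ ∏ i, ((3 : ℝ) ^ α i / (δ i).factorial) :=
        Finset.prod_le_prod (fun _ _ => by positivity) fun i _ => sqrt_pow_div_factorial_le (h i)
    _ = 9 ^ s / ∏ i, ((δ i).factorial : ℝ) := by
        rw [Finset.prod_div_distrib, Finset.prod_pow_eq_pow_sum, hα, pow_mul]
        norm_num

/-- The number of exponents of degree `s` that differ from a given one by at most one in every
variable. -/
lemma card_balanced_le {n s : ℕ} (δ : Fin n → ℕ) (hδ : ∑ i, δ i = s) {t : ℝ} (ht : 0 < t)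
    (ht1 : t ≤ 1) :
    (#{δ' ∈ Fintype.piFinset (fun i => Finset.Icc (δ i - 1) (δ i + 1)) | ∑ i, δ' i = s} : ℝ) ≤
      3 ^ s * (1 + t) ^ n / t ^ s := by
  -- Each counted exponent has weight `t ^ s`; without the constraint on the degree the sum over the
  -- box factors into one-variable sums.
  have h1 : (#{δ' ∈ Fintype.piFinset (fun i => Finset.Icc (δ i - 1) (δ i + 1)) |
      ∑ i, δ' i = s} : ℝ) * t ^ s ≤
      ∑ δ' ∈ Fintype.piFinset (fun i => Finset.Icc (δ i - 1) (δ i + 1)), ∏ i, t ^ δ' i := by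
    rw [← nsmul_eq_mul, ← Finset.sum_const]
    refine (Finset.sum_le_sum_of_subset_of_nonneg (Finset.filter_subset _ _)
      fun _ _ _ => ?_).trans' (Finset.sum_le_sum fun δ' h => ?_)
    · exact Finset.prod_nonneg fun _ _ => by positivity
    · rw [Finset.prod_pow_eq_pow_sum, (Finset.mem_filter.mp h).2]
  rw [← Finset.prod_univ_sum (fun i => Finset.Icc (δ i - 1) (δ i + 1)) (fun _ j => t ^ j)] at h1
  -- Only variables that occur in `δ` pay a factor `3`, at most `3 ^ s` in total; each of the others
  -- pays `1 + t`, which is close to `1`.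
  have h2 : ∀ i, ∑ j ∈ Finset.Icc (δ i - 1) (δ i + 1), t ^ j ≤ 3 ^ δ i * (1 + t) := by
    intro i
    rcases Nat.eq_zero_or_pos (δ i) with h0 | hpos
    · rw [h0]
      simp [Finset.sum_Icc_succ_top]
    · calc ∑ j ∈ Finset.Icc (δ i - 1) (δ i + 1), t ^ j
          ≤ ∑ j ∈ Finset.Icc (δ i - 1) (δ i + 1), (1 : ℝ) :=
            Finset.sum_le_sum fun j _ => pow_le_one₀ ht.le ht1
        _ = 3 := by
            have : δ i + 1 + 1 - (δ i - 1) = 3 := by omega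
            simp only [Finset.sum_const, Nat.card_Icc, this]
            norm_num
        _ ≤ 3 ^ δ i * (1 + t) := by
            have : (3 : ℝ) ^ 1 ≤ 3 ^ δ i := pow_le_pow_right₀ (by norm_num) hpos
            nlinarith
  have h3 : ∏ i, ∑ j ∈ Finset.Icc (δ i - 1) (δ i + 1), t ^ j ≤ 3 ^ s * (1 + t) ^ n := by
    calc _ ≤ ∏ i, ((3 : ℝ) ^ δ i * (1 + t)) :=
          Finset.prod_le_prod (fun _ _ => Finset.sum_nonneg fun _ _ => by positivity)
            fun i _ => h2 i
      _ = _ := by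
          rw [Finset.prod_mul_distrib, Finset.prod_pow_eq_pow_sum, hδ]; simp
  rw [le_div_iff₀ (by positivity)]
  exact h1.trans h3

/-- Group the exponents `α` by their half `δ = φ α`. Within a group, `α` is determined by the other
half `α - δ`, which also has degree `s` and differs from `δ` by at most one in every variable, so
`card_balanced_le` bounds the size of the group. -/
lemma sum_extractionConst_mul_le {n s : ℕ} (Y : (Fin n → ℕ) → ℝ) (hY : ∀ δ, ∑ i, δ i = s → 0 ≤ Y δ)
    (φ : (Fin n → ℕ) → (Fin n → ℕ))
    (hφ : ∀ α : Fin n → ℕ, ∑ i, α i = 2 * s →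
      ∑ i, φ α i = s ∧ ∀ i, α i ≤ 2 * φ α i + 1 ∧ 2 * φ α i ≤ α i + 1)
    {t : ℝ} (ht : 0 < t) (ht1 : t ≤ 1) :
    ∑ α ∈ piAntidiag univ (2 * s), extractionConst α * Y (φ α) ≤
      9 ^ s * (3 ^ s * (1 + t) ^ n / t ^ s) *
        ∑ δ ∈ piAntidiag univ s, Y δ / ∏ i, ((δ i).factorial : ℝ) := by
  have hmem : ∀ {k : ℕ} {α : Fin n → ℕ}, α ∈ piAntidiag univ k ↔ ∑ i, α i = k := by
    intro k α; simp [mem_piAntidiag]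
  calc ∑ α ∈ piAntidiag univ (2 * s), extractionConst α * Y (φ α)
      ≤ ∑ α ∈ piAntidiag univ (2 * s),
          9 ^ s * (Y (φ α) / ∏ i, ((φ α i).factorial : ℝ)) := by
        refine Finset.sum_le_sum fun α hα => ?_
        have hα' := hmem.mp hα
        have := extractionConst_le hα' fun i => ((hφ α hα').2 i).2
        calc _ ≤ (9 ^ s / ∏ i, ((φ α i).factorial : ℝ)) * Y (φ α) :=
              mul_le_mul_of_nonneg_right this (hY _ (hφ α hα').1)
          _ = _ := by ring
    _ = 9 ^ s * ∑ δ ∈ piAntidiag univ s, ∑ α ∈ piAntidiag univ (2 * s) with φ α = δ,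
          (Y (φ α) / ∏ i, ((φ α i).factorial : ℝ)) := by
        rw [← Finset.mul_sum, Finset.sum_fiberwise_of_maps_to]
        intro α hα
        exact hmem.mpr (hφ α (hmem.mp hα)).1
    _ ≤ 9 ^ s * ∑ δ ∈ piAntidiag univ s, (3 ^ s * (1 + t) ^ n / t ^ s) *
          (Y δ / ∏ i, ((δ i).factorial : ℝ)) := by
        gcongr with δ hδ
        have hδ' := hmem.mp hδ
        have e1 : ∑ α ∈ piAntidiag univ (2 * s) with φ α = δ,
            (Y (φ α) / ∏ i, ((φ α i).factorial : ℝ)) =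
            (#{α ∈ piAntidiag univ (2 * s) | φ α = δ} : ℝ) *
              (Y δ / ∏ i, ((δ i).factorial : ℝ)) := by
          rw [← nsmul_eq_mul, ← Finset.sum_const]
          refine Finset.sum_congr rfl fun α hα => ?_
          rw [(Finset.mem_filter.mp hα).2]
        rw [e1]
        refine mul_le_mul_of_nonneg_right ?_
          (div_nonneg (hY _ hδ') (Finset.prod_nonneg fun _ _ => by positivity))
        refine (card_balanced_le δ hδ' ht ht1).trans' ?_
        norm_cast
        refine Finset.card_le_card_of_injOn (fun α i => α i - δ i) ?_ ?_
        · intro α hα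
          obtain ⟨hα1, rfl⟩ := Finset.mem_filter.mp hα
          have hα2 := hmem.mp hα1
          obtain ⟨h1, h2⟩ := hφ α hα2
          refine Finset.mem_coe.mpr (Finset.mem_filter.mpr
            ⟨Fintype.mem_piFinset.mpr fun i => Finset.mem_Icc.mpr ?_, ?_⟩)
          · have := h2 i
            dsimp only
            omega
          · change ∑ i, (α i - φ α i) = s
            have : ∑ i, (α i - φ α i) + ∑ i, φ α i = ∑ i, α i := by
              rw [← Finset.sum_add_distrib]
              refine Finset.sum_congr rfl fun i _ => ?_
              have := h2 i; omega
            omega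
        · intro α hα β hβ hab
          obtain ⟨hα1, hα2⟩ := Finset.mem_filter.mp hα
          obtain ⟨hβ1, hβ2⟩ := Finset.mem_filter.mp hβ
          obtain ⟨-, h2⟩ := hφ α (hmem.mp hα1)
          obtain ⟨-, h3⟩ := hφ β (hmem.mp hβ1)
          funext i
          have e1 := congrFun hab i
          have e2 := congrFun hα2 i
          have e3 := congrFun hβ2 i
          have e4 := h2 i
          have e5 := h3 i
          simp only at e1
          omega
    _ = _ := by rw [← Finset.mul_sum, mul_assoc]

/-- The number of odd exponents is even because the total is; half of them are rounded up in one
part and the remaining ones in the other. -/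
lemma exists_balanced_splitting {n s : ℕ} (α : Fin n → ℕ) (hα : ∑ i, α i = 2 * s) :
    ∃ δ δ' : Fin n → ℕ, (∀ i, δ i + δ' i = α i) ∧ (∑ i, δ i = s ∧ ∀ i, α i ≤ 2 * δ i + 1 ∧
      2 * δ i ≤ α i + 1) ∧ (∑ i, δ' i = s ∧ ∀ i, α i ≤ 2 * δ' i + 1 ∧ 2 * δ' i ≤ α i + 1) := by
  classical
  set O : Finset (Fin n) := univ.filter fun i => α i % 2 = 1 with hO
  have hsum : ∑ i, α i = 2 * ∑ i, α i / 2 + #O := by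
    rw [hO, Finset.card_filter, Finset.mul_sum, ← Finset.sum_add_distrib]
    refine Finset.sum_congr rfl fun i _ => ?_
    split_ifs <;> omega
  obtain ⟨S, hS, hcard⟩ := Finset.exists_subset_card_eq (s := O) (n := #O / 2) (by omega)
  have hSO : ∀ i, i ∈ S → α i % 2 = 1 := fun i hi => (Finset.mem_filter.mp (hS hi)).2
  have hδ : ∑ i, (α i / 2 + if i ∈ S then 1 else 0) = s := by
    rw [Finset.sum_add_distrib, ← Finset.card_filter]
    simp only [Finset.filter_univ_mem]
    omega
  have hadd : ∀ i, (α i / 2 + if i ∈ S then 1 else 0) +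
      (α i - (α i / 2 + if i ∈ S then 1 else 0)) = α i := by
    intro i
    have := hSO i
    split_ifs with h
    · have := this h; omega
    · omega
  refine ⟨fun i => α i / 2 + if i ∈ S then 1 else 0,
    fun i => α i - (α i / 2 + if i ∈ S then 1 else 0), hadd, ⟨hδ, fun i => ?_⟩, ?_, fun i => ?_⟩
  · have := hSO i
    dsimp only
    split_ifs with h
    · have := this h; omega
    · omega
  · have h1 := Finset.sum_congr rfl (fun i (_ : i ∈ univ) => hadd i)
    rw [Finset.sum_add_distrib, hδ, hα] at h1
    dsimp only
    omega
  · have := hSO i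
    dsimp only
    split_ifs with h
    · have := this h; omega
    · omega

/-! ### Pseudo-expectations -/

section PseudoExpectation

variable {n q : ℕ} {E : MvPolynomial (Fin n) ℝ →ₗ[ℝ] ℝ}

lemma totalDegree_sum_X_sq_pow_le (k : ℕ) :
    ((∑ i : Fin n, (X i : MvPolynomial (Fin n) ℝ) ^ 2) ^ k).totalDegree ≤ 2 * k := by
  have h : (∑ i : Fin n, (X i : MvPolynomial (Fin n) ℝ) ^ 2).IsHomogeneous 2 :=
    IsHomogeneous.sum _ _ _ fun i _ => isHomogeneous_X_pow i 2
  exact (h.pow k).totalDegree_le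

lemma IsPseudoExpectation.mul_sum_X_sq_pow (hE : IsPseudoExpectation q E)
    (p : MvPolynomial (Fin n) ℝ) (k : ℕ) (h : p.totalDegree + 2 * k ≤ q) :
    E (p * (∑ i, X i ^ 2) ^ k) = E p := by
  induction k with
  | zero => simp
  | succ k ih =>
    have h1 := hE.sphere (p * (∑ i, X i ^ 2) ^ k) (by
      have := totalDegree_mul p ((∑ i : Fin n, (X i : MvPolynomial (Fin n) ℝ) ^ 2) ^ k)
      have := totalDegree_sum_X_sq_pow_le (n := n) k
      omega)
    rw [mul_sub, mul_one, map_sub, sub_eq_zero, mul_assoc, ← pow_succ] at h1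
    rw [h1, ih (by omega)]

/-- The factor `h` need not be a square: nonnegativity against the two squares `(u ± v) ^ 2` is all
that the expansion uses. -/
lemma abs_apply_mul_mul_le {u v h : MvPolynomial (Fin n) ℝ}
    (h1 : 0 ≤ E ((u + v) ^ 2 * h)) (h2 : 0 ≤ E ((u - v) ^ 2 * h)) :
    |E (u * v * h)| ≤ (E (u ^ 2 * h) + E (v ^ 2 * h)) / 2 := by
  have e1 : E ((u + v) ^ 2 * h) = E (u ^ 2 * h) + 2 * E (u * v * h) + E (v ^ 2 * h) := by
    have : (u + v) ^ 2 * h = u ^ 2 * h + (2 : ℝ) • (u * v * h) + v ^ 2 * h := by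
      rw [Algebra.smul_def, map_ofNat]; ring
    rw [this, map_add, map_add, map_smul, smul_eq_mul]
  have e2 : E ((u - v) ^ 2 * h) = E (u ^ 2 * h) - 2 * E (u * v * h) + E (v ^ 2 * h) := by
    have : (u - v) ^ 2 * h = u ^ 2 * h - (2 : ℝ) • (u * v * h) + v ^ 2 * h := by
      rw [Algebra.smul_def, map_ofNat]; ring
    rw [this, map_add, map_sub, map_smul, smul_eq_mul]
  rw [abs_le]
  constructor <;> linarith

/-- Multinomial expansion of `E (‖x‖ ^ (2s)) = 1`, divided by `s!`. -/
lemma IsPseudoExpectation.sum_monomial_sq (hE : IsPseudoExpectation q E) {s : ℕ}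
    (hs : 2 * s ≤ q) :
    ∑ δ ∈ piAntidiag univ s, E ((∏ i, X i ^ δ i) ^ 2) / ∏ i, ((δ i).factorial : ℝ) =
      1 / s.factorial := by
  have h1 := hE.mul_sum_X_sq_pow 1 s (by simpa using hs)
  rw [hE.one, one_mul, Finset.sum_pow_eq_sum_piAntidiag, map_sum] at h1
  rw [eq_div_iff (by positivity), ← h1, Finset.sum_mul]
  refine Finset.sum_congr rfl fun δ hδ => ?_
  have hsum : ∑ i, δ i = s := by simpa [mem_piAntidiag] using hδ
  have h2 := Nat.multinomial_spec univ δ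
  rw [hsum] at h2
  have h3 : ((∏ i, ((δ i).factorial : ℝ)) * Nat.multinomial univ δ) = s.factorial := by
    exact_mod_cast h2
  have h4 : ((Nat.multinomial univ δ : MvPolynomial (Fin n) ℝ) *
      ∏ i, ((X i : MvPolynomial (Fin n) ℝ) ^ 2) ^ δ i) =
      (Nat.multinomial univ δ : ℝ) • (∏ i, X i ^ δ i) ^ 2 := by
    rw [Algebra.smul_def, map_natCast, ← Finset.prod_pow]
    congr 1
    exact Finset.prod_congr rfl fun i _ => pow_right_comm _ _ _
  rw [h4, map_smul, smul_eq_mul, ← h3]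
  have : (∏ i, ((δ i).factorial : ℝ)) ≠ 0 :=
    Finset.prod_ne_zero_iff.mpr fun i _ => by positivity
  field_simp

lemma totalDegree_prod_X_pow_le (δ : Fin n → ℕ) :
    (∏ i, (X i : MvPolynomial (Fin n) ℝ) ^ δ i).totalDegree ≤ ∑ i, δ i :=
  (IsHomogeneous.prod univ _ _ fun i _ => isHomogeneous_X_pow i (δ i)).totalDegree_le

/-- The point of the net with numerators `k` for the exponent `α`. -/
def netPoint (α k : Fin n → ℕ) (i : Fin n) : ℝ := k i * (1 / Real.sqrt (α i))

/-- The step `1 / √(α i)` puts the outermost node at `√(α i)`, which keeps the squared norm of the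
nodes at most `2 * s` and makes the weight comparable to the reciprocal factorials of the halves of
`α`. Where `α i = 0` the only node is `0` and the convention `1 / √0 = 0` is harmless. -/
lemma coeff_eq_sum_diffWeight {s : ℕ} {H : MvPolynomial (Fin n) (MvPolynomial (Fin n) ℝ)}
    (hH : H.IsHomogeneous (2 * s)) (α : Fin n → ℕ) (hα : ∑ i, α i = 2 * s) :
    coeff (Finsupp.equivFunOnFinite.symm α) H = extractionConst α •
      ∑ k ∈ Fintype.piFinset (fun i => range (α i + 1)),
        diffWeight α k • eval (fun i => C (netPoint α k i)) H := by
  have h := sum_diffWeight_smul_eval H hH α hα (fun i => 1 / Real.sqrt (α i))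
  rw [MvPolynomial.algebraMap_eq] at h
  unfold netPoint
  rw [h, smul_smul]
  have : extractionConst α * ∏ i, ((α i).factorial * (1 / Real.sqrt (α i)) ^ α i : ℝ) = 1 := by
    rw [extractionConst, ← Finset.prod_mul_distrib]
    refine Finset.prod_eq_one fun i _ => ?_
    rcases Nat.eq_zero_or_pos (α i) with h0 | h0
    · simp [h0]
    · have : Real.sqrt (α i) ≠ 0 := by positivity
      have : ((α i).factorial : ℝ) ≠ 0 := by positivity
      rw [one_div, inv_pow]
      field_simp
  rw [this, one_smul]

/-- Under `E` and against squares, every net value of `H` behaves like a number between `0` and `K`.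
The factor `4 ^ s` is the total mass of the difference weights, `9 ^ s` comes from
`extractionConst`, the factor with `t` counts splittings, and `1 / s!` is `sum_monomial_sq`. -/
theorem IsPseudoExpectation.eval_X_le (hE : IsPseudoExpectation q E) {s : ℕ} (hs : 2 * s ≤ q)
    {K : ℝ} (hK0 : 0 ≤ K) {H : MvPolynomial (Fin n) (MvPolynomial (Fin n) ℝ)}
    (hH : H.IsHomogeneous (2 * s))
    (hK : ∀ α k : Fin n → ℕ, ∑ i, α i = 2 * s → (∀ i, k i ≤ α i) →
      ∀ u : MvPolynomial (Fin n) ℝ, u.totalDegree ≤ s →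
        0 ≤ E (u ^ 2 * eval (fun i => C (netPoint α k i)) H) ∧
        E (u ^ 2 * eval (fun i => C (netPoint α k i)) H) ≤ K * E (u ^ 2))
    {t : ℝ} (ht : 0 < t) (ht1 : t ≤ 1) :
    E (eval X H) ≤ K * 4 ^ s * (9 ^ s * (3 ^ s * (1 + t) ^ n / t ^ s)) / s.factorial := by
  have hmem : ∀ {k : ℕ} {α : Fin n → ℕ}, α ∈ piAntidiag univ k ↔ ∑ i, α i = k := by
    intro k α; simp [mem_piAntidiag]
  set Y : (Fin n → ℕ) → ℝ := fun δ => E ((∏ i, X i ^ δ i) ^ 2) with hYdef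
  choose! φ ψ hadd hφ hψ using exists_balanced_splitting (n := n) (s := s)
  have hterm : ∀ α : Fin n → ℕ, ∑ i, α i = 2 * s →
      E (coeff (Finsupp.equivFunOnFinite.symm α) H * ∏ i, X i ^ α i) ≤
        4 ^ s * K / 2 * (extractionConst α * Y (φ α) + extractionConst α * Y (ψ α)) := by
    intro α hα
    set u : MvPolynomial (Fin n) ℝ := ∏ i, X i ^ φ α i with hu
    set v : MvPolynomial (Fin n) ℝ := ∏ i, X i ^ ψ α i with hv
    have hdu : u.totalDegree ≤ s := (totalDegree_prod_X_pow_le _).trans (hφ α hα).1.le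
    have hdv : v.totalDegree ≤ s := (totalDegree_prod_X_pow_le _).trans (hψ α hα).1.le
    have huv : ∏ i, (X i : MvPolynomial (Fin n) ℝ) ^ α i = u * v := by
      rw [hu, hv, ← Finset.prod_mul_distrib]
      exact Finset.prod_congr rfl fun i _ => by rw [← pow_add, hadd α hα i]
    -- The product `u * v` is not a square, so the bounds on `H` at a node enter only through the
    -- inequality between geometric and arithmetic mean.
    have hb : ∀ k ∈ Fintype.piFinset (fun i => range (α i + 1)),
        |E (u * v * eval (fun i => C (netPoint α k i)) H)| ≤ K * (Y (φ α) + Y (ψ α)) / 2 := by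
      intro k hk
      have hk' : ∀ i, k i ≤ α i := fun i => by
        have := Fintype.mem_piFinset.mp hk i
        simp at this; omega
      have := abs_apply_mul_mul_le
        (hK α k hα hk' (u + v) ((totalDegree_add _ _).trans (max_le hdu hdv))).1
        (hK α k hα hk' (u - v) ((totalDegree_sub _ _).trans (max_le hdu hdv))).1
      have h1 := (hK α k hα hk' u hdu).2
      have h2 := (hK α k hα hk' v hdv).2
      simp only [hYdef]
      linarith
    have e1 : E (coeff (Finsupp.equivFunOnFinite.symm α) H * ∏ i, X i ^ α i) =
        extractionConst α * ∑ k ∈ Fintype.piFinset (fun i => range (α i + 1)),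
          diffWeight α k * E (u * v * eval (fun i => C (netPoint α k i)) H) := by
      rw [coeff_eq_sum_diffWeight hH α hα, huv, smul_mul_assoc, map_smul, smul_eq_mul,
        Finset.sum_mul, map_sum]
      congr 1
      refine Finset.sum_congr rfl fun k _ => ?_
      rw [smul_mul_assoc, map_smul, smul_eq_mul, mul_comm (eval _ H)]
    rw [e1]
    have e2 : ∑ k ∈ Fintype.piFinset (fun i => range (α i + 1)),
          diffWeight α k * E (u * v * eval (fun i => C (netPoint α k i)) H) ≤
        4 ^ s * (K * (Y (φ α) + Y (ψ α)) / 2) := by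
      have h4 : (4 : ℝ) ^ s = ∑ k ∈ Fintype.piFinset (fun i => range (α i + 1)),
          |diffWeight α k| := by
        rw [sum_abs_diffWeight, hα, pow_mul]; norm_num
      rw [h4, Finset.sum_mul]
      refine Finset.sum_le_sum fun k hk => (le_abs_self _).trans ?_
      rw [abs_mul]
      exact mul_le_mul_of_nonneg_left (hb k hk) (abs_nonneg _)
    calc _ ≤ extractionConst α * (4 ^ s * (K * (Y (φ α) + Y (ψ α)) / 2)) :=
          mul_le_mul_of_nonneg_left e2 (extractionConst_nonneg α)
      _ = _ := by ring
  have hsum : E (eval X H) = ∑ α ∈ piAntidiag univ (2 * s),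
      E (coeff (Finsupp.equivFunOnFinite.symm α) H * ∏ i, X i ^ α i) := by
    rw [eval_eq', map_sum]
    have hsub : H.support ⊆ (piAntidiag univ (2 * s)).map
        (Finsupp.equivFunOnFinite (α := Fin n) (M := ℕ)).symm.toEmbedding := by
      intro β hβ
      refine Finset.mem_map.mpr ⟨Finsupp.equivFunOnFinite β, hmem.mpr ?_, by simp⟩
      have := hH (mem_support_iff.mp hβ)
      rw [Finsupp.weight_apply, Finsupp.sum_fintype _ _ (by simp)] at this
      simpa using this
    rw [Finset.sum_subset hsub, Finset.sum_map]
    · simp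
    · intro β _ hβ
      rw [notMem_support_iff.mp hβ, zero_mul, map_zero]
  have hYnn : ∀ δ : Fin n → ℕ, ∑ i, δ i = s → 0 ≤ Y δ := fun δ hδ =>
    hE.sq_nonneg _ (by have := totalDegree_prod_X_pow_le δ; omega)
  have h1 := sum_extractionConst_mul_le Y hYnn φ hφ ht ht1
  have h2 := sum_extractionConst_mul_le Y hYnn ψ hψ ht ht1
  rw [hE.sum_monomial_sq hs] at h1 h2
  rw [hsum]
  calc _ ≤ ∑ α ∈ piAntidiag univ (2 * s),
        4 ^ s * K / 2 * (extractionConst α * Y (φ α) + extractionConst α * Y (ψ α)) :=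
        Finset.sum_le_sum fun α hα => hterm α (hmem.mp hα)
    _ = 4 ^ s * K / 2 * (∑ α ∈ piAntidiag univ (2 * s), extractionConst α * Y (φ α) +
          ∑ α ∈ piAntidiag univ (2 * s), extractionConst α * Y (ψ α)) := by
        rw [← Finset.mul_sum, Finset.sum_add_distrib]
    _ ≤ 4 ^ s * K / 2 * (9 ^ s * (3 ^ s * (1 + t) ^ n / t ^ s) * (1 / s.factorial) +
          9 ^ s * (3 ^ s * (1 + t) ^ n / t ^ s) * (1 / s.factorial)) := by gcongr
    _ = _ := by ring

end PseudoExpectation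

end SphereOpt
end

noncomputable section
namespace SphereOpt
open MvPolynomial Finset Matrix

/-! ### Quadratic forms under a pseudo-expectation -/

/-- The quadratic form of a matrix, as a polynomial. -/
def quadForm {n : ℕ} (A : Matrix (Fin n) (Fin n) ℝ) : MvPolynomial (Fin n) ℝ :=
  ∑ i, ∑ j, C (A i j) * (X i * X j)

lemma quadForm_isHomogeneous {n : ℕ} (A : Matrix (Fin n) (Fin n) ℝ) :
    (quadForm A).IsHomogeneous 2 :=
  IsHomogeneous.sum _ _ _ fun i _ => IsHomogeneous.sum _ _ _ fun j _ =>
    ((isHomogeneous_X ℝ i).mul (isHomogeneous_X ℝ j)).C_mul _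

lemma quadForm_add {n : ℕ} (A B : Matrix (Fin n) (Fin n) ℝ) :
    quadForm (A + B) = quadForm A + quadForm B := by
  simp only [quadForm, Matrix.add_apply, C_add, add_mul, Finset.sum_add_distrib]

lemma quadForm_neg {n : ℕ} (A : Matrix (Fin n) (Fin n) ℝ) :
    quadForm (-A) = -quadForm A := by
  simp only [quadForm, Matrix.neg_apply, C_neg, neg_mul, Finset.sum_neg_distrib]

lemma quadForm_smul_one {n : ℕ} (c : ℝ) :
    quadForm (c • (1 : Matrix (Fin n) (Fin n) ℝ)) = C c * ∑ i, X i ^ 2 := by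
  simp only [quadForm, Matrix.smul_apply, Matrix.one_apply, smul_eq_mul, mul_ite, mul_one,
    mul_zero, apply_ite C, C_0, ite_mul, zero_mul]
  simp [Finset.mul_sum, sq]

lemma quadForm_eq_sum_sq {n : ℕ} {A : Matrix (Fin n) (Fin n) ℝ} (hA : A.PosSemidef) :
    ∃ (m : ℕ) (l : Fin m → MvPolynomial (Fin n) ℝ), (∀ k, (l k).totalDegree ≤ 1) ∧
      quadForm A = ∑ k, l k ^ 2 := by
  obtain ⟨m, v, rfl⟩ := Matrix.posSemidef_iff_eq_sum_vecMulVec.mp hA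
  refine ⟨m, fun k => ∑ i, C (v k i) * X i, fun k => ?_, ?_⟩
  · exact (IsHomogeneous.sum _ _ _ fun i _ => (isHomogeneous_X ℝ i).C_mul _).totalDegree_le
  · simp only [quadForm, Matrix.sum_apply, Matrix.vecMulVec_apply, map_sum, Finset.sum_mul, sq,
      star_trivial, C_mul]
    simp only [Finset.mul_sum]
    rw [Finset.sum_congr rfl fun i _ => Finset.sum_comm, Finset.sum_comm]
    refine Finset.sum_congr rfl fun k _ => ?_
    rw [Finset.sum_comm]
    refine Finset.sum_congr rfl fun i _ => Finset.sum_congr rfl fun j _ => ?_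
    ring

lemma posSemidef_smul_one_add {n : ℕ} {A : Matrix (Fin n) (Fin n) ℝ} (hA : A.IsSymm) {c : ℝ}
    (h : ∀ y, |y ⬝ᵥ (A *ᵥ y)| ≤ c * (y ⬝ᵥ y)) : (c • (1 : Matrix (Fin n) (Fin n) ℝ) + A).PosSemidef := by
  refine .of_dotProduct_mulVec_nonneg ?_ fun y => ?_
  · rw [Matrix.IsHermitian, Matrix.conjTranspose_eq_transpose_of_trivial, Matrix.transpose_add,
      hA.eq]
    simp
  · have := (abs_le.mp (h y)).1
    simp only [star_trivial, Matrix.add_mulVec, Matrix.smul_mulVec, Matrix.one_mulVec,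
      dotProduct_add, dotProduct_smul, smul_eq_mul]
    linarith

section

variable {n q : ℕ} {E : MvPolynomial (Fin n) ℝ →ₗ[ℝ] ℝ}

/-- Both `c * ‖x‖² + Q` and `c * ‖x‖² - Q` are sums of squares of linear forms, so their product `c²
* ‖x‖⁴ - Q²` is a sum of squares; under `E` the factor `‖x‖⁴` is `1`. -/
lemma IsPseudoExpectation.sq_mul_quadForm_sq_le (hE : IsPseudoExpectation q E)
    {A : Matrix (Fin n) (Fin n) ℝ} (hA : A.IsSymm) {c : ℝ}
    (h : ∀ y, |y ⬝ᵥ (A *ᵥ y)| ≤ c * (y ⬝ᵥ y)) (w : MvPolynomial (Fin n) ℝ)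
    (hw : 2 * (w.totalDegree + 2) ≤ q) :
    E (w ^ 2 * quadForm A ^ 2) ≤ c ^ 2 * E (w ^ 2) := by
  obtain ⟨m, l, hl, hl'⟩ := quadForm_eq_sum_sq (posSemidef_smul_one_add hA h)
  obtain ⟨m', l', hd, hd'⟩ := quadForm_eq_sum_sq (posSemidef_smul_one_add (A := -A)
    (by rw [Matrix.IsSymm, Matrix.transpose_neg, hA.eq]) (c := c)
    (fun y => by rw [Matrix.neg_mulVec, dotProduct_neg, abs_neg]; exact h y))
  rw [quadForm_add, quadForm_smul_one] at hl' hd'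
  rw [quadForm_neg] at hd'
  have h1 : 0 ≤ E (w ^ 2 * ((∑ k, l k ^ 2) * ∑ k, l' k ^ 2)) := by
    rw [Finset.sum_mul_sum, Finset.mul_sum, map_sum]
    refine Finset.sum_nonneg fun k _ => ?_
    rw [Finset.mul_sum, map_sum]
    refine Finset.sum_nonneg fun k' _ => ?_
    have : w ^ 2 * (l k ^ 2 * l' k' ^ 2) = (w * (l k * l' k')) ^ 2 := by ring
    rw [this]
    refine hE.sq_nonneg _ ?_
    have := totalDegree_mul w (l k * l' k')
    have := totalDegree_mul (l k) (l' k')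
    have := hl k
    have := hd k'
    omega
  have h2 : E (w ^ 2 * (∑ i, X i ^ 2) ^ 2) = E (w ^ 2) :=
    hE.mul_sum_X_sq_pow _ 2 (by have := totalDegree_pow w 2; omega)
  have h3 : w ^ 2 * ((∑ k, l k ^ 2) * ∑ k, l' k ^ 2) =
      (c ^ 2) • (w ^ 2 * (∑ i, X i ^ 2) ^ 2) - w ^ 2 * quadForm A ^ 2 := by
    rw [← hl', ← hd', Algebra.smul_def, MvPolynomial.algebraMap_eq, C_pow]
    ring
  rw [h3, map_sub, map_smul, smul_eq_mul, h2] at h1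
  linarith

lemma IsPseudoExpectation.sq_mul_quadForm_pow_le (hE : IsPseudoExpectation q E)
    {A : Matrix (Fin n) (Fin n) ℝ} (hA : A.IsSymm) {c : ℝ}
    (h : ∀ y, |y ⬝ᵥ (A *ᵥ y)| ≤ c * (y ⬝ᵥ y)) (u : MvPolynomial (Fin n) ℝ) (l : ℕ)
    (hu : 2 * (u.totalDegree + 2 * l) ≤ q) :
    0 ≤ E (u ^ 2 * quadForm A ^ (2 * l)) ∧
      E (u ^ 2 * quadForm A ^ (2 * l)) ≤ c ^ (2 * l) * E (u ^ 2) := by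
  have hdeg : ∀ j, (u * quadForm A ^ j).totalDegree ≤ u.totalDegree + 2 * j := fun j => by
    have := totalDegree_mul u (quadForm A ^ j)
    have := ((quadForm_isHomogeneous A).pow j).totalDegree_le
    omega
  have hsq : ∀ j, u ^ 2 * quadForm A ^ (2 * j) = (u * quadForm A ^ j) ^ 2 := fun j => by ring
  constructor
  · rw [hsq]
    exact hE.sq_nonneg _ (by have := hdeg l; omega)
  · induction l with
    | zero => simp
    | succ l ih =>
      have h1 := hE.sq_mul_quadForm_sq_le hA h (u * quadForm A ^ l)
        (by have := hdeg l; omega)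
      have h2 : u ^ 2 * quadForm A ^ (2 * (l + 1)) =
          (u * quadForm A ^ l) ^ 2 * quadForm A ^ 2 := by ring
      rw [h2]
      refine h1.trans ?_
      rw [← hsq]
      calc c ^ 2 * E (u ^ 2 * quadForm A ^ (2 * l)) ≤ c ^ 2 * (c ^ (2 * l) * E (u ^ 2)) :=
            mul_le_mul_of_nonneg_left (ih (by omega)) (_root_.sq_nonneg c)
        _ = _ := by ring

end

/-! ### Power iteration -/

section LogConvex

variable {a : ℕ → ℝ}

/-- The ratios of successive terms increase, so a bound for the last ratio holds for all of them.
Products replace quotients because terms may vanish. -/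
lemma le_pow_mul_of_logConvex (h0 : ∀ k, 0 ≤ a k) (h : ∀ k, a (k + 1) ^ 2 ≤ a k * a (k + 2))
    {c : ℝ} (hc : 0 ≤ c) (N : ℕ) (hN : a (N + 1) ≤ c * a N) :
    a (N + 1) ≤ c ^ (N + 1) * a 0 := by
  induction N with
  | zero => simpa using hN
  | succ N ih =>
    have h1 : a (N + 1) ≤ c * a N := by
      rcases (h0 (N + 1)).eq_or_lt with h2 | h2
      · rw [← h2]; exact mul_nonneg hc (h0 N)
      · have h3 := h N
        have h4 : a (N + 1) * a (N + 1) ≤ (c * a N) * a (N + 1) := by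
          nlinarith [mul_le_mul_of_nonneg_left hN (h0 N)]
        exact le_of_mul_le_mul_right h4 h2
    calc a (N + 1 + 1) ≤ c * a (N + 1) := hN
      _ ≤ c * (c ^ (N + 1) * a 0) := mul_le_mul_of_nonneg_left (ih h1) hc
      _ = _ := by ring

/-- The first ratio `a 1 / a 0` is the smallest one, and `a (N + 1) / a 0` is a product of `N + 1`
ratios. -/
lemma pow_le_of_logConvex (h0 : ∀ k, 0 ≤ a k) (h : ∀ k, a (k + 1) ^ 2 ≤ a k * a (k + 2))
    (N : ℕ) : a 1 ^ (N + 1) ≤ a (N + 1) * a 0 ^ N := by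
  have h1 : ∀ k, a 1 * a k ≤ a 0 * a (k + 1) := by
    intro k
    induction k with
    | zero => rw [mul_comm]
    | succ k ih =>
      rcases (h0 k).eq_or_lt with h2 | h2
      · have h3 := h k
        rw [← h2, zero_mul] at h3
        have h4 : a (k + 1) = 0 := by nlinarith [sq_nonneg (a (k + 1))]
        rw [h4, mul_zero]
        exact mul_nonneg (h0 0) (h0 _)
      · have h3 : (a 1 * a (k + 1)) * a k ≤ (a 0 * a (k + 1 + 1)) * a k := by
          nlinarith [mul_le_mul_of_nonneg_right ih (h0 (k + 1)),
            mul_le_mul_of_nonneg_left (h k) (h0 0)]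
        exact le_of_mul_le_mul_right h3 h2
  induction N with
  | zero => simp
  | succ N ih =>
    calc a 1 ^ (N + 1 + 1) = a 1 ^ (N + 1) * a 1 := pow_succ _ _
      _ ≤ (a (N + 1) * a 0 ^ N) * a 1 := mul_le_mul_of_nonneg_right ih (h0 1)
      _ = (a 1 * a (N + 1)) * a 0 ^ N := by ring
      _ ≤ (a 0 * a (N + 1 + 1)) * a 0 ^ N :=
          mul_le_mul_of_nonneg_right (h1 _) (pow_nonneg (h0 0) _)
      _ = _ := by ring

end LogConvex

section PowerIteration

variable {n : ℕ}

lemma dotProduct_self_nonneg' (y : Fin n → ℝ) : 0 ≤ y ⬝ᵥ y :=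
  Finset.sum_nonneg fun i _ => mul_self_nonneg (y i)

lemma dotProduct_sq_le (x y : Fin n → ℝ) : (x ⬝ᵥ y) ^ 2 ≤ (x ⬝ᵥ x) * (y ⬝ᵥ y) := by
  simpa [dotProduct, sq] using Finset.sum_mul_sq_le_sq_mul_sq univ x y

/-- By symmetry one factor `A` moves across the inner product, `‖A^(k+1) y‖² = ⟨A^k y, A^(k+2) y⟩`;
then Cauchy–Schwarz. -/
lemma iterate_mulVec_logConvex {A : Matrix (Fin n) (Fin n) ℝ} (hA : A.IsSymm) (y : Fin n → ℝ)
    (k : ℕ) :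
    ((A *ᵥ ·)^[k + 1] y ⬝ᵥ (A *ᵥ ·)^[k + 1] y) ^ 2 ≤
      ((A *ᵥ ·)^[k] y ⬝ᵥ (A *ᵥ ·)^[k] y) * ((A *ᵥ ·)^[k + 2] y ⬝ᵥ (A *ᵥ ·)^[k + 2] y) := by
  have h : ∀ z w : Fin n → ℝ, (A *ᵥ z) ⬝ᵥ w = z ⬝ᵥ (A *ᵥ w) := by
    intro z w
    rw [dotProduct_mulVec, ← Matrix.mulVec_transpose, hA.eq]
  have h1 : (A *ᵥ ·)^[k + 1] y ⬝ᵥ (A *ᵥ ·)^[k + 1] y =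
      (A *ᵥ ·)^[k] y ⬝ᵥ (A *ᵥ ·)^[k + 2] y := by
    rw [Function.iterate_succ_apply' _ (k + 1), Function.iterate_succ_apply' _ k, h]
  rw [h1]
  exact dotProduct_sq_le _ _

lemma iterate_mulVec_eq_sum (A : Matrix (Fin n) (Fin n) ℝ) (k : ℕ) (y : Fin n → ℝ) :
    (A *ᵥ ·)^[k] y = ∑ j, y j • (A *ᵥ ·)^[k] (Pi.single j 1) := by
  have h : ∀ z, (A *ᵥ ·)^[k] z = (A ^ k) *ᵥ z := by
    induction k with
    | zero => simp
    | succ k ih =>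
      intro z
      rw [Function.iterate_succ_apply', ih, pow_succ', ← Matrix.mulVec_mulVec]
  simp_rw [h]
  ext i
  simp [Matrix.mulVec, dotProduct, mul_comm]

/-- If the last step of each iteration stretches by at most `c`, log-convexity gives `‖A^(n+1) e_j‖
≤ c^(n+1)` for each basis vector, hence a bound on `‖A^(n+1) y‖` with a loss of `√n`. Log-convexity
at `y` then takes the root of order `n + 1`, which shrinks this loss to a constant. -/
lemma dotProduct_mulVec_le_of_powerIteration {A : Matrix (Fin n) (Fin n) ℝ} (hA : A.IsSymm)
    {c : ℝ} (hc : 0 ≤ c)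
    (h : ∀ j, (A *ᵥ ·)^[n + 1] (Pi.single j 1) ⬝ᵥ (A *ᵥ ·)^[n + 1] (Pi.single j 1) ≤
      c ^ 2 * ((A *ᵥ ·)^[n] (Pi.single j 1) ⬝ᵥ (A *ᵥ ·)^[n] (Pi.single j 1))) (y : Fin n → ℝ) :
    |y ⬝ᵥ (A *ᵥ y)| ≤ 2 * c * (y ⬝ᵥ y) := by
  have h1 : ∀ j, (A *ᵥ ·)^[n + 1] (Pi.single j 1) ⬝ᵥ (A *ᵥ ·)^[n + 1] (Pi.single j 1) ≤
      (c ^ 2) ^ (n + 1) := fun j => by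
    simpa using le_pow_mul_of_logConvex
      (a := fun k => (A *ᵥ ·)^[k] (Pi.single j 1) ⬝ᵥ (A *ᵥ ·)^[k] (Pi.single j 1))
      (fun k => dotProduct_self_nonneg' _) (iterate_mulVec_logConvex hA _)
      (_root_.sq_nonneg c) n (h j)
  have h2 : (A *ᵥ ·)^[n + 1] y ⬝ᵥ (A *ᵥ ·)^[n + 1] y ≤ n * (c ^ 2) ^ (n + 1) * (y ⬝ᵥ y) := by
    rw [iterate_mulVec_eq_sum]
    calc _ ≤ ∑ i, (∑ j, y j ^ 2) * ∑ j, ((A *ᵥ ·)^[n + 1] (Pi.single j 1) i) ^ 2 := by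
          refine Finset.sum_le_sum fun i _ => ?_
          simp only [Finset.sum_apply, Pi.smul_apply, smul_eq_mul, ← sq]
          exact Finset.sum_mul_sq_le_sq_mul_sq _ _ _
      _ = (y ⬝ᵥ y) * ∑ j, ((A *ᵥ ·)^[n + 1] (Pi.single j 1) ⬝ᵥ
            (A *ᵥ ·)^[n + 1] (Pi.single j 1)) := by
          rw [← Finset.mul_sum, Finset.sum_comm]
          simp only [dotProduct, sq]
      _ ≤ (y ⬝ᵥ y) * ∑ _j : Fin n, (c ^ 2) ^ (n + 1) :=
          mul_le_mul_of_nonneg_left (Finset.sum_le_sum fun j _ => h1 j)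
            (dotProduct_self_nonneg' y)
      _ = _ := by simp; ring
  have h3 := pow_le_of_logConvex
      (a := fun k => (A *ᵥ ·)^[k] y ⬝ᵥ (A *ᵥ ·)^[k] y)
      (fun k => dotProduct_self_nonneg' _) (iterate_mulVec_logConvex hA _) n
  have h4 : (A *ᵥ y) ⬝ᵥ (A *ᵥ y) ≤ 4 * c ^ 2 * (y ⬝ᵥ y) := by
    have hy := dotProduct_self_nonneg' y
    refine le_of_pow_le_pow_left₀ (n := n + 1) (by omega) (by positivity) ?_
    calc ((A *ᵥ y) ⬝ᵥ (A *ᵥ y)) ^ (n + 1)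
        ≤ ((A *ᵥ ·)^[n + 1] y ⬝ᵥ (A *ᵥ ·)^[n + 1] y) * (y ⬝ᵥ y) ^ n := h3
      _ ≤ (n * (c ^ 2) ^ (n + 1) * (y ⬝ᵥ y)) * (y ⬝ᵥ y) ^ n :=
          mul_le_mul_of_nonneg_right h2 (pow_nonneg hy _)
      _ = n * (c ^ 2 * (y ⬝ᵥ y)) ^ (n + 1) := by rw [mul_pow]; ring
      -- The loss `n` is for squared norms, so `n ≤ 4 ^ (n + 1)` becomes the factor `2` in the
      -- conclusion.
      _ ≤ 4 ^ (n + 1) * (c ^ 2 * (y ⬝ᵥ y)) ^ (n + 1) := by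
          gcongr
          have : n ≤ 4 ^ (n + 1) :=
            (Nat.lt_pow_self (by norm_num)).le.trans (Nat.pow_le_pow_right (by norm_num) n.le_succ)
          exact_mod_cast this
      _ = _ := by rw [← mul_pow]; ring
  have hy := dotProduct_self_nonneg' y
  refine abs_le_of_sq_le_sq ?_ (by positivity)
  calc (y ⬝ᵥ (A *ᵥ y)) ^ 2 ≤ (y ⬝ᵥ y) * ((A *ᵥ y) ⬝ᵥ (A *ᵥ y)) := dotProduct_sq_le _ _
    _ ≤ (y ⬝ᵥ y) * (4 * c ^ 2 * (y ⬝ᵥ y)) := mul_le_mul_of_nonneg_left h4 hy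
    _ = _ := by ring

end PowerIteration

/-! ### Symmetric tensors -/

section Tensor

variable {n d : ℕ}

/-- The multilinear form of a tensor. -/
def tensorForm (T : (Fin d → Fin n) → ℝ) (v : Fin d → Fin n → ℝ) : ℝ :=
  ∑ I, T I * ∏ j, v j (I j)

lemma tensorForm_comp_perm {T : (Fin d → Fin n) → ℝ}
    (hT : ∀ (σ : Equiv.Perm (Fin d)) I, T (I ∘ σ) = T I) (σ : Equiv.Perm (Fin d))
    (v : Fin d → Fin n → ℝ) : tensorForm T (v ∘ σ) = tensorForm T v := by
  unfold tensorForm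
  refine Fintype.sum_equiv (Equiv.arrowCongr σ (Equiv.refl _)) _ _ fun I => ?_
  have h1 : (Equiv.arrowCongr σ (Equiv.refl (Fin n))) I = I ∘ σ.symm := rfl
  rw [h1, hT]
  congr 1
  exact Fintype.prod_equiv σ _ _ fun j => by simp

lemma tensorForm_smul (T : (Fin d → Fin n) → ℝ) (c : Fin d → ℝ) (v : Fin d → Fin n → ℝ) :
    tensorForm T (fun j => c j • v j) = (∏ j, c j) * tensorForm T v := by
  simp only [tensorForm, Pi.smul_apply, smul_eq_mul, Finset.prod_mul_distrib, Finset.mul_sum]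
  exact Finset.sum_congr rfl fun I _ => by ring

/-- The polarization identity. -/
lemma tensorForm_polarization {T : (Fin d → Fin n) → ℝ}
    (hT : ∀ (σ : Equiv.Perm (Fin d)) I, T (I ∘ σ) = T I) (v : Fin d → Fin n → ℝ) :
    ∑ U : Finset (Fin d), (-1 : ℝ) ^ #U * tensorForm T (fun _ => ∑ j ∈ Uᶜ, v j) =
      d.factorial * tensorForm T v := by
  classical
  -- Multilinearity: a choice `φ` of one vector per slot contributes to the term of `U` exactly when
  -- its image avoids `U`.
  have h1 : ∀ U : Finset (Fin d), tensorForm T (fun _ => ∑ j ∈ Uᶜ, v j) =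
      ∑ φ : Fin d → Fin d, if U ⊆ (univ.image φ)ᶜ then tensorForm T (v ∘ φ) else 0 := by
    intro U
    rw [← Finset.sum_filter]
    have h2 : (univ.filter fun φ : Fin d → Fin d => U ⊆ (univ.image φ)ᶜ) =
        Fintype.piFinset fun _ => Uᶜ := by
      ext φ
      simp only [Finset.mem_filter, Finset.mem_univ, true_and, Fintype.mem_piFinset,
        Finset.mem_compl, Finset.subset_iff, Finset.mem_image, not_exists]
      exact ⟨fun h k hk => h hk k rfl, fun h x hx k hk => h k (hk ▸ hx)⟩
    rw [h2]
    simp only [tensorForm, Finset.sum_apply, Function.comp]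
    rw [Finset.sum_comm]
    refine Finset.sum_congr rfl fun I _ => ?_
    rw [Finset.prod_univ_sum (fun _ => Uᶜ) (fun k j => v j (I k)), Finset.mul_sum]
  -- The signs cancel over the subsets of the complement of the image unless this complement is
  -- empty, that is, unless `φ` is a permutation.
  have h3 : ∀ φ : Fin d → Fin d, ∑ U : Finset (Fin d), (-1 : ℝ) ^ #U *
      (if U ⊆ (univ.image φ)ᶜ then tensorForm T (v ∘ φ) else 0) =
      if Function.Bijective φ then tensorForm T v else 0 := by
    intro φ
    have h4 : ∑ U : Finset (Fin d), (-1 : ℝ) ^ #U *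
      (if U ⊆ (univ.image φ)ᶜ then tensorForm T (v ∘ φ) else 0) =
        (∑ U ∈ (univ.image φ)ᶜ.powerset, (-1 : ℝ) ^ #U) * tensorForm T (v ∘ φ) := by
      rw [Finset.sum_mul]
      simp only [mul_ite, mul_zero]
      rw [← Finset.sum_filter]
      refine Finset.sum_congr ?_ fun _ _ => rfl
      ext U; simp
    have h5 : (∑ U ∈ (univ.image φ)ᶜ.powerset, (-1 : ℝ) ^ #U) =
        if (univ.image φ)ᶜ = ∅ then 1 else 0 := by
      have := Finset.sum_powerset_neg_one_pow_card (x := (univ.image φ)ᶜ)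
      exact_mod_cast congrArg (Int.cast : ℤ → ℝ) this
    rw [h4, h5]
    have h6 : (univ.image φ)ᶜ = ∅ ↔ Function.Bijective φ := by
      have : univ.image φ = univ ↔ Function.Surjective φ := by
        simp [Finset.eq_univ_iff_forall, Function.Surjective]
      rw [Finset.compl_eq_empty_iff, this]
      exact ⟨fun h => ⟨Finite.injective_iff_surjective.mpr h, h⟩, fun h => h.2⟩
    simp only [h6]
    split_ifs with h
    · rw [one_mul]
      exact tensorForm_comp_perm hT (Equiv.ofBijective φ h) v
    · simp
  simp_rw [h1, Finset.mul_sum]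
  rw [Finset.sum_comm]
  simp_rw [h3]
  rw [← Finset.sum_filter, Finset.sum_const, nsmul_eq_mul]
  congr 2
  rw [← Fintype.card_subtype, Fintype.card_congr (Equiv.ofBijective
    (fun σ : Equiv.Perm (Fin d) => (⟨σ, σ.bijective⟩ : {φ : Fin d → Fin d // Function.Bijective φ}))
    ⟨fun σ τ h => Equiv.coe_fn_injective (congrArg Subtype.val h),
      fun φ => ⟨Equiv.ofBijective φ.1 φ.2, rfl⟩⟩).symm, Fintype.card_perm, Fintype.card_fin]

/-- The Euclidean norm of a tuple. -/
def tupleNorm (w : Fin n → ℝ) : ℝ := Real.sqrt (∑ i, w i * w i)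

/-- The normalization of a tuple (`0` for the zero tuple). -/
def unitize (w : Fin n → ℝ) : Fin n → ℝ := fun i => w i / tupleNorm w

lemma tupleNorm_eq (w : Fin n → ℝ) : tupleNorm w = ‖WithLp.toLp 2 w‖ := by
  rw [EuclideanSpace.norm_eq, tupleNorm]
  simp [sq]

lemma tupleNorm_nonneg (w : Fin n → ℝ) : 0 ≤ tupleNorm w := Real.sqrt_nonneg _

lemma tupleNorm_sq (w : Fin n → ℝ) : tupleNorm w ^ 2 = w ⬝ᵥ w :=
  Real.sq_sqrt (dotProduct_self_nonneg' w)

lemma eq_zero_of_tupleNorm_eq_zero {w : Fin n → ℝ} (h : tupleNorm w = 0) : w = 0 := by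
  rw [tupleNorm_eq, norm_eq_zero] at h
  exact (WithLp.toLp_eq_zero 2).mp h

lemma unitize_eq_smul (w : Fin n → ℝ) : unitize w = (tupleNorm w)⁻¹ • w := by
  funext i
  simp [unitize, div_eq_inv_mul]

lemma tupleNorm_smul_unitize (w : Fin n → ℝ) : tupleNorm w • unitize w = w := by
  by_cases h : tupleNorm w = 0
  · rw [h, zero_smul, eq_zero_of_tupleNorm_eq_zero h]
  · rw [unitize_eq_smul, smul_inv_smul₀ h]

lemma tupleNorm_smul (c : ℝ) (w : Fin n → ℝ) : tupleNorm (c • w) = |c| * tupleNorm w := by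
  rw [tupleNorm_eq, tupleNorm_eq, WithLp.toLp_smul, norm_smul, Real.norm_eq_abs]

lemma tupleNorm_unitize {w : Fin n → ℝ} (h : w ≠ 0) : tupleNorm (unitize w) = 1 := by
  have : tupleNorm w ≠ 0 := fun h0 => h (eq_zero_of_tupleNorm_eq_zero h0)
  rw [unitize_eq_smul, tupleNorm_smul, abs_inv, abs_of_nonneg (tupleNorm_nonneg w),
    inv_mul_cancel₀ this]

lemma unitize_zero : unitize (0 : Fin n → ℝ) = 0 := by
  funext i; simp [unitize]

lemma tupleNorm_unitize_le (w : Fin n → ℝ) : tupleNorm (unitize w) ≤ 1 := by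
  by_cases h : w = 0
  · rw [h, unitize_zero]; simp [tupleNorm]
  · exact (tupleNorm_unitize h).le

lemma tupleNorm_sum_le {ι : Type*} (s : Finset ι) (v : ι → Fin n → ℝ) :
    tupleNorm (∑ j ∈ s, v j) ≤ ∑ j ∈ s, tupleNorm (v j) := by
  simp only [tupleNorm_eq]
  rw [WithLp.toLp_sum]
  exact norm_sum_le _ _

/-- Polarization has `2 ^ d` terms; a partial sum of the `v j` has norm at most `d`, so each term is
at most `d ^ d * V`. Division by `d!` leaves at most `2 ^ d * 3 ^ d`. -/
lemma abs_tensorForm_le_of_combinations {T : (Fin d → Fin n) → ℝ}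
    (hT : ∀ (σ : Equiv.Perm (Fin d)) I, T (I ∘ σ) = T I) {v : Fin d → Fin n → ℝ}
    (hv : ∀ j, tupleNorm (v j) ≤ 1) {V : ℝ} (hV0 : 0 ≤ V)
    (hV : ∀ S : Finset (Fin d), |tensorForm T (fun _ => unitize (∑ j ∈ S, v j))| ≤ V) :
    |tensorForm T v| ≤ 6 ^ d * V := by
  have h1 : ∀ S : Finset (Fin d), |tensorForm T (fun _ => ∑ j ∈ S, v j)| ≤ d ^ d * V := by
    intro S
    have h2 : tupleNorm (∑ j ∈ S, v j) ≤ d := by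
      calc _ ≤ ∑ j ∈ S, tupleNorm (v j) := tupleNorm_sum_le _ _
        _ ≤ ∑ j ∈ S, (1 : ℝ) := Finset.sum_le_sum fun j _ => hv j
        _ ≤ d := by
            simp only [Finset.sum_const, nsmul_eq_mul, mul_one]
            exact_mod_cast (Finset.card_le_univ S).trans_eq (Fintype.card_fin d)
    have h3 := tensorForm_smul T (fun _ => tupleNorm (∑ j ∈ S, v j))
      (fun _ => unitize (∑ j ∈ S, v j))
    simp only [tupleNorm_smul_unitize] at h3
    rw [h3, abs_mul, Finset.prod_const, Finset.card_univ, Fintype.card_fin,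
      abs_of_nonneg (pow_nonneg (tupleNorm_nonneg _) _)]
    exact mul_le_mul (pow_le_pow_left₀ (tupleNorm_nonneg _) h2 d) (hV S) (abs_nonneg _)
      (by positivity)
  have h2 := tensorForm_polarization hT v
  have h3 : (d.factorial : ℝ) * |tensorForm T v| ≤ 2 ^ d * (d ^ d * V) := by
    have : (d.factorial : ℝ) * |tensorForm T v| = |(d.factorial : ℝ) * tensorForm T v| := by
      rw [abs_mul, Nat.abs_cast]
    rw [this, ← h2]
    calc _ ≤ ∑ U : Finset (Fin d), |(-1 : ℝ) ^ #U * tensorForm T (fun _ => ∑ j ∈ Uᶜ, v j)| :=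
          Finset.abs_sum_le_sum_abs _ _
      _ ≤ ∑ _U : Finset (Fin d), (d ^ d * V : ℝ) := by
          refine Finset.sum_le_sum fun U _ => ?_
          rw [abs_mul, abs_pow, abs_neg, abs_one, one_pow, one_mul]
          exact h1 _
      _ = _ := by simp
  have h4 := pow_self_le_factorial d
  have h5 : (d.factorial : ℝ) * |tensorForm T v| ≤ d.factorial * (6 ^ d * V) := by
    refine h3.trans ?_
    calc (2 : ℝ) ^ d * (d ^ d * V) ≤ 2 ^ d * ((3 ^ d * d.factorial) * V) := by gcongr
      _ = _ := by rw [show (6 : ℝ) = 2 * 3 by norm_num, mul_pow]; ring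
  exact le_of_mul_le_mul_left h5 (by positivity)

end Tensor

end SphereOpt
end

noncomputable section
namespace SphereOpt
open MvPolynomial Finset Matrix

/-! ### The bound on the relaxation by the values at the candidate points -/

lemma sum_univ_snoc {M : Type*} [AddCommMonoid M] {n k : ℕ} (g : (Fin (k + 1) → Fin n) → M) :
    ∑ I, g I = ∑ J : Fin k → Fin n, ∑ i, g (Fin.snoc J i) := by
  rw [← (Fin.snocEquiv fun _ : Fin (k + 1) => Fin n).sum_comp, Fintype.sum_prod_type_right]
  rfl

section

variable {n e : ℕ}

/-- The matrix that a tensor becomes when all slots but the last two are filled with `x`. -/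
def tensorMatrix (T : (Fin (e + 2) → Fin n) → ℝ) (x : Fin n → ℝ) : Matrix (Fin n) (Fin n) ℝ :=
  fun i j => ∑ J : Fin e → Fin n,
    T (Fin.snoc (α := fun _ => Fin n) (Fin.snoc (α := fun _ => Fin n) J i) j) * ∏ k, x (J k)

/-- The vectors that fill the slots of a tensor: `x` except for the last two slots. -/
def slotVec (e : ℕ) (x v u : Fin n → ℝ) : Fin (e + 2) → Fin n → ℝ :=
  fun k => if (k : ℕ) < e then x else if (k : ℕ) = e then v else u

lemma prod_snoc_snoc {M : Type*} [CommMonoid M] (g : Fin (e + 2) → Fin n → M) (J : Fin e → Fin n)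
    (i j : Fin n) : ∏ k, g k ((Fin.snoc (α := fun _ => Fin n)
      (Fin.snoc (α := fun _ => Fin n) J i) j : Fin (e + 2) → Fin n) k) =
      (∏ k : Fin e, g k.castSucc.castSucc (J k)) * g (Fin.last e).castSucc i *
        g (Fin.last (e + 1)) j := by
  rw [Fin.prod_univ_castSucc, Fin.prod_univ_castSucc]
  simp only [Fin.snoc_castSucc, Fin.snoc_last]

lemma tensorForm_slotVec (T : (Fin (e + 2) → Fin n) → ℝ) (x v u : Fin n → ℝ) :
    tensorForm T (slotVec e x v u) = v ⬝ᵥ (tensorMatrix T x *ᵥ u) := by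
  simp only [tensorForm, sum_univ_snoc, prod_snoc_snoc]
  simp only [slotVec, Fin.val_castSucc, Fin.is_lt, if_true, Fin.val_last, lt_irrefl,
    if_false, show ¬ (e + 1 < e) by omega, show e + 1 ≠ e by omega]
  simp only [dotProduct, Matrix.mulVec, tensorMatrix, Finset.mul_sum, Finset.sum_mul]
  rw [Finset.sum_comm]
  refine Finset.sum_congr rfl fun i _ => ?_
  rw [Finset.sum_comm]
  refine Finset.sum_congr rfl fun j _ => Finset.sum_congr rfl fun J _ => ?_
  ring

lemma tensorMatrix_isSymm {T : (Fin (e + 2) → Fin n) → ℝ}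
    (hT : ∀ (σ : Equiv.Perm (Fin (e + 2))) I, T (I ∘ σ) = T I) (x : Fin n → ℝ) :
    (tensorMatrix T x).IsSymm := by
  ext i j
  simp only [Matrix.transpose_apply, tensorMatrix]
  refine Finset.sum_congr rfl fun J _ => ?_
  rw [← hT (Equiv.swap (Fin.last e).castSucc (Fin.last (e + 1)))]
  congr 2
  funext k
  simp only [Function.comp]
  refine Fin.lastCases ?_ (fun k => ?_) k
  · rw [Equiv.swap_apply_right, Fin.snoc_castSucc, Fin.snoc_last, Fin.snoc_last]
  · refine Fin.lastCases ?_ (fun k => ?_) k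
    · rw [Equiv.swap_apply_left, Fin.snoc_castSucc, Fin.snoc_last, Fin.snoc_last]
    · rw [Equiv.swap_apply_of_ne_of_ne]
      · simp only [Fin.snoc_castSucc]
      · exact fun h => (Fin.castSucc_lt_last k).ne (Fin.castSucc_injective _ h)
      · exact (Fin.castSucc_lt_last _).ne

lemma tensorMatrix_smul (T : (Fin (e + 2) → Fin n) → ℝ) (c : ℝ) (x : Fin n → ℝ) :
    tensorMatrix T (c • x) = c ^ e • tensorMatrix T x := by
  ext i j
  simp only [tensorMatrix, Pi.smul_apply, smul_eq_mul, Finset.prod_mul_distrib,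
    Finset.prod_const, Finset.card_univ, Fintype.card_fin, Matrix.smul_apply, Finset.mul_sum]
  exact Finset.sum_congr rfl fun J _ => by ring

/-- The unit vector tried for the net point `x`, the starting vector `j` of the power iteration
and the coefficients `k₁ k₂ k₃`. -/
def candidate (T : (Fin (e + 2) → Fin n) → ℝ) (x : Fin n → ℝ) (j : Fin n) (k₁ k₂ k₃ : ℕ) :
    Fin n → ℝ :=
  let A := tensorMatrix T (unitize x)
  let v := unitize ((A *ᵥ ·)^[n] (Pi.single j 1))
  unitize ((k₁ : ℝ) • v + (k₂ : ℝ) • unitize (A *ᵥ v) + (k₃ : ℝ) • unitize x)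

/-- Only three distinct vectors occupy the slots, so the `2 ^ (e + 2)` partial sums are among `(e +
2) ^ 3` combinations with small natural coefficients. This keeps the list of candidates polynomial
in `d`. -/
lemma exists_sum_slotVec (x v u : Fin n → ℝ) (S : Finset (Fin (e + 2))) :
    ∃ k₁ k₂ k₃ : ℕ, k₁ < e + 2 ∧ k₂ < e + 2 ∧ k₃ < e + 2 ∧
      ∑ j ∈ S, slotVec e x v u j = (k₁ : ℝ) • u + (k₂ : ℝ) • v + (k₃ : ℝ) • x := by
  classical
  rw [← Finset.sum_ite_mem_eq S, Fin.sum_univ_castSucc, Fin.sum_univ_castSucc]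
  simp only [slotVec, Fin.val_castSucc, Fin.is_lt, if_true, Fin.val_last, lt_irrefl,
    if_false, show ¬ (e + 1 < e) by omega, show e + 1 ≠ e by omega]
  refine ⟨if Fin.last (e + 1) ∈ S then 1 else 0, if (Fin.last e).castSucc ∈ S then 1 else 0,
    #{k : Fin e | k.castSucc.castSucc ∈ S}, by split_ifs <;> omega, by split_ifs <;> omega,
    ?_, ?_⟩
  · have := (Finset.card_le_univ {k : Fin e | k.castSucc.castSucc ∈ S}).trans_eq
      (Fintype.card_fin e)
    omega
  · rw [← Finset.sum_filter, Finset.sum_const, ← Nat.cast_smul_eq_nsmul ℝ, add_comm, add_assoc,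
      add_comm (_ • x)]
    split_ifs <;> simp

/-- For `v` produced by power iteration and `u` the direction of `A v`, the length `‖A v‖ = ⟨u, A
v⟩` is the multilinear form with `u` and `v` in the last two slots, so polarization bounds it by
values at candidates. The estimate for power iteration extends this to all `y`, and homogeneity of
degree `e` in `x` restores the length of `x`. -/
lemma abs_dotProduct_tensorMatrix_le {T : (Fin (e + 2) → Fin n) → ℝ}
    (hT : ∀ (σ : Equiv.Perm (Fin (e + 2))) I, T (I ∘ σ) = T I) {x : Fin n → ℝ} {V : ℝ}
    (hV0 : 0 ≤ V) (hV : ∀ j k₁ k₂ k₃, k₁ < e + 2 → k₂ < e + 2 → k₃ < e + 2 →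
      |tensorForm T (fun _ => candidate T x j k₁ k₂ k₃)| ≤ V) (y : Fin n → ℝ) :
    |y ⬝ᵥ (tensorMatrix T x *ᵥ y)| ≤ 2 * (6 ^ (e + 2) * V) * tupleNorm x ^ e * (y ⬝ᵥ y) := by
  set A := tensorMatrix T (unitize x) with hA
  have hsymm : A.IsSymm := tensorMatrix_isSymm hT _
  set c := 6 ^ (e + 2) * V with hc
  have hc0 : 0 ≤ c := by positivity
  have h1 : ∀ j, tupleNorm (A *ᵥ unitize ((A *ᵥ ·)^[n] (Pi.single j 1))) ≤ c := by
    intro j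
    set v := unitize ((A *ᵥ ·)^[n] (Pi.single j 1)) with hv
    set u := unitize (A *ᵥ v) with hu
    have h2 : |tensorForm T (slotVec e (unitize x) u v)| ≤ c := by
      refine abs_tensorForm_le_of_combinations hT (fun k => ?_) hV0 fun S => ?_
      · simp only [slotVec]
        split_ifs
        · exact tupleNorm_unitize_le _
        · exact tupleNorm_unitize_le _
        · exact tupleNorm_unitize_le _
      · obtain ⟨k₁, k₂, k₃, h₁, h₂, h₃, h⟩ := exists_sum_slotVec (unitize x) u v S
        rw [h]
        exact hV j k₁ k₂ k₃ h₁ h₂ h₃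
    rw [tensorForm_slotVec] at h2
    have h3 : u ⬝ᵥ (A *ᵥ v) = tupleNorm (A *ᵥ v) := by
      by_cases h0 : tupleNorm (A *ᵥ v) = 0
      · rw [h0, eq_zero_of_tupleNorm_eq_zero h0, dotProduct_zero]
      · rw [hu, unitize_eq_smul, smul_dotProduct, ← tupleNorm_sq, smul_eq_mul, sq,
          inv_mul_cancel_left₀ h0]
    rw [h3] at h2
    exact (le_abs_self _).trans h2
  have h2 := dotProduct_mulVec_le_of_powerIteration hsymm hc0 (fun j => by
    rw [Function.iterate_succ_apply', ← tupleNorm_sq, ← tupleNorm_sq]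
    have h3 := h1 j
    set w := (A *ᵥ ·)^[n] (Pi.single j 1)
    rw [← tupleNorm_smul_unitize w, Matrix.mulVec_smul, tupleNorm_smul,
      tupleNorm_smul_unitize w, abs_of_nonneg (tupleNorm_nonneg w), mul_pow, mul_comm]
    have := pow_le_pow_left₀ (tupleNorm_nonneg _) h3 2
    exact mul_le_mul_of_nonneg_right this (_root_.sq_nonneg _)) y
  rw [← tupleNorm_smul_unitize x, tensorMatrix_smul, tupleNorm_smul_unitize, Matrix.smul_mulVec,
    dotProduct_smul, smul_eq_mul, abs_mul, abs_of_nonneg (pow_nonneg (tupleNorm_nonneg x) e)]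
  calc _ ≤ tupleNorm x ^ e * (2 * c * (y ⬝ᵥ y)) :=
        mul_le_mul_of_nonneg_left h2 (pow_nonneg (tupleNorm_nonneg x) e)
    _ = _ := by ring

/-- The form of a tensor, with all slots but the last two as outer variables. -/
def splitForm (T : (Fin (e + 2) → Fin n) → ℝ) :
    MvPolynomial (Fin n) (MvPolynomial (Fin n) ℝ) :=
  ∑ J : Fin e → Fin n, ∑ i, ∑ j,
    C (C (T (Fin.snoc (α := fun _ => Fin n) (Fin.snoc (α := fun _ => Fin n) J i) j)) *
      (X i * X j)) * ∏ k, X (J k)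

lemma splitForm_isHomogeneous (T : (Fin (e + 2) → Fin n) → ℝ) :
    (splitForm T).IsHomogeneous e := by
  refine IsHomogeneous.sum _ _ _ fun J _ => IsHomogeneous.sum _ _ _ fun i _ =>
    IsHomogeneous.sum _ _ _ fun j _ => IsHomogeneous.C_mul ?_ _
  have := IsHomogeneous.prod univ (fun k : Fin e => (X (J k) :
    MvPolynomial (Fin n) (MvPolynomial (Fin n) ℝ))) (fun _ => 1) fun k _ => isHomogeneous_X _ _
  simpa using this

lemma eval_X_splitForm (T : (Fin (e + 2) → Fin n) → ℝ) :
    eval X (splitForm T) = ∑ I, C (T I) * ∏ k, X (I k) := by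
  simp only [sum_univ_snoc, splitForm, map_sum, map_mul, map_prod, eval_C, eval_X]
  refine Finset.sum_congr rfl fun J _ => Finset.sum_congr rfl fun i _ =>
    Finset.sum_congr rfl fun j _ => ?_
  rw [prod_snoc_snoc (fun _ => X)]
  ring

lemma eval_C_splitForm (T : (Fin (e + 2) → Fin n) → ℝ) (x : Fin n → ℝ) :
    eval (fun i => C (x i)) (splitForm T) = quadForm (tensorMatrix T x) := by
  simp only [splitForm, map_sum, map_mul, map_prod, eval_C, eval_X, quadForm, tensorMatrix,
    Finset.sum_mul]
  rw [Finset.sum_comm]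
  refine Finset.sum_congr rfl fun i _ => ?_
  rw [Finset.sum_comm]
  refine Finset.sum_congr rfl fun j _ => Finset.sum_congr rfl fun J _ => ?_
  ring

/-- Since `k i ≤ α i`, each coordinate is at most `√(α i)`. -/
lemma tupleNorm_netPoint_sq_le {α k : Fin n → ℕ} (hk : ∀ i, k i ≤ α i) :
    tupleNorm (netPoint α k) ^ 2 ≤ ∑ i, (α i : ℝ) := by
  rw [tupleNorm_sq, dotProduct]
  refine Finset.sum_le_sum fun i _ => ?_
  rw [netPoint]
  rcases Nat.eq_zero_or_pos (α i) with h0 | h0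
  · simp [h0]
  · have h1 : Real.sqrt (α i) * Real.sqrt (α i) = α i := Real.mul_self_sqrt (by positivity)
    have h2 : 0 < Real.sqrt (α i) := by positivity
    have h3 : (k i : ℝ) ≤ α i := by exact_mod_cast hk i
    have h4 : (k i : ℝ) * (1 / Real.sqrt (α i)) ≤ Real.sqrt (α i) := by
      rw [mul_one_div, div_le_iff₀ h2, h1]; exact h3
    calc _ ≤ Real.sqrt (α i) * Real.sqrt (α i) :=
          mul_self_le_mul_self (by positivity) h4
      _ = _ := h1

/-- This is `eval_X_le` for `K = c ^ (2 * l)` and `t = q / n`. The constants: `648 = 6 * 4 * 9 * 3`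
collects the powers with exponent `s`, and `648 ≤ 26²` with `2 * s ≤ q` makes this `26 ^ q`; `(1 + q
/ n) ^ n ≤ 3 ^ q` gives `78 = 26 * 3`; finally `936 = 2 * 6 * 78`, where `2` and `6` come from power
iteration and polarization. -/
theorem IsPseudoExpectation.pow_le {l q : ℕ} {E : MvPolynomial (Fin n) ℝ →ₗ[ℝ] ℝ}
    (hE : IsPseudoExpectation q E) (hq : q = (e + 2) * (2 * l)) (hq0 : 0 < q) (hqn : q ≤ n)
    {T : (Fin (e + 2) → Fin n) → ℝ}
    (hT : ∀ (σ : Equiv.Perm (Fin (e + 2))) I, T (I ∘ σ) = T I) {V : ℝ} (hV0 : 0 ≤ V)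
    (hV : ∀ α k : Fin n → ℕ, ∑ i, α i ≤ q → (∀ i, k i ≤ α i) → (∀ i, α i < n) →
      ∀ j k₁ k₂ k₃, k₁ < e + 2 → k₂ < e + 2 → k₃ < e + 2 →
        |tensorForm T (fun _ => candidate T (netPoint α k) j k₁ k₂ k₃)| ≤ V) :
    E ((∑ I, C (T I) * ∏ k, X (I k)) ^ (2 * l)) ≤
      (936 ^ (e + 2) * V) ^ (2 * l) * ((n : ℝ) / q) ^ (e * l) := by
  obtain ⟨s, hs⟩ : ∃ s, s = e * l := ⟨_, rfl⟩
  rw [← hs]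
  have hqs : q = 2 * s + 2 * (2 * l) := by rw [hq, hs]; ring
  have hl : 0 < l := by
    rcases Nat.eq_zero_or_pos l with h | h
    · rw [h] at hq; omega
    · exact h
  -- The net points for exponents of degree `2 * s` have norm at most `√(2 * s)`.
  set c := 2 * (6 ^ (e + 2) * V) * Real.sqrt (2 * s) ^ e with hc
  have hq0' : (0 : ℝ) < q := by exact_mod_cast hq0
  have hn0' : (0 : ℝ) < n := by exact_mod_cast hq0.trans_le hqn
  have ht : (0 : ℝ) < q / n := by positivity
  have ht1 : (q : ℝ) / n ≤ 1 := by
    rw [div_le_one hn0']; exact_mod_cast hqn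
  have hK : 0 ≤ c ^ (2 * l) := by rw [pow_mul]; positivity
  have hH : (splitForm T ^ (2 * l)).IsHomogeneous (2 * s) := by
    have := (splitForm_isHomogeneous T).pow (2 * l)
    rwa [show e * (2 * l) = 2 * s by rw [hs]; ring] at this
  have hmain := hE.eval_X_le (s := s) (by omega) hK hH (fun α k hα hk u hu => by
    rw [map_pow, eval_C_splitForm]
    refine hE.sq_mul_quadForm_pow_le (tensorMatrix_isSymm hT _) (fun y => ?_) u l (by omega)
    -- Since `2 * s < q ≤ n`, every exponent is below `n`, as a base-`n` digit must be.
    have h1 := abs_dotProduct_tensorMatrix_le hT hV0 (hV α k (by omega) hk (fun i => by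
      have := Finset.single_le_sum (f := α) (fun i _ => Nat.zero_le _) (Finset.mem_univ i)
      omega)) y
    refine h1.trans (mul_le_mul_of_nonneg_right ?_ (dotProduct_self_nonneg' y))
    refine mul_le_mul_of_nonneg_left ?_ (by positivity)
    refine pow_le_pow_left₀ (tupleNorm_nonneg _) (Real.le_sqrt_of_sq_le ?_) e
    refine (tupleNorm_netPoint_sq_le hk).trans_eq ?_
    exact_mod_cast hα) ht ht1
  rw [map_pow, eval_X_splitForm] at hmain
  refine hmain.trans ?_
  have h1 : c ^ (2 * l) = (2 * (6 ^ (e + 2) * V)) ^ (2 * l) * (2 * s : ℝ) ^ s := by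
    rw [hc, mul_pow, ← pow_mul, show e * (2 * l) = 2 * s by rw [hs]; ring, pow_mul _ 2 s,
      Real.sq_sqrt (by positivity)]
  have h2 : (2 * s : ℝ) ^ s / s.factorial ≤ 6 ^ s := by
    rw [div_le_iff₀ (by positivity), mul_pow]
    calc (2 : ℝ) ^ s * s ^ s ≤ 2 ^ s * (3 ^ s * s.factorial) := by
          gcongr; exact pow_self_le_factorial s
      _ = _ := by rw [show (6 : ℝ) = 2 * 3 by norm_num, mul_pow]; ring
  have h3 : (1 + (q : ℝ) / n) ^ n ≤ 3 ^ q := by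
    calc (1 + (q : ℝ) / n) ^ n ≤ Real.exp (q / n) ^ n := by
          gcongr; rw [add_comm]; exact Real.add_one_le_exp _
      _ = Real.exp q := by rw [← Real.exp_nat_mul]; congr 1; field_simp
      _ ≤ 3 ^ q := exp_natCast_le q
  have h4 : (648 : ℝ) ^ s ≤ 26 ^ q := by
    calc (648 : ℝ) ^ s ≤ 676 ^ s := by gcongr; norm_num
      _ = 26 ^ (2 * s) := by rw [pow_mul (26 : ℝ) 2 s]; norm_num
      _ ≤ 26 ^ q := pow_le_pow_right₀ (by norm_num) (by omega)
  have h5 : ((q : ℝ) / n) ^ s ≠ 0 := by positivity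
  calc c ^ (2 * l) * 4 ^ s * (9 ^ s * (3 ^ s * (1 + (q : ℝ) / n) ^ n / (q / n) ^ s)) /
        s.factorial
      = (2 * (6 ^ (e + 2) * V)) ^ (2 * l) * ((2 * s : ℝ) ^ s / s.factorial) *
          (4 ^ s * 9 ^ s * 3 ^ s) * (1 + (q : ℝ) / n) ^ n * (((q : ℝ) / n) ^ s)⁻¹ := by
        rw [h1]; field_simp
    _ ≤ (2 * (6 ^ (e + 2) * V)) ^ (2 * l) * 6 ^ s * (4 ^ s * 9 ^ s * 3 ^ s) * 3 ^ q *
          (((q : ℝ) / n) ^ s)⁻¹ := by gcongr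
    _ = (2 * (6 ^ (e + 2) * V)) ^ (2 * l) * 648 ^ s * 3 ^ q * ((n : ℝ) / q) ^ s := by
        have h6 : (648 : ℝ) ^ s = 6 ^ s * (4 ^ s * 9 ^ s * 3 ^ s) := by
          rw [← mul_pow, ← mul_pow, ← mul_pow]; norm_num
        rw [← inv_pow, inv_div, h6]
        ring
    _ ≤ (2 * (6 ^ (e + 2) * V)) ^ (2 * l) * 26 ^ q * 3 ^ q * ((n : ℝ) / q) ^ s := by gcongr
    _ = (2 * (6 ^ (e + 2) * V)) ^ (2 * l) * 78 ^ q * ((n : ℝ) / q) ^ s := by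
        rw [show (78 : ℝ) = 26 * 3 by norm_num, mul_pow (26 : ℝ) 3 q]; ring
    _ ≤ (2 ^ (e + 2) * (6 ^ (e + 2) * V)) ^ (2 * l) * 78 ^ q * ((n : ℝ) / q) ^ s := by
        gcongr
        exact le_self_pow₀ (by norm_num) (by omega)
    _ = _ := by
        rw [hq, pow_mul 78, ← mul_pow]
        congr 2
        rw [show (936 : ℝ) = 2 * 6 * 78 by norm_num, mul_pow, mul_pow]; ring

end

end SphereOpt
end

noncomputable section
namespace SphereOpt
open MvPolynomial Finset Matrix

/-! ### The symmetric tensor of a form -/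

section

variable {n d : ℕ}

/-- The exponent of the monomial with the index tuple `I`. -/
def expo (I : Fin d → Fin n) : Fin n →₀ ℕ := ∑ j, Finsupp.single (I j) 1

/-- The symmetric tensor of a form of degree `d`. -/
def symTensor (d : ℕ) (f : MvPolynomial (Fin n) ℝ) (I : Fin d → Fin n) : ℝ :=
  f.coeff (expo I) * ((∏ i, ((expo I i).factorial : ℝ)) / d.factorial)

lemma expo_comp_perm (σ : Equiv.Perm (Fin d)) (I : Fin d → Fin n) : expo (I ∘ σ) = expo I :=
  Equiv.sum_comp σ fun j => Finsupp.single (I j) 1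

lemma symTensor_comp_perm (f : MvPolynomial (Fin n) ℝ) (σ : Equiv.Perm (Fin d))
    (I : Fin d → Fin n) : symTensor d f (I ∘ σ) = symTensor d f I := by
  rw [symTensor, expo_comp_perm, symTensor]

lemma expo_snoc (J : Fin d → Fin n) (i : Fin n) :
    expo (Fin.snoc (α := fun _ => Fin n) J i : Fin (d + 1) → Fin n) =
      expo J + Finsupp.single i 1 := by
  rw [expo, Fin.sum_univ_castSucc]
  simp only [Fin.snoc_castSucc, Fin.snoc_last]
  rfl

/-- Induction by Euler's identity `(d + 1) * f = ∑ X i * ∂ᵢ f`: the tensor of `∂ᵢ f` is `d + 1`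
times the slice of the tensor of `f` with last index `i`. -/
lemma eq_sum_symTensor {f : MvPolynomial (Fin n) ℝ} (hf : f.IsHomogeneous d) :
    f = ∑ I : Fin d → Fin n, C (symTensor d f I) * ∏ k, X (I k) := by
  induction d generalizing f with
  | zero =>
    have h0 := totalDegree_eq_zero_iff_eq_C.mp (Nat.le_zero.mp hf.totalDegree_le)
    rw [h0]
    simp [symTensor, expo]
  | succ d ih =>
    have h1 := hf.sum_X_mul_pderiv
    have h2 : ∀ i, pderiv i f = ∑ J : Fin d → Fin n,
        C (symTensor d (pderiv i f) J) * ∏ k, X (J k) := fun i => ih hf.pderiv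
    have h3 : ∀ (J : Fin d → Fin n) i, symTensor d (pderiv i f) J =
        (d + 1) * symTensor (d + 1) f (Fin.snoc (α := fun _ => Fin n) J i) := by
      intro J i
      rw [symTensor, symTensor, coeff_pderiv, expo_snoc]
      have h4 : ∏ k, (((expo J + Finsupp.single i 1 : Fin n →₀ ℕ) k).factorial : ℝ) =
          (∏ k, ((expo J k).factorial : ℝ)) * (expo J i + 1) := by
        rw [← Finset.mul_prod_erase univ _ (Finset.mem_univ i),
          ← Finset.mul_prod_erase univ (fun k => ((expo J k).factorial : ℝ)) (Finset.mem_univ i)]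
        have h5 : ∏ k ∈ univ.erase i, (((expo J + Finsupp.single i 1 : Fin n →₀ ℕ) k).factorial : ℝ)
            = ∏ k ∈ univ.erase i, ((expo J k).factorial : ℝ) := by
          refine Finset.prod_congr rfl fun k hk => ?_
          rw [Finsupp.add_apply, Finsupp.single_eq_of_ne (Finset.ne_of_mem_erase hk), add_zero]
        rw [h5, Finsupp.add_apply, Finsupp.single_eq_same, Nat.factorial_succ]
        push_cast; ring
      rw [h4, Nat.factorial_succ]
      have : (d.factorial : ℝ) ≠ 0 := by positivity
      push_cast
      field_simp
    have h4 : ((d : MvPolynomial (Fin n) ℝ) + 1) * f = (d + 1) *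
        ∑ I : Fin (d + 1) → Fin n, C (symTensor (d + 1) f I) * ∏ k, X (I k) := by
      rw [nsmul_eq_mul] at h1
      push_cast at h1
      rw [← h1, sum_univ_snoc, Finset.mul_sum, Finset.sum_congr rfl fun i _ => by
        rw [h2 i, Finset.mul_sum], Finset.sum_comm]
      refine Finset.sum_congr rfl fun J _ => ?_
      rw [Finset.mul_sum]
      refine Finset.sum_congr rfl fun i _ => ?_
      rw [h3, Fin.prod_univ_castSucc]
      simp only [Fin.snoc_castSucc, Fin.snoc_last, C_mul, C_add, C_1, map_natCast]
      ring
    refine mul_left_cancel₀ ?_ h4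
    have : ((d : MvPolynomial (Fin n) ℝ) + 1) = C ((d : ℝ) + 1) := by simp
    rw [this]
    exact fun h => absurd (C_eq_zero.mp h) (by positivity)

lemma eval_eq_tensorForm {f : MvPolynomial (Fin n) ℝ} (hf : f.IsHomogeneous d)
    (x : Fin n → ℝ) : eval x f = tensorForm (symTensor d f) fun _ => x := by
  conv_lhs => rw [eq_sum_symTensor hf]
  simp [tensorForm]

end

/-! ### Contraction of arrays -/

/-- The contraction of the lowest digit of an array with a vector. -/
def contract (n : ℕ) (v t : ℕ → ℝ) (c : ℕ) : ℝ := ∑ i ∈ range n, v i * t (n * c + i)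

/-- A contraction sums out the lowest base-`n` digit of the cell number, so after `k` of them cell
`c` collects the cells whose digits above the lowest `k` spell `c`. -/
lemma contract_iterate (n k : ℕ) (v t : ℕ → ℝ) (c : ℕ) :
    (contract n v)^[k] t c = ∑ J : Fin k → Fin n,
      t (∑ j, J j * n ^ (j : ℕ) + n ^ k * c) * ∏ j, v (J j) := by
  induction k generalizing c with
  | zero => simp
  | succ k ih =>
    rw [Function.iterate_succ_apply', contract, sum_univ_snoc, Finset.sum_comm,
      Finset.sum_range]
    refine Finset.sum_congr rfl fun i _ => ?_
    rw [ih, Finset.mul_sum]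
    refine Finset.sum_congr rfl fun J _ => ?_
    rw [Fin.sum_univ_castSucc, Fin.prod_univ_castSucc]
    simp only [Fin.snoc_castSucc, Fin.snoc_last, Fin.val_castSucc, Fin.val_last]
    have : ∑ j, (J j : ℕ) * n ^ (j : ℕ) + n ^ k * (n * c + i) =
        ∑ j, (J j : ℕ) * n ^ (j : ℕ) + i * n ^ k + n ^ (k + 1) * c := by ring
    rw [this]
    ring

/-- `t` lists the entries of the tensor `T`. -/
def IsTable {n d : ℕ} (T : (Fin d → Fin n) → ℝ) (t : ℕ → ℝ) : Prop :=
  ∀ I : Fin d → Fin n, t (∑ j, I j * n ^ (j : ℕ)) = T I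

lemma IsTable.contract_iterate_zero {n d : ℕ} {T : (Fin d → Fin n) → ℝ} {t : ℕ → ℝ}
    (h : IsTable T t) (v : ℕ → ℝ) :
    (contract n v)^[d] t 0 = tensorForm T fun _ i => v i := by
  rw [contract_iterate, tensorForm]
  refine Finset.sum_congr rfl fun I _ => ?_
  rw [mul_zero, add_zero, h I]

lemma IsTable.contract_iterate_matrix {n e : ℕ} {T : (Fin (e + 2) → Fin n) → ℝ} {t : ℕ → ℝ}
    (h : IsTable T t) (v : ℕ → ℝ) (i j : Fin n) :
    (contract n v)^[e] t (n * j + i) = tensorMatrix T (fun i => v i) i j := by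
  rw [contract_iterate, tensorMatrix]
  refine Finset.sum_congr rfl fun J _ => ?_
  rw [← h]
  congr 2
  rw [Fin.sum_univ_castSucc, Fin.sum_univ_castSucc]
  simp only [Fin.snoc_castSucc, Fin.snoc_last, Fin.val_castSucc, Fin.val_last]
  ring

/-- Contraction pairs `v` with the row index, the low digit; symmetry turns the transposed product
into the product itself. -/
lemma contract_eq_mulVec {n : ℕ} {A : Matrix (Fin n) (Fin n) ℝ} (hA : A.IsSymm) {a : ℕ → ℝ}
    (ha : ∀ i j : Fin n, a (n * j + i) = A i j) (v : ℕ → ℝ) (j : Fin n) :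
    contract n v a j = (A *ᵥ fun i => v i) j := by
  rw [contract, Finset.sum_range, Matrix.mulVec, dotProduct]
  refine Finset.sum_congr rfl fun i _ => ?_
  rw [ha, ← hA.apply, mul_comm]

end SphereOpt
end

noncomputable section
namespace SphereOpt
open Finset

/-! ### Structured programs -/

/-- Programs whose only loops are counted: `loop i b P` runs `P` with the index register `i` equal
to `0, 1, …` as long as it is below the content of the register `b`. -/
inductive Code where
  | instr (c : Instr)
  | seq (P Q : Code)
  | branch (b : Test) (P Q : Code)
  | loop (i b : ℕ) (P : Code)

local infixr:60 " ;; " => Code.seq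

namespace Code

/-- The translation into programs; register `3` holds the increment of the counters. -/
def compile : Code → Program
  | instr c => .instr c
  | seq P Q => .seq P.compile Q.compile
  | branch b P Q => .branch b P.compile Q.compile
  | loop i b P => .seq (.instr (.natConst i 0)) (.loop (.natLt i b)
      (.seq P.compile (.seq (.instr (.natConst 3 1)) (.instr (.natAdd i i 3)))))

end Code

/-- The increment of a loop counter. -/
def Store.bump (i : ℕ) (s : Store) : Store :=
  (Instr.natAdd i i 3).exec ((Instr.natConst 3 1).exec s)

open Classical in
/-- The effect of a structured program. -/
def Code.den : Code → Store → Store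
  | .instr c, s => c.exec s
  | .seq P Q, s => Q.den (P.den s)
  | .branch b P Q, s => if b.Holds s then P.den s else Q.den s
  | .loop i b P, s =>
      (fun s => (P.den s).bump i)^[s.nreg b] ((Instr.natConst i 0).exec s)

/-- Whether an instruction writes into the index register `i`. -/
def Instr.writesN (i : ℕ) : Instr → Bool
  | .natConst j _ => i == j
  | .natAdd j _ _ => i == j
  | .natSub j _ _ => i == j
  | .natLoad j _ _ => i == j
  | _ => false

/-- Whether an instruction writes into the real register `i`. -/
def Instr.writesR (i : ℕ) : Instr → Bool
  | .realOfNat j _ => i == j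
  | .realAdd j _ _ => i == j
  | .realSub j _ _ => i == j
  | .realMul j _ _ => i == j
  | .realDiv j _ _ => i == j
  | .realSqrt j _ => i == j
  | .realLoad j _ _ => i == j
  | _ => false

/-- Whether an instruction writes into the index array `a`. -/
def Instr.writesNA (a : ℕ) : Instr → Bool
  | .natStore b _ _ => a == b
  | _ => false

/-- Whether an instruction writes into the real array `a`. -/
def Instr.writesRA (a : ℕ) : Instr → Bool
  | .realStore b _ _ => a == b
  | _ => false

namespace Code

def writesN (i : ℕ) : Code → Bool
  | instr c => c.writesN i
  | seq P Q => P.writesN i || Q.writesN i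
  | branch _ P Q => P.writesN i || Q.writesN i
  | loop j _ P => i == j || i == 3 || P.writesN i

def writesR (i : ℕ) : Code → Bool
  | instr c => c.writesR i
  | seq P Q => P.writesR i || Q.writesR i
  | branch _ P Q => P.writesR i || Q.writesR i
  | loop _ _ P => P.writesR i

def writesNA (i : ℕ) : Code → Bool
  | instr c => c.writesNA i
  | seq P Q => P.writesNA i || Q.writesNA i
  | branch _ P Q => P.writesNA i || Q.writesNA i
  | loop _ _ P => P.writesNA i

def writesRA (i : ℕ) : Code → Bool
  | instr c => c.writesRA i
  | seq P Q => P.writesRA i || Q.writesRA i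
  | branch _ P Q => P.writesRA i || Q.writesRA i
  | loop _ _ P => P.writesRA i

end Code

/-- `s'` agrees with `s` wherever `P` does not write. -/
structure Frame (P : Code) (s s' : Store) : Prop where
  nreg : ∀ i, P.writesN i = false → s'.nreg i = s.nreg i
  rreg : ∀ i, P.writesR i = false → s'.rreg i = s.rreg i
  narr : ∀ i, P.writesNA i = false → s'.narr i = s.narr i
  rarr : ∀ i, P.writesRA i = false → s'.rarr i = s.rarr i

lemma Frame.trans {P : Code} {s s' s'' : Store} (h : Frame P s s') (h' : Frame P s' s'') :
    Frame P s s'' :=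
  ⟨fun i hi => (h'.nreg i hi).trans (h.nreg i hi), fun i hi => (h'.rreg i hi).trans (h.rreg i hi),
    fun i hi => (h'.narr i hi).trans (h.narr i hi), fun i hi => (h'.rarr i hi).trans (h.rarr i hi)⟩

lemma Frame.mono {P Q : Code} {s s' : Store} (h : Frame P s s')
    (hN : ∀ i, Q.writesN i = false → P.writesN i = false)
    (hR : ∀ i, Q.writesR i = false → P.writesR i = false)
    (hNA : ∀ i, Q.writesNA i = false → P.writesNA i = false)
    (hRA : ∀ i, Q.writesRA i = false → P.writesRA i = false) : Frame Q s s' :=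
  ⟨fun i hi => h.nreg i (hN i hi), fun i hi => h.rreg i (hR i hi),
    fun i hi => h.narr i (hNA i hi), fun i hi => h.rarr i (hRA i hi)⟩

lemma frame_instr (c : Instr) (s : Store) : Frame (.instr c) s (c.exec s) := by
  constructor <;> intro i hi <;> cases c <;>
    simp_all [Instr.exec, Code.writesN, Code.writesR, Code.writesNA, Code.writesRA,
      Instr.writesN, Instr.writesR, Instr.writesNA, Instr.writesRA, Function.update_of_ne]

lemma frame_init (i b : ℕ) (P : Code) (s : Store) :
    Frame (.loop i b P) s ((Instr.natConst i 0).exec s) := by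
  refine (frame_instr _ s).mono ?_ ?_ ?_ ?_ <;> intro j hj <;>
    simp_all [Code.writesN, Code.writesR, Code.writesNA, Code.writesRA, Instr.writesN,
      Instr.writesR, Instr.writesNA, Instr.writesRA]

lemma frame_bump (i b : ℕ) (P : Code) (s : Store) : Frame (.loop i b P) s (s.bump i) := by
  refine Frame.trans ((frame_instr (.natConst 3 1) s).mono ?_ ?_ ?_ ?_)
    ((frame_instr (.natAdd i i 3) _).mono ?_ ?_ ?_ ?_) <;> intro j hj <;>
    simp_all [Code.writesN, Code.writesR, Code.writesNA, Code.writesRA, Instr.writesN,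
      Instr.writesR, Instr.writesNA, Instr.writesRA]

lemma Code.frame (P : Code) (s : Store) : Frame P s (P.den s) := by
  induction P generalizing s with
  | instr c => exact frame_instr c s
  | seq P Q ihP ihQ =>
    refine Frame.trans ((ihP s).mono ?_ ?_ ?_ ?_) ((ihQ _).mono ?_ ?_ ?_ ?_) <;> intro j hj <;>
      simp_all [Code.writesN, Code.writesR, Code.writesNA, Code.writesRA]
  | branch b P Q ihP ihQ =>
    rw [Code.den]
    split_ifs
    · refine (ihP s).mono ?_ ?_ ?_ ?_ <;> intro j hj <;>
        simp_all [Code.writesN, Code.writesR, Code.writesNA, Code.writesRA]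
    · refine (ihQ s).mono ?_ ?_ ?_ ?_ <;> intro j hj <;>
        simp_all [Code.writesN, Code.writesR, Code.writesNA, Code.writesRA]
  | loop i b P ih =>
    rw [Code.den]
    generalize s.nreg b = k
    induction k with
    | zero => exact frame_init i b P s
    | succ k ihk =>
      rw [Function.iterate_succ_apply']
      refine ihk.trans (Frame.trans ((ih _).mono ?_ ?_ ?_ ?_) (frame_bump i b P _)) <;>
        intro j hj <;>
        simp_all [Code.writesN, Code.writesR, Code.writesNA, Code.writesRA]

@[simp] lemma Store.bump_rreg (i : ℕ) (s : Store) : (s.bump i).rreg = s.rreg := rfl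
@[simp] lemma Store.bump_narr (i : ℕ) (s : Store) : (s.bump i).narr = s.narr := rfl
@[simp] lemma Store.bump_rarr (i : ℕ) (s : Store) : (s.bump i).rarr = s.rarr := rfl

lemma Store.bump_nreg_of_ne {i j : ℕ} (s : Store) (h : j ≠ i) (h3 : j ≠ 3) :
    (s.bump i).nreg j = s.nreg j := by
  simp [Store.bump, Instr.exec, h, h3]

lemma Store.bump_nreg_self {i : ℕ} (s : Store) (h3 : i ≠ 3) :
    (s.bump i).nreg i = s.nreg i + 1 := by
  simp [Store.bump, Instr.exec, h3]

/-- The rule for counted loops. -/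
lemma Code.loop_induction {i b : ℕ} {P : Code} {s : Store} (Inv : ℕ → Store → Prop)
    (hP : P.writesN i = false) (h3 : i ≠ 3)
    (h0 : Inv 0 ((Instr.natConst i 0).exec s))
    (hstep : ∀ k s', k < s.nreg b → s'.nreg i = k → Frame (.loop i b P) s s' → Inv k s' →
      Inv (k + 1) ((P.den s').bump i)) :
    Inv (s.nreg b) ((Code.loop i b P).den s) := by
  rw [Code.den]
  suffices h : ∀ k, k ≤ s.nreg b →
      ((fun s => (P.den s).bump i)^[k] ((Instr.natConst i 0).exec s)).nreg i = k ∧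
      Frame (.loop i b P) s ((fun s => (P.den s).bump i)^[k] ((Instr.natConst i 0).exec s)) ∧
      Inv k ((fun s => (P.den s).bump i)^[k] ((Instr.natConst i 0).exec s)) from
    (h _ le_rfl).2.2
  intro k
  induction k with
  | zero =>
    exact fun _ => ⟨by simp [Instr.exec], frame_init i b P s, h0⟩
  | succ k ih =>
    intro hk
    obtain ⟨h1, h2, h4⟩ := ih (by omega)
    rw [Function.iterate_succ_apply']
    refine ⟨?_, ?_, hstep k _ (by omega) h1 h2 h4⟩
    · rw [Store.bump_nreg_self _ h3, (P.frame _).nreg i hP, h1]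
    · refine h2.trans (Frame.trans ((P.frame _).mono ?_ ?_ ?_ ?_) (frame_bump i b P _)) <;>
        intro j hj <;>
        simp_all [Code.writesN, Code.writesR, Code.writesNA, Code.writesRA]

/-! ### Running times -/

namespace Code

/-- All loop bounds of the program are in the registers `B`, to which it does not write, and the
loop bodies do not write to their counters. -/
def wellBounded (B : List ℕ) : Code → Bool
  | instr c => B.all fun b => !c.writesN b
  | seq P Q => P.wellBounded B && Q.wellBounded B
  | branch _ P Q => P.wellBounded B && Q.wellBounded B
  | loop i b P => B.contains b && !B.contains i && !B.contains 3 && (i != 3) &&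
      !P.writesN i && P.wellBounded B

/-- The nesting depth of the loops. -/
def depth : Code → ℕ
  | instr _ => 0
  | seq P Q => max P.depth Q.depth
  | branch _ P Q => max P.depth Q.depth
  | loop _ _ P => P.depth + 1

/-- A bound for the number of steps when all loops are run once. -/
def weight : Code → ℕ
  | instr _ => 1
  | seq P Q => P.weight + Q.weight
  | branch _ P Q => P.weight + Q.weight + 1
  | loop _ _ P => P.weight + 5

lemma wellBounded_writesN {B : List ℕ} {P : Code} (h : P.wellBounded B = true) {b : ℕ}
    (hb : b ∈ B) : P.writesN b = false := by
  induction P with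
  | instr c =>
    simp only [wellBounded, List.all_eq_true] at h
    simpa [writesN] using h b hb
  | seq P Q ihP ihQ => simp_all [wellBounded, writesN]
  | branch _ P Q ihP ihQ => simp_all [wellBounded, writesN]
  | loop i c P ih =>
    simp only [wellBounded, Bool.and_eq_true, List.contains_iff_mem, Bool.not_eq_true',
      bne_iff_ne] at h
    obtain ⟨⟨⟨⟨⟨h1, h2⟩, h3⟩, h4⟩, h5⟩, h6⟩ := h
    simp only [writesN, ih h6, Bool.or_false, Bool.or_eq_false_iff, beq_eq_false_iff_ne]
    constructor
    · rintro rfl; simp_all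
    · rintro rfl; simp_all

/-- Registers in `B` are never written, so every loop bound stays at most `L`, and nested loops
multiply to `L ^ depth`. The `5` in the weight of a loop is the test and the two counter
instructions of each pass, plus the initialization and the last test. -/
theorem runs_compile {B : List ℕ} {L : ℕ} (hL : 0 < L) (P : Code) (h : P.wellBounded B = true)
    (s : Store) (hs : ∀ b ∈ B, s.nreg b ≤ L) :
    ∃ t, Runs P.compile s (P.den s) t ∧ t ≤ P.weight * L ^ P.depth := by
  induction P generalizing s with
  | instr c => exact ⟨1, .instr c s, by simp [weight, depth]⟩
  | seq P Q ihP ihQ =>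
    simp only [wellBounded, Bool.and_eq_true] at h
    obtain ⟨t, h1, h2⟩ := ihP h.1 s hs
    obtain ⟨u, h3, h4⟩ := ihQ h.2 (P.den s) fun b hb => by
      rw [(P.frame s).nreg b (wellBounded_writesN h.1 hb)]; exact hs b hb
    refine ⟨t + u, .seq h1 h3, ?_⟩
    simp only [weight, depth, add_mul]
    exact Nat.add_le_add
      (h2.trans (Nat.mul_le_mul_left _ (Nat.pow_le_pow_right hL (le_max_left _ _))))
      (h4.trans (Nat.mul_le_mul_left _ (Nat.pow_le_pow_right hL (le_max_right _ _))))
  | branch b P Q ihP ihQ =>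
    simp only [wellBounded, Bool.and_eq_true] at h
    have hp : 1 ≤ L ^ max P.depth Q.depth := Nat.one_le_pow _ _ hL
    by_cases hb : b.Holds s
    · obtain ⟨t, h1, h2⟩ := ihP h.1 s hs
      refine ⟨t + 1, by rw [den, if_pos hb]; exact .branch_true hb h1, ?_⟩
      have := h2.trans (Nat.mul_le_mul_left P.weight
        (Nat.pow_le_pow_right hL (le_max_left P.depth Q.depth)))
      simp only [weight, depth, add_mul, one_mul]
      omega
    · obtain ⟨t, h1, h2⟩ := ihQ h.2 s hs
      refine ⟨t + 1, by rw [den, if_neg hb]; exact .branch_false hb h1, ?_⟩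
      have := h2.trans (Nat.mul_le_mul_left Q.weight
        (Nat.pow_le_pow_right hL (le_max_right P.depth Q.depth)))
      simp only [weight, depth, add_mul, one_mul]
      omega
  | loop i b P ih =>
    have hB := fun {c} (hc : c ∈ B) => wellBounded_writesN h hc
    simp only [wellBounded, Bool.and_eq_true, List.contains_iff_mem, Bool.not_eq_true',
      bne_iff_ne] at h
    obtain ⟨⟨⟨⟨⟨h1, h2⟩, h3⟩, h4⟩, h5⟩, h6⟩ := h
    set step : Store → Store := fun s => (P.den s).bump i with hstep
    set T := P.weight * L ^ P.depth + 3 with hT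
    have hbody : ∀ s', (∀ c ∈ B, s'.nreg c = s.nreg c) → ∃ t,
        Runs (.seq P.compile (.seq (.instr (.natConst 3 1)) (.instr (.natAdd i i 3)))) s'
          (step s') t ∧ t + 1 ≤ T ∧ (∀ c ∈ B, (step s').nreg c = s.nreg c) ∧
          (step s').nreg i = s'.nreg i + 1 := by
      intro s' hs'
      obtain ⟨t, ht, ht'⟩ := ih h6 s' fun c hc => (hs' c hc).trans_le (hs c hc)
      refine ⟨t + (1 + 1), .seq ht (.seq (.instr _ _) (.instr _ _)), by omega, fun c hc => ?_, ?_⟩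
      · have e1 : c ≠ i := by rintro rfl; simp_all
        have e2 : c ≠ 3 := by rintro rfl; simp_all
        rw [hstep]
        dsimp only
        rw [Store.bump_nreg_of_ne _ e1 e2, (P.frame s').nreg c (wellBounded_writesN h6 hc),
          hs' c hc]
      · rw [hstep]
        dsimp only
        rw [Store.bump_nreg_self _ h4, (P.frame s').nreg i h5]
    have hloop : ∀ k s', (∀ c ∈ B, s'.nreg c = s.nreg c) → s'.nreg i + k = s.nreg b →
        ∃ t, Runs (.loop (.natLt i b)
          (.seq P.compile (.seq (.instr (.natConst 3 1)) (.instr (.natAdd i i 3))))) s'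
            (step^[k] s') t ∧ t ≤ k * T + 1 := by
      intro k
      induction k with
      | zero =>
        intro s' hs' hk
        refine ⟨1, .loop_false ?_, by omega⟩
        simp only [Test.Holds, hs' b h1]
        omega
      | succ k ihk =>
        intro s' hs' hk
        obtain ⟨t, ht, ht1, ht2, ht3⟩ := hbody s' hs'
        obtain ⟨u, hu, hu1⟩ := ihk (step s') ht2 (by omega)
        refine ⟨t + u + 1, .loop_true ?_ ht hu, ?_⟩
        · simp only [Test.Holds, hs' b h1]
          omega
        · rw [add_mul]
          omega
    obtain ⟨t, ht, ht'⟩ := hloop (s.nreg b) ((Instr.natConst i 0).exec s) (fun c hc => by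
      have e1 : c ≠ i := by rintro rfl; simp_all
      simp [Instr.exec, e1]) (by simp [Instr.exec])
    refine ⟨1 + t, .seq (.instr _ _) ht, ?_⟩
    have hb := hs b h1
    have hp : 1 ≤ L ^ P.depth := Nat.one_le_pow _ _ hL
    have e1 : s.nreg b * T ≤ L * (P.weight * L ^ P.depth + 3 * L ^ P.depth) := by
      refine Nat.mul_le_mul hb ?_
      rw [hT]; omega
    have e2 : 1 ≤ L ^ (P.depth + 1) := Nat.one_le_pow _ _ hL
    simp only [weight, depth]
    calc 1 + t ≤ L * (P.weight * L ^ P.depth + 3 * L ^ P.depth) + 2 * L ^ (P.depth + 1) := by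
          omega
      _ = _ := by rw [pow_succ]; ring

end Code

end SphereOpt
end

noncomputable section
namespace SphereOpt
open Finset

local infixr:60 " ;; " => Code.seq

/-! ### Subroutines -/

/-- Sets the first `n` cells of the array `a` to `0`. -/
def zeroCode (a : ℕ) : Code :=
  .loop 20 0 (.instr (.realSub 0 0 0) ;; .instr (.realStore a 20 0))

/-- Copies cells from the array `a` to the array `a'`; their number is in register `b`. -/
def copyCode (a a' b : ℕ) : Code :=
  .loop 20 b (.instr (.realLoad 0 a 20) ;; .instr (.realStore a' 20 0))

/-- Replaces the table in the array `w` by its contraction with the vector in the array `v`. -/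
def contractCode (w v : ℕ) : Code :=
  .instr (.natConst 22 0) ;;
  .loop 20 4 (.instr (.realSub 0 0 0) ;;
    .loop 21 0 (.instr (.realLoad 1 v 21) ;; .instr (.realLoad 2 w 22) ;;
      .instr (.realMul 1 1 2) ;; .instr (.realAdd 0 0 1) ;;
      .instr (.natConst 3 1) ;; .instr (.natAdd 22 22 3)) ;;
    .instr (.realStore w 20 0))

/-- Normalizes the vector in the first `n` cells of the array `a`. -/
def normalizeCode (a : ℕ) : Code :=
  .instr (.realSub 0 0 0) ;;
  .loop 20 0 (.instr (.realLoad 1 a 20) ;; .instr (.realMul 1 1 1) ;; .instr (.realAdd 0 0 1)) ;;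
  .instr (.realSqrt 0 0) ;;
  .loop 20 0 (.instr (.realLoad 1 a 20) ;; .instr (.realDiv 1 1 0) ;; .instr (.realStore a 20 1))

lemma zeroCode_spec (a : ℕ) (s : Store) {c : ℕ} (hc : c < s.nreg 0) :
    ((zeroCode a).den s).rarr a c = 0 := by
  have h := Code.loop_induction (i := 20) (b := 0) (s := s)
    (P := .instr (.realSub 0 0 0) ;; .instr (.realStore a 20 0))
    (fun k s' => ∀ c < k, s'.rarr a c = 0) (by simp [Code.writesN, Instr.writesN]) (by decide)
    (by simp) (fun k s' hk hi _ hinv c hc => by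
      simp only [Code.den, Instr.exec, Store.bump_rarr, Function.update_self, sub_self, hi]
      rcases Nat.lt_succ_iff_lt_or_eq.mp hc with h1 | rfl
      · rw [Function.update_of_ne h1.ne, hinv c h1]
      · simp)
  exact h c hc

lemma copyCode_spec {a a' : ℕ} (haa : a ≠ a') {b : ℕ} (s : Store) {c : ℕ} (hc : c < s.nreg b) :
    ((copyCode a a' b).den s).rarr a' c = s.rarr a c := by
  have h := Code.loop_induction (i := 20) (b := b) (s := s)
    (P := .instr (.realLoad 0 a 20) ;; .instr (.realStore a' 20 0))
    (fun k s' => ∀ c < k, s'.rarr a' c = s.rarr a c)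
    (by simp [Code.writesN, Instr.writesN]) (by decide)
    (by simp) (fun k s' hk hi hf hinv c hc => by
      have ha := hf.rarr a (by simpa [Code.writesRA, Instr.writesRA] using haa)
      simp only [Code.den, Instr.exec, Store.bump_rarr, Function.update_self, hi, ha]
      rcases Nat.lt_succ_iff_lt_or_eq.mp hc with h1 | rfl
      · rw [Function.update_of_ne h1.ne, hinv c h1]
      · simp)
  exact h c hc

/-- Working in place is safe: cell `k` is overwritten only after cells `n * k, …, n * k + n - 1`
have been read, and later passes read from `n * (k + 1) ≥ k + 1` on. Register `22` runs through all
cells in order, so no address is ever multiplied out. -/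
lemma contractCode_spec {w v : ℕ} (hwv : v ≠ w) (s : Store) (hn : 0 < s.nreg 0) {c : ℕ}
    (hc : c < s.nreg 4) :
    ((contractCode w v).den s).rarr w c = contract (s.nreg 0) (s.rarr v) (s.rarr w) c := by
  have h := Code.loop_induction (i := 20) (b := 4) (s := (Instr.natConst 22 0).exec s)
    (P := .instr (.realSub 0 0 0) ;;
      .loop 21 0 (.instr (.realLoad 1 v 21) ;; .instr (.realLoad 2 w 22) ;;
        .instr (.realMul 1 1 2) ;; .instr (.realAdd 0 0 1) ;;
        .instr (.natConst 3 1) ;; .instr (.natAdd 22 22 3)) ;;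
      .instr (.realStore w 20 0))
    (fun k s' => s'.nreg 22 = s.nreg 0 * k ∧ (∀ c < k, s'.rarr w c =
      contract (s.nreg 0) (s.rarr v) (s.rarr w) c) ∧ ∀ c, k ≤ c → s'.rarr w c = s.rarr w c)
    (by simp [Code.writesN, Instr.writesN]) (by decide)
    (by simp [Instr.exec]) (fun k s' hk hi hf ⟨h22, hlt, hge⟩ => by
      have hv : s'.rarr v = s.rarr v :=
        hf.rarr v (by simpa [Code.writesRA, Instr.writesRA] using hwv)
      have h0 : s'.nreg 0 = s.nreg 0 := hf.nreg 0 (by simp [Code.writesN, Instr.writesN])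
      set s₁ := (Instr.realSub 0 0 0).exec s' with hs₁
      set Q : Code := .loop 21 0 (.instr (.realLoad 1 v 21) ;; .instr (.realLoad 2 w 22) ;;
        .instr (.realMul 1 1 2) ;; .instr (.realAdd 0 0 1) ;;
        .instr (.natConst 3 1) ;; .instr (.natAdd 22 22 3)) with hQ
      have hinner := Code.loop_induction (i := 21) (b := 0) (s := s₁)
        (P := .instr (.realLoad 1 v 21) ;; .instr (.realLoad 2 w 22) ;;
          .instr (.realMul 1 1 2) ;; .instr (.realAdd 0 0 1) ;;
          .instr (.natConst 3 1) ;; .instr (.natAdd 22 22 3))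
        (fun j r => r.nreg 22 = s.nreg 0 * k + j ∧
          r.rreg 0 = ∑ i ∈ range j, s.rarr v i * s.rarr w (s.nreg 0 * k + i))
        (by simp [Code.writesN, Instr.writesN]) (by decide)
        (by simp [Instr.exec, hs₁, h22]) (fun j r hj hji hr ⟨hr1, hr2⟩ => by
          have e1 : r.rarr v = s.rarr v := by
            rw [hr.rarr v (by simp [Code.writesRA, Instr.writesRA])]; exact hv
          have e2 : r.rarr w = s'.rarr w := hr.rarr w (by simp [Code.writesRA, Instr.writesRA])
          -- The cell about to be read has not been overwritten yet; this needs `n > 0`.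
          have e3 : s.nreg 0 * k + j ≥ k := by nlinarith
          constructor
          · rw [Store.bump_nreg_of_ne _ (by decide) (by decide)]
            simp [Code.den, Instr.exec, hr1]
            ring
          · simp [Code.den, Instr.exec, hr1, hr2, e1, e2, hji, Finset.sum_range_succ,
              hge _ e3])
      have hQf : Frame Q s₁ (Q.den s₁) := Q.frame s₁
      rw [← hQ] at hinner
      have h0' : s₁.nreg 0 = s.nreg 0 := h0
      rw [h0'] at hinner
      have f20 : (Q.den s₁).nreg 20 = k := by
        rw [hQf.nreg 20 (by simp [hQ, Code.writesN, Instr.writesN])]; exact hi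
      have fw : (Q.den s₁).rarr w = s'.rarr w := by
        rw [hQf.rarr w (by simp [hQ, Code.writesRA, Instr.writesRA])]; rfl
      have hden : (Code.den (.instr (.realSub 0 0 0) ;; Q ;; .instr (.realStore w 20 0)) s') =
          (Instr.realStore w 20 0).exec (Q.den s₁) := rfl
      rw [hden]
      refine ⟨?_, fun c hc => ?_, fun c hc => ?_⟩
      · rw [Store.bump_nreg_of_ne _ (by decide) (by decide)]
        simp only [Instr.exec, hinner.1]
        ring
      · simp only [Store.bump_rarr, Instr.exec, Function.update_self, f20, fw, hinner.2]
        rcases Nat.lt_succ_iff_lt_or_eq.mp hc with h1 | rfl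
        · rw [Function.update_of_ne h1.ne, hlt c h1]
        · rw [Function.update_self]; rfl
      · simp only [Store.bump_rarr, Instr.exec, Function.update_self, f20, fw]
        rw [Function.update_of_ne (by omega), hge c (by omega)])
  exact h.2.1 c (by simpa [Instr.exec] using hc)

lemma normalizeCode_spec (a : ℕ) (s : Store) {c : ℕ} (hc : c < s.nreg 0) :
    ((normalizeCode a).den s).rarr a c =
      s.rarr a c / Real.sqrt (∑ i ∈ range (s.nreg 0), s.rarr a i * s.rarr a i) := by
  set s₁ := (Instr.realSub 0 0 0).exec s with hs₁
  set Q : Code := .loop 20 0 (.instr (.realLoad 1 a 20) ;; .instr (.realMul 1 1 1) ;;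
    .instr (.realAdd 0 0 1)) with hQ
  have h1 : (Q.den s₁).rreg 0 = ∑ i ∈ range (s.nreg 0), s.rarr a i * s.rarr a i :=
    Code.loop_induction (i := 20) (b := 0) (s := s₁)
      (P := .instr (.realLoad 1 a 20) ;; .instr (.realMul 1 1 1) ;; .instr (.realAdd 0 0 1))
      (fun k s' => s'.rreg 0 = ∑ i ∈ range k, s.rarr a i * s.rarr a i)
      (by simp [Code.writesN, Instr.writesN]) (by decide)
      (by simp [Instr.exec, hs₁]) (fun k s' hk hi hf hinv => by
        have e1 : s'.rarr a = s.rarr a := hf.rarr a (by simp [Code.writesRA, Instr.writesRA])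
        simp [Code.den, Instr.exec, hi, hinv, e1, Finset.sum_range_succ])
  set s₂ := (Instr.realSqrt 0 0).exec (Q.den s₁) with hs₂
  have hQf : Frame Q s₁ (Q.den s₁) := Q.frame s₁
  have e0 : s₂.nreg 0 = s.nreg 0 := hQf.nreg 0 (by simp [hQ, Code.writesN, Instr.writesN])
  have e1 : s₂.rarr a = s.rarr a := hQf.rarr a (by simp [hQ, Code.writesRA, Instr.writesRA])
  have e2 : s₂.rreg 0 = Real.sqrt (∑ i ∈ range (s.nreg 0), s.rarr a i * s.rarr a i) := by
    rw [hs₂, ← h1]; simp [Instr.exec]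
  have h2 := Code.loop_induction (i := 20) (b := 0) (s := s₂)
      (P := .instr (.realLoad 1 a 20) ;; .instr (.realDiv 1 1 0) ;; .instr (.realStore a 20 1))
      (fun k s' => (∀ c < k, s'.rarr a c = s.rarr a c / s₂.rreg 0) ∧
        ∀ c, k ≤ c → s'.rarr a c = s.rarr a c)
      (by simp [Code.writesN, Instr.writesN]) (by decide)
      (by simp [Instr.exec, e1]) (fun k s' hk hi hf ⟨hlt, hge⟩ => by
        have e3 : s'.rreg 0 = s₂.rreg 0 := hf.rreg 0 (by simp [Code.writesR, Instr.writesR])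
        refine ⟨fun c hc => ?_, fun c hc => ?_⟩
        · simp only [Code.den, Instr.exec, Store.bump_rarr, Function.update_self, hi]
          rcases Nat.lt_succ_iff_lt_or_eq.mp hc with h1 | rfl
          · rw [Function.update_of_ne h1.ne, hlt c h1]
          · simp [hge c le_rfl, e3]
        · simp only [Code.den, Instr.exec, Store.bump_rarr, Function.update_self, hi]
          rw [Function.update_of_ne (by omega), hge c (by omega)])
  rw [e0] at h2
  rw [← e2]
  exact h2.1 c hc

end SphereOpt
end

/-! ### Digits, tensor entries and net points on the machine -/

noncomputable section
namespace SphereOpt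
open Finset

local infixr:60 " ;; " => Code.seq

/-- Puts the power of `n` whose exponent is in register `b` into register `r`. -/
def powCode (r b : ℕ) : Code :=
  .instr (.natConst r 1) ;;
  -- A product with `n` is a repeated addition, and adding the `0` in register `8` moves the result
  -- back.
  .loop 10 b (.instr (.natConst 9 0) ;; .loop 11 0 (.instr (.natAdd 9 9 r)) ;;
    .instr (.natConst 8 0) ;; .instr (.natAdd r 9 8))

lemma powCode_spec {r b : ℕ} (hr : r = 4 ∨ r = 5) (hb : b ≠ r) (s : Store) :
    ((powCode r b).den s).nreg r = s.nreg 0 ^ s.nreg b := by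
  have hr0 : r ≠ 0 ∧ r ≠ 3 ∧ r ≠ 8 ∧ r ≠ 9 ∧ r ≠ 10 ∧ r ≠ 11 := by omega
  obtain ⟨h0, h3, h8, h9, h10, h11⟩ := hr0
  have h := Code.loop_induction (i := 10) (b := b) (s := (Instr.natConst r 1).exec s)
    (P := .instr (.natConst 9 0) ;; .loop 11 0 (.instr (.natAdd 9 9 r)) ;;
      .instr (.natConst 8 0) ;; .instr (.natAdd r 9 8))
    (fun k s' => s'.nreg r = s.nreg 0 ^ k)
    (by simp [Code.writesN, Instr.writesN, h10.symm]) (by decide)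
    (by simp [Instr.exec, h10]) (fun k s' hk hi hf hinv => by
      have e0 : s'.nreg 0 = s.nreg 0 := by
        rw [hf.nreg 0 (by simp [Code.writesN, Instr.writesN, h0.symm])]
        simp [Instr.exec, h0.symm]
      set s₁ := (Instr.natConst 9 0).exec s' with hs₁
      have h1 := Code.loop_induction (i := 11) (b := 0) (s := s₁)
        (P := .instr (.natAdd 9 9 r))
        (fun j r' => r'.nreg 9 = j * s.nreg 0 ^ k)
        (by simp [Code.writesN, Instr.writesN]) (by decide)
        (by simp [Instr.exec, hs₁]) (fun j r' hj hji hr' hinv' => by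
          have e1 : r'.nreg r = s.nreg 0 ^ k := by
            rw [hr'.nreg r (by simp [Code.writesN, Instr.writesN, h9, h11, h3]), hs₁]
            simp [Instr.exec, h9, hinv]
          rw [Store.bump_nreg_of_ne _ (by decide) (by decide)]
          simp [Code.den, Instr.exec, hinv', e1, add_mul])
      have e2 : s₁.nreg 0 = s.nreg 0 := by simp [hs₁, Instr.exec, e0]
      rw [e2] at h1
      rw [Store.bump_nreg_of_ne _ h10 h3, pow_succ, mul_comm, ← h1]
      simp [Code.den, Instr.exec, hs₁])
  have e : ((Instr.natConst r 1).exec s).nreg b = s.nreg b := by simp [Instr.exec, hb]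
  rw [e] at h
  exact h

/-- Tabulates quotients and remainders modulo `n` in the index arrays `0` and `1`. -/
def divModCode : Code :=
  .instr (.natConst 12 0) ;;
  .loop 10 5 (.loop 11 0 (.instr (.natStore 0 12 10) ;; .instr (.natStore 1 12 11) ;;
    .instr (.natConst 3 1) ;; .instr (.natAdd 12 12 3)))

/-- Register `12` counts cells as `n * k + j`, so the two loop counters are its quotient and
remainder. -/
lemma divModCode_spec (s : Store) {c : ℕ} (hc : c < s.nreg 0 * s.nreg 5) :
    (divModCode.den s).narr 0 c = c / s.nreg 0 ∧ (divModCode.den s).narr 1 c = c % s.nreg 0 := by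
  have h := Code.loop_induction (i := 10) (b := 5) (s := (Instr.natConst 12 0).exec s)
    (P := .loop 11 0 (.instr (.natStore 0 12 10) ;; .instr (.natStore 1 12 11) ;;
      .instr (.natConst 3 1) ;; .instr (.natAdd 12 12 3)))
    (fun k s' => s'.nreg 12 = s.nreg 0 * k ∧ ∀ c < s.nreg 0 * k,
      s'.narr 0 c = c / s.nreg 0 ∧ s'.narr 1 c = c % s.nreg 0)
    rfl (by decide) (by simp [Instr.exec]) (fun k s' hk hi hf ⟨h12, hinv⟩ => by
      have e0 : s'.nreg 0 = s.nreg 0 := hf.nreg 0 rfl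
      have h1 := Code.loop_induction (i := 11) (b := 0) (s := s')
        (P := .instr (.natStore 0 12 10) ;; .instr (.natStore 1 12 11) ;;
          .instr (.natConst 3 1) ;; .instr (.natAdd 12 12 3))
        (fun j r => r.nreg 12 = s.nreg 0 * k + j ∧ ∀ c < s.nreg 0 * k + j,
          r.narr 0 c = c / s.nreg 0 ∧ r.narr 1 c = c % s.nreg 0)
        rfl (by decide) (by simpa [Instr.exec, h12] using hinv)
        (fun j r hj hji hr ⟨hr1, hr2⟩ => by
          have e10 : r.nreg 10 = k := (hr.nreg 10 rfl).trans hi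
          constructor
          · rw [Store.bump_nreg_of_ne _ (by decide) (by decide)]
            simp [Code.den, Instr.exec, hr1, add_assoc]
          · intro c hc
            simp only [Code.den, Instr.exec, Store.bump_narr, Function.update_self, hr1, e10, hji]
            rcases Nat.lt_succ_iff_lt_or_eq.mp (show c < (s.nreg 0 * k + j).succ from hc)
              with h1 | rfl
            · simpa [Function.update_of_ne h1.ne] using hr2 c h1
            · have : j < s.nreg 0 := by omega
              have h0 : 0 < s.nreg 0 := by omega
              simp [Nat.mul_add_div h0, Nat.div_eq_of_lt this,
                Nat.mod_eq_of_lt this])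
      rw [e0] at h1
      refine ⟨?_, fun c hc => ?_⟩
      · rw [Store.bump_nreg_of_ne _ (by decide) (by decide), h1.1]; ring
      · exact h1.2 c (by rw [mul_add, mul_one] at hc; exact hc))
  exact h.2 c hc

/-- How often `i` occurs among the first `j` digits of `m`. -/
def digitCount (n m j i : ℕ) : ℕ := ∑ l ∈ range j, if m / n ^ l % n = i then 1 else 0

/-- Reads the next digit of the number in register `12` and updates the counts of the digits and
the weight of the tensor entry. -/
def countCode : Code :=
  .instr (.natLoad 13 1 12) ;; .instr (.natLoad 12 0 12) ;;
  .instr (.natLoad 14 2 13) ;; .instr (.natConst 3 1) ;; .instr (.natAdd 14 14 3) ;;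
  .instr (.natStore 2 13 14) ;; .instr (.realOfNat 1 14) ;; .instr (.realMul 0 0 1) ;;
  .instr (.natAdd 15 11 3) ;; .instr (.realOfNat 1 15) ;; .instr (.realDiv 0 0 1)

/-- Sets the counts of the digits to `0`. -/
def clearCountCode : Code :=
  .loop 20 0 (.instr (.natConst 13 0) ;; .instr (.natStore 2 20 13))

/-- Computes the entry of the symmetric tensor with the number in register `10`. -/
def entryCode : Code :=
  .instr (.natConst 8 0) ;; .instr (.natAdd 12 10 8) ;; clearCountCode ;;
  .instr (.natConst 3 1) ;; .instr (.realOfNat 0 3) ;; .loop 11 1 countCode ;;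
  .instr (.realLoad 1 0 10) ;; .instr (.realMul 0 1 0) ;; .instr (.realStore 2 10 0)

/-- Fills the array `2` with the entries of the symmetric tensor. -/
def tensorCode : Code := .loop 10 4 entryCode

/-- Reading a digit multiplies the product of the factorials of the counts by the new count of that
digit, while `j!` gains the factor `j + 1`; so the weight is maintained by one product and one
quotient per digit. -/
lemma tensorCode_inner (n m d : ℕ) (s : Store) (hn : 0 < n)
    (h1 : s.nreg 1 = d) (h12 : s.nreg 12 = m) (hcnt : ∀ i < n, s.narr 2 i = 0)
    (hr0 : s.rreg 0 = 1)
    (htab : ∀ c ≤ m, s.narr 0 c = c / n ∧ s.narr 1 c = c % n) :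
    ((Code.loop 11 1 countCode).den
        s).rreg 0 = (∏ i ∈ range n, ((digitCount n m d i).factorial : ℝ)) / d.factorial := by
  have h := Code.loop_induction (i := 11) (b := 1) (s := s)
    (P := countCode)
    (fun j r => r.nreg 12 = m / n ^ j ∧ (∀ i < n, r.narr 2 i = digitCount n m j i) ∧
      r.rreg 0 = (∏ i ∈ range n, ((digitCount n m j i).factorial : ℝ)) / j.factorial)
    rfl (by decide) ⟨by simp [Instr.exec, h12], by simpa [Instr.exec, digitCount] using hcnt,
      by simp [Instr.exec, hr0, digitCount]⟩
    (fun j r hj hji hr ⟨hr1, hr2, hr3⟩ => by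
      obtain ⟨ed, em⟩ := htab (m / n ^ j) (Nat.div_le_self _ _)
      have n0 : r.narr 0 = s.narr 0 := hr.narr 0 rfl
      have n1 : r.narr 1 = s.narr 1 := hr.narr 1 rfl
      rw [← n0] at ed
      rw [← n1] at em
      have hlt : m / n ^ j % n < n := Nat.mod_lt _ hn
      have hc := hr2 _ hlt
      have hsucc : ∀ i, digitCount n m (j + 1) i =
          digitCount n m j i + if m / n ^ j % n = i then 1 else 0 := fun i => by
        rw [digitCount, Finset.sum_range_succ]; rfl
      refine ⟨?_, fun i hi => ?_, ?_⟩
      · rw [Store.bump_nreg_of_ne _ (by decide) (by decide), pow_succ, ← Nat.div_div_eq_div_mul,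
          ← ed, ← hr1]
        simp [countCode, Code.den, Instr.exec]
      · rw [hsucc]
        simp only [countCode, Code.den, Instr.exec, Store.bump_narr, Function.update_self,
          Function.update_of_ne, ne_eq, Nat.reduceEqDiff, not_false_eq_true, hr1, em]
        split_ifs with h
        · subst h; simp [hc]
        · rw [Function.update_of_ne (Ne.symm h), hr2 i hi, add_zero]
      · have e1 : ((countCode.den r).bump 11).rreg 0 =
            r.rreg 0 * (digitCount n m j (m / n ^ j % n) + 1) / (j + 1) := by
          simp [countCode, Code.den, Instr.exec, hr1, em, hc, hji]
        have e2 : ∏ i ∈ range n, ((digitCount n m (j + 1) i).factorial : ℝ) =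
            (∏ i ∈ range n, ((digitCount n m j i).factorial : ℝ)) *
              (digitCount n m j (m / n ^ j % n) + 1) := by
          have hmem := Finset.mem_range.mpr hlt
          rw [← Finset.mul_prod_erase _ _ hmem, ← Finset.mul_prod_erase (range n)
            (fun i => ((digitCount n m j i).factorial : ℝ)) hmem, hsucc, if_pos rfl,
            Nat.factorial_succ]
          rw [Finset.prod_congr rfl fun i hi => by
            rw [hsucc, if_neg (Finset.ne_of_mem_erase hi).symm, add_zero]]
          push_cast; ring
        rw [e1, e2, hr3, Nat.factorial_succ]
        push_cast
        have : (j.factorial : ℝ) ≠ 0 := by positivity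
        field_simp)
  rw [h1] at h
  exact h.2.2

lemma tensorCode_spec (n d : ℕ) (s : Store) (h0 : s.nreg 0 = n) (hn : 0 < n) (h1 : s.nreg 1 = d)
    (htab : ∀ c < s.nreg 4, s.narr 0 c = c / n ∧ s.narr 1 c = c % n) {m : ℕ}
    (hm : m < s.nreg 4) :
    (tensorCode.den s).rarr 2 m = s.rarr 0 m *
      ((∏ i ∈ range n, ((digitCount n m d i).factorial : ℝ)) / d.factorial) := by
  have h := Code.loop_induction (i := 10) (b := 4) (s := s) (P := entryCode)
    (fun k s' => ∀ m < k, s'.rarr 2 m = s.rarr 0 m *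
      ((∏ i ∈ range n, ((digitCount n m d i).factorial : ℝ)) / d.factorial))
    rfl (by decide) (by simp) (fun k s' hk hi hf hinv m hm => by
      set s₁ := (Instr.natAdd 12 10 8).exec ((Instr.natConst 8 0).exec s') with hs₁
      have hz : ∀ i < n, (clearCountCode.den s₁).narr 2 i = 0 := by
        have := Code.loop_induction (i := 20) (b := 0) (s := s₁)
          (P := .instr (.natConst 13 0) ;; .instr (.natStore 2 20 13))
          (fun k r => ∀ i < k, r.narr 2 i = 0) rfl (by decide) (by simp)
          (fun k r hk hi _ hr i hik => by
            simp only [Code.den, Instr.exec, Store.bump_narr, Function.update_self,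
              Function.update_of_ne, ne_eq, Nat.reduceEqDiff, not_false_eq_true, hi]
            rcases Nat.lt_succ_iff_lt_or_eq.mp hik with h1 | rfl
            · simpa [Function.update_of_ne h1.ne, hi] using hr i h1
            · simp)
        have e0 : s₁.nreg 0 = n := by
          rw [← h0, ← hf.nreg 0 rfl]; simp [hs₁, Instr.exec]
        rwa [e0] at this
      have fZ : Frame clearCountCode s₁ (clearCountCode.den s₁) := clearCountCode.frame s₁
      set s₂ := (Instr.realOfNat 0 3).exec ((Instr.natConst 3 1).exec (clearCountCode.den s₁)) with hs₂
      have g1 : s₂.nreg 1 = d := by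
        rw [← h1, ← hf.nreg 1 rfl]; exact fZ.nreg 1 rfl
      have g12 : s₂.nreg 12 = k := by
        rw [← hi]; refine (fZ.nreg 12 rfl).trans ?_
        simp [hs₁, Instr.exec]
      have gr : s₂.rreg 0 = 1 := by simp [hs₂, Instr.exec]
      have gn0 : s₂.narr 0 = s.narr 0 := by
        rw [← hf.narr 0 rfl]; exact fZ.narr 0 rfl
      have gn1 : s₂.narr 1 = s.narr 1 := by
        rw [← hf.narr 1 rfl]; exact fZ.narr 1 rfl
      have hin := tensorCode_inner n k d s₂ hn g1 g12 hz gr (fun c hc => by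
        rw [gn0, gn1]; exact htab c (by omega))
      set Q : Code := .loop 11 1 countCode with hQ
      have fQ : Frame Q s₂ (Q.den s₂) := Q.frame s₂
      have g10 : (Q.den s₂).nreg 10 = k := by
        rw [← hi]; exact (fQ.nreg 10 rfl).trans (fZ.nreg 10 rfl)
      have ga0 : (Q.den s₂).rarr 0 = s.rarr 0 := by
        rw [← hf.rarr 0 rfl]; exact (fQ.rarr 0 rfl).trans (fZ.rarr 0 rfl)
      have ga2 : (Q.den s₂).rarr 2 = s'.rarr 2 :=
        (fQ.rarr 2 rfl).trans (fZ.rarr 2 rfl)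
      have hden : entryCode.den s' = Code.den (.instr (.realLoad 1 0 10) ;;
          .instr (.realMul 0 1 0) ;; .instr (.realStore 2 10 0)) (Q.den s₂) := rfl
      rw [hden]
      simp only [Code.den, Instr.exec, Store.bump_rarr, Function.update_self, g10, ga0, ga2]
      rcases Nat.lt_succ_iff_lt_or_eq.mp hm with h2 | rfl
      · rw [Function.update_of_ne h2.ne, hinv m h2]
      · simp [hin])
  exact h m hm

/-- The vector that the number `z` encodes: its digits `i` and `b` at the positions `2 * k` and
`2 * k + 1` contribute `1 / √b` to the coordinate `i`. -/
def decodeVec (n z k i : ℕ) : ℝ :=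
  ∑ l ∈ range k, if z / n ^ (2 * l) % n = i then 1 / Real.sqrt (z / n ^ (2 * l + 1) % n : ℕ) else 0

/-- Decodes the number in register `10` into the array `5`. -/
def decodeCode : Code :=
  zeroCode 5 ;; .instr (.natConst 8 0) ;; .instr (.natAdd 12 10 8) ;;
  .loop 11 2 (.instr (.natLoad 13 1 12) ;; .instr (.natLoad 12 0 12) ;;
    .instr (.natLoad 14 1 12) ;; .instr (.natLoad 12 0 12) ;;
    .instr (.realOfNat 0 14) ;; .instr (.realSqrt 0 0) ;; .instr (.natConst 3 1) ;;
    .instr (.realOfNat 1 3) ;; .instr (.realDiv 0 1 0) ;; .instr (.realLoad 1 5 13) ;;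
    .instr (.realAdd 0 1 0) ;; .instr (.realStore 5 13 0))

lemma decodeCode_spec (n q z : ℕ) (s : Store) (h0 : s.nreg 0 = n) (hn : 0 < n) (h2 : s.nreg 2 = q)
    (h10 : s.nreg 10 = z) (htab : ∀ c ≤ z, s.narr 0 c = c / n ∧ s.narr 1 c = c % n) {i : ℕ}
    (hi : i < n) : (decodeCode.den s).rarr 5 i = decodeVec n z q i := by
  have fZ : Frame (zeroCode 5) s ((zeroCode 5).den s) := (zeroCode 5).frame s
  have hz : ∀ i < n, ((zeroCode 5).den s).rarr 5 i = 0 := fun i hi =>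
    zeroCode_spec 5 s (by rw [h0]; exact hi)
  set s₁ := (Instr.natAdd 12 10 8).exec ((Instr.natConst 8 0).exec ((zeroCode 5).den s)) with hs₁
  have g12 : s₁.nreg 12 = z := by
    rw [← h10, ← fZ.nreg 10 rfl]; simp [hs₁, Instr.exec]
  have g2 : s₁.nreg 2 = q := by
    rw [← h2, ← fZ.nreg 2 rfl]; simp [hs₁, Instr.exec]
  have gn0 : s₁.narr 0 = s.narr 0 := fZ.narr 0 rfl
  have gn1 : s₁.narr 1 = s.narr 1 := fZ.narr 1 rfl
  have h := Code.loop_induction (i := 11) (b := 2) (s := s₁)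
    (P := .instr (.natLoad 13 1 12) ;; .instr (.natLoad 12 0 12) ;;
      .instr (.natLoad 14 1 12) ;; .instr (.natLoad 12 0 12) ;;
      .instr (.realOfNat 0 14) ;; .instr (.realSqrt 0 0) ;; .instr (.natConst 3 1) ;;
      .instr (.realOfNat 1 3) ;; .instr (.realDiv 0 1 0) ;; .instr (.realLoad 1 5 13) ;;
      .instr (.realAdd 0 1 0) ;; .instr (.realStore 5 13 0))
    (fun k r => r.nreg 12 = z / n ^ (2 * k) ∧ ∀ i < n, r.rarr 5 i = decodeVec n z k i)
    rfl (by decide) ⟨by simp [Instr.exec, g12], fun i hi => by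
      rw [decodeVec, Finset.sum_range_zero]; exact hz i hi⟩
    (fun k r hk hki hr ⟨hr1, hr2⟩ => by
      have n0 : r.narr 0 = s.narr 0 := (hr.narr 0 rfl).trans gn0
      have n1 : r.narr 1 = s.narr 1 := (hr.narr 1 rfl).trans gn1
      obtain ⟨ed, em⟩ := htab (z / n ^ (2 * k)) (Nat.div_le_self _ _)
      obtain ⟨ed', em'⟩ := htab (z / n ^ (2 * k + 1)) (Nat.div_le_self _ _)
      rw [← n0] at ed ed'
      rw [← n1] at em em'
      have hp : z / n ^ (2 * k) / n = z / n ^ (2 * k + 1) := by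
        rw [pow_succ, Nat.div_div_eq_div_mul]
      rw [hp] at ed
      have hlt : z / n ^ (2 * k) % n < n := Nat.mod_lt _ hn
      refine ⟨?_, fun i hi => ?_⟩
      · rw [Store.bump_nreg_of_ne _ (by decide) (by decide), show 2 * (k + 1) = 2 * k + 1 + 1 by ring,
          pow_succ, ← Nat.div_div_eq_div_mul, ← ed', ← ed, ← hr1]
        simp [Code.den, Instr.exec]
      · rw [decodeVec, Finset.sum_range_succ, ← decodeVec]
        simp only [Code.den, Instr.exec, Store.bump_rarr, Function.update_self,
          Function.update_of_ne, ne_eq, Nat.reduceEqDiff,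
          not_false_eq_true, hr1, em, ed, em', zero_ne_one]
        split_ifs with h
        · subst h; simp [hr2 _ hlt]
        · rw [Function.update_of_ne (Ne.symm h), hr2 i hi, add_zero])
  rw [g2] at h
  exact h.2 i hi

end SphereOpt
end

noncomputable section
namespace SphereOpt
open Finset Matrix

local infixr:60 " ;; " => Code.seq

/-! ### The search -/

/-- The first `n` cells of an array. -/
def vec (n : ℕ) (a : ℕ → ℝ) : Fin n → ℝ := fun i => a i

/-- Contracts the tensor with the vector in the array `v` as often as register `b` says, with the
result in the array `3`. -/
def iterCode (v b : ℕ) : Code := copyCode 2 3 4 ;; .loop 11 b (contractCode 3 v)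

/-- Applies the matrix in the array `4` to the vector in the array `v`, with the result in the
array `v'`. -/
def matVecCode (v v' : ℕ) : Code := copyCode 4 3 4 ;; contractCode 3 v ;; copyCode 3 v' 0

/-- Puts the combination with the coefficients in the registers `17`, `18`, `19` of the vectors in
the arrays `6`, `7`, `5` into the array `8`. -/
def combineCode : Code :=
  .instr (.realOfNat 3 17) ;; .instr (.realOfNat 4 18) ;; .instr (.realOfNat 5 19) ;;
  .loop 20 0 (.instr (.realLoad 0 6 20) ;; .instr (.realMul 0 3 0) ;;
    .instr (.realLoad 1 7 20) ;; .instr (.realMul 1 4 1) ;; .instr (.realAdd 0 0 1) ;;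
    .instr (.realLoad 1 5 20) ;; .instr (.realMul 1 5 1) ;; .instr (.realAdd 0 0 1) ;;
    .instr (.realStore 8 20 0))

/-- Replaces the content of real register `0` by the absolute value of the first cell of the array
`3`. -/
def absCode : Code :=
  .instr (.natConst 12 0) ;; .instr (.realLoad 0 3 12) ;; .instr (.realSub 2 0 0) ;;
  .instr (.realSub 1 2 0) ;; .branch (.realLt 0 1) (.instr (.realAdd 0 1 2)) (.instr .skip)

/-- Keeps the vector in the array `8` if its value, in real register `0`, is the best so far. -/
def recordCode : Code :=
  .branch (.realLt 9 0) (.instr (.realAdd 9 0 2) ;; copyCode 8 1 0) (.instr .skip)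

/-- Tries one combination. -/
def tryCode : Code := combineCode ;; normalizeCode 8 ;; iterCode 8 1 ;; absCode ;; recordCode

/-- Tries all combinations for the starting vector of the power iteration in register `16`. -/
def startCode : Code :=
  zeroCode 6 ;; .instr (.natConst 3 1) ;; .instr (.realOfNat 0 3) ;; .instr (.realStore 6 16 0) ;;
  .loop 11 0 (matVecCode 6 6) ;; normalizeCode 6 ;; matVecCode 6 7 ;; normalizeCode 7 ;;
  .loop 17 1 (.loop 18 1 (.loop 19 1 tryCode))

/-- Tries all vectors for the net point with the number in register `10`. -/
def pointCode : Code :=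
  decodeCode ;; normalizeCode 5 ;; iterCode 5 6 ;; copyCode 3 4 4 ;; .loop 16 0 startCode

/-- Tries all vectors. -/
def searchCode : Code := .loop 10 5 pointCode

lemma contract_congr {n : ℕ} {v v' t t' : ℕ → ℝ} {c : ℕ} (hv : ∀ i < n, v i = v' i)
    (ht : ∀ i < n, t (n * c + i) = t' (n * c + i)) : contract n v t c = contract n v' t' c :=
  Finset.sum_congr rfl fun i hi => by
    rw [hv i (Finset.mem_range.mp hi), ht i (Finset.mem_range.mp hi)]

lemma normalizeCode_vec (a : ℕ) {n : ℕ} (s : Store) (h0 : s.nreg 0 = n) :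
    vec n (((normalizeCode a).den s).rarr a) = unitize (vec n (s.rarr a)) := by
  subst h0
  funext i
  rw [vec, normalizeCode_spec a s i.2, unitize, tupleNorm, Finset.sum_range]
  rfl

/-- Each pass contracts all `n ^ d` cells although only the first `n ^ (d - j)` are meaningful after
`j` passes. The invariant speaks of these alone, and they are exactly what the next pass needs for
its own meaningful cells. -/
lemma iterCode_spec {v b : ℕ} (hv : v ≠ 3) (hb : b = 1 ∨ b = 6) {n d k : ℕ} (s : Store) (t : ℕ → ℝ)
    (h0 : s.nreg 0 = n) (hn : 0 < n) (h4 : s.nreg 4 = n ^ d) (hbk : s.nreg b = k) (hk : k ≤ d)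
    (ht : ∀ c < n ^ d, s.rarr 2 c = t c) {c : ℕ} (hc : c < n ^ (d - k)) :
    ((iterCode v b).den s).rarr 3 c = (contract n (s.rarr v))^[k] t c := by
  have fZ : Frame (copyCode 2 3 4) s ((copyCode 2 3 4).den s) := (copyCode 2 3 4).frame s
  set s₁ := (copyCode 2 3 4).den s with hs₁
  have gb : s₁.nreg b = k := by
    rw [← hbk]
    rcases hb with rfl | rfl
    · exact fZ.nreg 1 rfl
    · exact fZ.nreg 6 rfl
  have g0 : s₁.nreg 0 = n := (fZ.nreg 0 rfl).trans h0
  have g4 : s₁.nreg 4 = n ^ d := (fZ.nreg 4 rfl).trans h4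
  have gv : s₁.rarr v = s.rarr v :=
    fZ.rarr v (by simp [copyCode, Code.writesRA, Instr.writesRA, hv])
  have h := Code.loop_induction (i := 11) (b := b) (s := s₁) (P := contractCode 3 v)
    (fun j r => ∀ c < n ^ (d - j), r.rarr 3 c = (contract n (s.rarr v))^[j] t c)
    rfl (by decide) (fun c hc => by
      refine (copyCode_spec (a := 2) (a' := 3) (b := 4) (by decide) s (by rw [h4]; exact hc)).trans
        (ht c hc)) (fun j r hj hji hr hinv c hc => by
      rw [gb] at hj
      have e0 : r.nreg 0 = n := (hr.nreg 0 rfl).trans g0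
      have e4 : r.nreg 4 = n ^ d := (hr.nreg 4 rfl).trans g4
      have ev : r.rarr v = s.rarr v :=
        (hr.rarr v (by simp [contractCode, Code.writesRA, Instr.writesRA, hv])).trans gv
      rw [Store.bump_rarr, contractCode_spec hv r (by omega) (by
        rw [e4]; exact hc.trans_le (Nat.pow_le_pow_right hn (by omega))), e0, ev,
        Function.iterate_succ_apply']
      refine contract_congr (fun _ _ => rfl) fun i hi => hinv _ ?_
      calc n * c + i < n * (c + 1) := by rw [mul_add]; omega
        _ ≤ n * n ^ (d - (j + 1)) := Nat.mul_le_mul_left _ hc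
        _ = n ^ (d - j) := by rw [← pow_succ']; congr 1; omega)
  rw [gb] at h
  exact h c hc

/-- The contraction destroys its table, so it works on a copy of the matrix; `2 ≤ d` ensures that
the `n ^ d` copied cells contain all `n * n` entries. -/
lemma matVecCode_spec {v v' : ℕ} (hv : v ≠ 3) (hv' : v' ≠ 3) {n d : ℕ} (s : Store)
    (h0 : s.nreg 0 = n) (hn : 0 < n) (hd : 2 ≤ d) (h4 : s.nreg 4 = n ^ d)
    {A : Matrix (Fin n) (Fin n) ℝ} (hA : A.IsSymm)
    (hs : ∀ i j : Fin n, s.rarr 4 (n * j + i) = A i j) :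
    vec n (((matVecCode v v').den s).rarr v') = A *ᵥ vec n (s.rarr v) := by
  have f₁ : Frame (copyCode 4 3 4) s ((copyCode 4 3 4).den s) := (copyCode 4 3 4).frame s
  set s₁ := (copyCode 4 3 4).den s with hs₁
  have f₂ : Frame (contractCode 3 v) s₁ ((contractCode 3 v).den s₁) := (contractCode 3 v).frame s₁
  set s₂ := (contractCode 3 v).den s₁ with hs₂
  have g0 : s₁.nreg 0 = n := (f₁.nreg 0 rfl).trans h0
  have g4 : s₁.nreg 4 = n ^ d := (f₁.nreg 4 rfl).trans h4
  have g0' : s₂.nreg 0 = n := (f₂.nreg 0 rfl).trans g0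
  have gv : s₁.rarr v = s.rarr v :=
    f₁.rarr v (by simp [copyCode, Code.writesRA, Instr.writesRA, hv])
  have hsq : n * n ≤ n ^ d := by
    rw [← sq]; exact Nat.pow_le_pow_right hn hd
  have hcell : ∀ i j : Fin n, n * (j : ℕ) + i < n ^ d := fun i j => by
    have := i.2
    have := j.2
    calc n * (j : ℕ) + i < n * (j + 1) := by rw [mul_add]; omega
      _ ≤ n * n := Nat.mul_le_mul_left _ (by omega)
      _ ≤ n ^ d := hsq
  funext j
  have hden : (matVecCode v v').den s = (copyCode 3 v' 0).den s₂ := rfl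
  have hj : (j : ℕ) < n ^ d := j.2.trans_le ((Nat.le_mul_of_pos_left n hn).trans hsq)
  rw [vec, hden, copyCode_spec hv'.symm s₂ (by rw [g0']; exact j.2), hs₂,
    contractCode_spec hv s₁ (by omega) (by rw [g4]; exact hj), g0, gv]
  refine contract_eq_mulVec hA (fun i j => ?_) (s.rarr v) j
  rw [hs₁, copyCode_spec (by decide) s (by rw [h4]; exact hcell i j)]
  exact hs i j

lemma combineCode_spec {n : ℕ} (s : Store) (h0 : s.nreg 0 = n) :
    vec n ((combineCode.den s).rarr 8) = (s.nreg 17 : ℝ) • vec n (s.rarr 6) +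
      (s.nreg 18 : ℝ) • vec n (s.rarr 7) + (s.nreg 19 : ℝ) • vec n (s.rarr 5) := by
  set s₁ := (Instr.realOfNat 5 19).exec ((Instr.realOfNat 4 18).exec
    ((Instr.realOfNat 3 17).exec s)) with hs₁
  have h := Code.loop_induction (i := 20) (b := 0) (s := s₁)
    (P := .instr (.realLoad 0 6 20) ;; .instr (.realMul 0 3 0) ;;
      .instr (.realLoad 1 7 20) ;; .instr (.realMul 1 4 1) ;; .instr (.realAdd 0 0 1) ;;
      .instr (.realLoad 1 5 20) ;; .instr (.realMul 1 5 1) ;; .instr (.realAdd 0 0 1) ;;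
      .instr (.realStore 8 20 0))
    (fun k r => ∀ c < k, r.rarr 8 c = s.nreg 17 * s.rarr 6 c + s.nreg 18 * s.rarr 7 c +
      s.nreg 19 * s.rarr 5 c) rfl (by decide) (by simp) (fun k r hk hki hr hinv c hc => by
      have e3 : r.rreg 3 = s.nreg 17 := by rw [hr.rreg 3 rfl]; simp [hs₁, Instr.exec]
      have e4 : r.rreg 4 = s.nreg 18 := by rw [hr.rreg 4 rfl]; simp [hs₁, Instr.exec]
      have e5 : r.rreg 5 = s.nreg 19 := by rw [hr.rreg 5 rfl]; simp [hs₁, Instr.exec]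
      have a6 : r.rarr 6 = s.rarr 6 := hr.rarr 6 rfl
      have a7 : r.rarr 7 = s.rarr 7 := hr.rarr 7 rfl
      have a5 : r.rarr 5 = s.rarr 5 := hr.rarr 5 rfl
      simp only [Code.den, Instr.exec, Store.bump_rarr, Function.update_self, hki]
      rcases Nat.lt_succ_iff_lt_or_eq.mp hc with h1 | rfl
      · rw [Function.update_of_ne h1.ne, hinv c h1]
      · simp [e3, e4, e5, a6, a7, a5])
  have e0 : s₁.nreg 0 = n := h0
  rw [e0] at h
  funext i
  exact h i i.2

/-- The `0` left in register `2` later lets `recordCode` move a real register by an addition. -/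
lemma absCode_spec (s : Store) :
    (absCode.den s).rreg 0 = |s.rarr 3 0| ∧ (absCode.den s).rreg 2 = 0 := by
  have h : absCode.den s = (Code.branch (.realLt 0 1) (.instr (.realAdd 0 1 2)) (.instr .skip)).den
      ((Instr.realSub 1 2 0).exec ((Instr.realSub 2 0 0).exec ((Instr.realLoad 0 3 12).exec
        ((Instr.natConst 12 0).exec s)))) := rfl
  rw [h, Code.den]
  split_ifs with hb
  · simp [Test.Holds, Instr.exec] at hb
    simp [Code.den, Instr.exec]
    rw [abs_of_neg (by linarith)]
  · simp [Test.Holds, Instr.exec] at hb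
    simp [Code.den, Instr.exec]
    rw [abs_of_nonneg (by linarith)]

/-- The vector in the array `1` is a unit vector at which `F` has at least the absolute value in
real register `9`. -/
structure Good (n : ℕ) (F : (Fin n → ℝ) → ℝ) (s : Store) : Prop where
  nonneg : 0 ≤ s.rreg 9
  le : s.rreg 9 ≤ |F (vec n (s.rarr 1))|
  norm : tupleNorm (vec n (s.rarr 1)) = 1

/-- A step from `s` to `s'` keeps the recorded vector good and raises the recorded value above all
elements of `S`. -/
def Improves (n : ℕ) (F : (Fin n → ℝ) → ℝ) (S : Set ℝ) (s s' : Store) : Prop :=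
  Good n F s → Good n F s' ∧ s.rreg 9 ≤ s'.rreg 9 ∧ ∀ v ∈ S, v ≤ s'.rreg 9

lemma Improves.of_frame {n : ℕ} {F : (Fin n → ℝ) → ℝ} {S : Set ℝ} {P : Code} {s s' s'' : Store}
    (hP : Frame P s s') (h9 : P.writesR 9 = false) (h1 : P.writesRA 1 = false)
    (h : Improves n F S s' s'') : Improves n F S s s'' := by
  intro hs
  rw [← hP.rreg 9 h9]
  refine h ⟨?_, ?_, ?_⟩
  · rw [hP.rreg 9 h9]; exact hs.nonneg
  · rw [hP.rreg 9 h9, hP.rarr 1 h1]; exact hs.le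
  · rw [hP.rarr 1 h1]; exact hs.norm

/-- The recorded value never decreases, so it stays above the values met in earlier passes. -/
lemma Improves.loop {n : ℕ} {F : (Fin n → ℝ) → ℝ} (S : ℕ → Set ℝ) {i b : ℕ} {P : Code} {s : Store}
    (hP : P.writesN i = false) (h3 : i ≠ 3)
    (h : ∀ k s', k < s.nreg b → s'.nreg i = k → Frame (.loop i b P) s s' →
      Improves n F (S k) s' (P.den s')) :
    Improves n F {v | ∃ k < s.nreg b, v ∈ S k} s ((Code.loop i b P).den s) := by
  intro hs
  have := Code.loop_induction (i := i) (b := b) (s := s) (P := P)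
    (fun k s' => Good n F s' ∧ s.rreg 9 ≤ s'.rreg 9 ∧ ∀ v ∈ {v | ∃ j < k, v ∈ S j}, v ≤ s'.rreg 9)
    hP h3 ⟨⟨hs.nonneg, hs.le, hs.norm⟩, le_rfl, by simp⟩ (fun k s' hk hki hf ⟨h1, h2, h4⟩ => by
      obtain ⟨g1, g2, g3⟩ := h k s' hk hki hf h1
      refine ⟨⟨g1.nonneg, g1.le, g1.norm⟩, h2.trans g2, ?_⟩
      rintro v ⟨j, hj, hv⟩
      rcases Nat.lt_succ_iff_lt_or_eq.mp hj with hjk | rfl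
      · exact (h4 v ⟨j, hjk, hv⟩).trans g2
      · exact g3 v hv)
  exact this

lemma recordCode_spec {n : ℕ} {F : (Fin n → ℝ) → ℝ} (hF : F 0 = 0) (s : Store)
    (h0 : s.nreg 0 = n) {w : Fin n → ℝ} (hw : vec n (s.rarr 8) = unitize w)
    (hv : s.rreg 0 = |F (unitize w)|) (h2 : s.rreg 2 = 0) :
    Improves n F {|F (unitize w)|} s (recordCode.den s) := by
  intro hs
  rw [recordCode, Code.den]
  split_ifs with hb
  · simp only [Test.Holds, hv] at hb
    -- A strict improvement of a nonnegative record is a nonzero value, so the zero vector, which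
    -- `unitize` does not normalize, is never recorded.
    have hw0 : w ≠ 0 := by
      rintro rfl
      rw [unitize_zero, hF, abs_zero] at hb
      exact hb.not_ge hs.nonneg
    set s₁ := (Instr.realAdd 9 0 2).exec s with hs₁
    have hf : Frame (copyCode 8 1 0) s₁ ((copyCode 8 1 0).den s₁) := (copyCode 8 1 0).frame s₁
    have e9 : ((copyCode 8 1 0).den s₁).rreg 9 = |F (unitize w)| := by
      rw [hf.rreg 9 rfl, hs₁]; simp [Instr.exec, hv, h2]
    have e1 : vec n (((copyCode 8 1 0).den s₁).rarr 1) = unitize w := by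
      rw [← hw]
      funext i
      exact copyCode_spec (by decide) s₁ (h0 ▸ i.2)
    have hden : Code.den (.instr (.realAdd 9 0 2) ;; copyCode 8 1 0) s =
      (copyCode 8 1 0).den s₁ := rfl
    rw [hden]
    refine ⟨⟨?_, ?_, ?_⟩, ?_, ?_⟩
    · rw [e9]; positivity
    · rw [e9, e1]
    · rw [e1]; exact tupleNorm_unitize hw0
    · rw [e9]; exact hb.le
    · rintro v rfl; exact e9.ge
  · refine ⟨hs, le_rfl, ?_⟩
    rintro v rfl
    simp only [Test.Holds, hv, not_lt] at hb
    exact hb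

end SphereOpt
end

/-! ### Correctness of the search -/

noncomputable section
namespace SphereOpt
open Finset Matrix

local infixr:60 " ;; " => Code.seq

/-- The data that the search reads: the parameters, the tables of digits and the tensor. -/
structure Env {n e : ℕ} (q : ℕ) (T : (Fin (e + 2) → Fin n) → ℝ) (s : Store) : Prop where
  nreg_zero : s.nreg 0 = n
  nreg_one : s.nreg 1 = e + 2
  nreg_two : s.nreg 2 = q
  nreg_four : s.nreg 4 = n ^ (e + 2)
  nreg_five : s.nreg 5 = n ^ (2 * q)
  nreg_six : s.nreg 6 = e
  divMod : ∀ c < n ^ (2 * q), s.narr 0 c = c / n ∧ s.narr 1 c = c % n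
  isTable : IsTable T (s.rarr 2)

/-- Whether a program leaves the data of `Env` unchanged. -/
def Code.keepsEnv (P : Code) : Bool :=
  [0, 1, 2, 4, 5, 6].all (fun i => !P.writesN i) && !P.writesNA 0 && !P.writesNA 1 &&
    !P.writesRA 2

section

variable {n e q : ℕ} {T : (Fin (e + 2) → Fin n) → ℝ}

lemma Env.of_frame {P : Code} {s s' : Store} (h : Env q T s) (hf : Frame P s s')
    (hP : P.keepsEnv = true) : Env q T s' := by
  simp only [Code.keepsEnv, List.all_cons, List.all_nil, Bool.and_true, Bool.and_eq_true,
    Bool.not_eq_true'] at hP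
  obtain ⟨⟨⟨⟨p0, p1, p2, p4, p5, p6⟩, q0⟩, q1⟩, r2⟩ := hP
  exact ⟨(hf.nreg 0 p0).trans h.nreg_zero, (hf.nreg 1 p1).trans h.nreg_one,
    (hf.nreg 2 p2).trans h.nreg_two, (hf.nreg 4 p4).trans h.nreg_four,
    (hf.nreg 5 p5).trans h.nreg_five, (hf.nreg 6 p6).trans h.nreg_six,
    by rw [hf.narr 0 q0, hf.narr 1 q1]; exact h.divMod, by rw [hf.rarr 2 r2]; exact h.isTable⟩

lemma Env.den {s : Store} (h : Env q T s) (P : Code) (hP : P.keepsEnv = true) :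
    Env q T (P.den s) := h.of_frame (P.frame s) hP

lemma Env.iterCode_zero {s : Store} (h : Env q T s) (hn : 0 < n) {v : ℕ} (hv : v ≠ 3) :
    ((iterCode v 1).den s).rarr 3 0 = tensorForm T fun _ => vec n (s.rarr v) := by
  rw [iterCode_spec hv (Or.inl rfl) s (s.rarr 2) h.nreg_zero hn h.nreg_four h.nreg_one le_rfl
    (fun _ _ => rfl) (by simp), h.isTable.contract_iterate_zero]
  rfl

lemma Env.iterCode_matrix {s : Store} (h : Env q T s) (hn : 0 < n) {v : ℕ} (hv : v ≠ 3)
    (i j : Fin n) :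
    ((iterCode v 6).den s).rarr 3 (n * j + i) = tensorMatrix T (vec n (s.rarr v)) i j := by
  rw [iterCode_spec hv (Or.inr rfl) s (s.rarr 2) h.nreg_zero hn h.nreg_four h.nreg_six
    (by omega) (fun _ _ => rfl), h.isTable.contract_iterate_matrix]
  · rfl
  · have := i.2
    have := j.2
    calc n * (j : ℕ) + i < n * (j + 1) := by rw [mul_add]; omega
      _ ≤ n * n := Nat.mul_le_mul_left _ (by omega)
      _ = n ^ (e + 2 - e) := by rw [Nat.add_sub_cancel_left, sq]

lemma tensorForm_zero : (tensorForm T fun _ => (0 : Fin n → ℝ)) = 0 :=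
  Finset.sum_eq_zero fun I _ => by simp

lemma tryCode_spec {s : Store} (h : Env q T s) (hn : 0 < n) :
    Improves n (fun x => tensorForm T fun _ => x)
      {|tensorForm T fun _ => unitize ((s.nreg 17 : ℝ) • vec n (s.rarr 6) +
        (s.nreg 18 : ℝ) • vec n (s.rarr 7) + (s.nreg 19 : ℝ) • vec n (s.rarr 5))|}
      s (tryCode.den s) := by
  set s₁ := combineCode.den s with hs₁
  have h₁ : Env q T s₁ := h.den combineCode rfl
  set s₂ := (normalizeCode 8).den s₁ with hs₂
  have h₂ : Env q T s₂ := h₁.den (normalizeCode 8) rfl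
  set s₃ := (iterCode 8 1).den s₂ with hs₃
  have h₃ : Env q T s₃ := h₂.den (iterCode 8 1) rfl
  set s₄ := absCode.den s₃ with hs₄
  have h₄ : Env q T s₄ := h₃.den absCode rfl
  have hfr : Frame (combineCode ;; normalizeCode 8 ;; iterCode 8 1 ;; absCode) s s₄ :=
    Code.frame _ s
  refine Improves.of_frame hfr rfl rfl ?_
  have hden : tryCode.den s = recordCode.den s₄ := rfl
  have e1 := combineCode_spec s h.nreg_zero
  have e2 := normalizeCode_vec 8 s₁ h₁.nreg_zero
  rw [e1] at e2
  have e3 : s₃.rarr 8 = s₂.rarr 8 := ((iterCode 8 1).frame s₂).rarr 8 rfl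
  have e4 : s₄.rarr 8 = s₃.rarr 8 := (absCode.frame s₃).rarr 8 rfl
  obtain ⟨e5, e6⟩ := absCode_spec s₃
  rw [hden]
  refine recordCode_spec tensorForm_zero s₄ h₄.nreg_zero (by rw [e4, e3]; exact e2) ?_ e6
  rw [e5, hs₃, h₂.iterCode_zero hn (by decide), hs₂, e2]

/-- Array `6` passes from `e_j` through `A ^ n e_j` to its direction `v`, array `7` receives the
direction of `A v`, and array `5` keeps the normalized net point; these are the three vectors that
`candidate` combines. -/
lemma startCode_spec {s : Store} (h : Env q T s) (hn : 0 < n)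
    (hT : ∀ (σ : Equiv.Perm (Fin (e + 2))) I, T (I ∘ σ) = T I)
    {x : Fin n → ℝ} (hx : vec n (s.rarr 5) = unitize x)
    (hA : ∀ i j : Fin n, s.rarr 4 (n * j + i) = tensorMatrix T (unitize x) i j) (j : Fin n)
    (hj : s.nreg 16 = j) :
    Improves n (fun x => tensorForm T fun _ => x)
      {v | ∃ k₁ < e + 2, ∃ k₂ < e + 2, ∃ k₃ < e + 2,
        v = |tensorForm T fun _ => candidate T x j k₁ k₂ k₃|} s (startCode.den s) := by
  have hsymm : (tensorMatrix T (unitize x)).IsSymm := tensorMatrix_isSymm hT _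
  set s₁ := (zeroCode 6 ;; .instr (.natConst 3 1) ;; .instr (.realOfNat 0 3) ;;
    .instr (.realStore 6 16 0)).den s with hs₁
  have f₁ : Frame (zeroCode 6 ;; .instr (.natConst 3 1) ;; .instr (.realOfNat 0 3) ;;
    .instr (.realStore 6 16 0)) s s₁ := Code.frame _ s
  have h₁ : Env q T s₁ := h.of_frame f₁ rfl
  have v₁ : vec n (s₁.rarr 6) = Pi.single j 1 := by
    have hz : ∀ i < n, ((zeroCode 6).den s).rarr 6 i = 0 := fun i hi =>
      zeroCode_spec 6 s (by rw [h.nreg_zero]; exact hi)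
    have h16 : ((zeroCode 6).den s).nreg 16 = j := (((zeroCode 6).frame s).nreg 16 rfl).trans hj
    have hd : s₁ = (Instr.realStore 6 16 0).exec ((Instr.realOfNat 0 3).exec
      ((Instr.natConst 3 1).exec ((zeroCode 6).den s))) := rfl
    funext i
    rw [vec, hd]
    simp only [Instr.exec, Function.update_self, ne_eq, Nat.reduceEqDiff, not_false_eq_true,
      Function.update_of_ne, h16]
    by_cases hij : i = j
    · subst hij; simp
    · rw [Function.update_of_ne (fun h => hij (Fin.ext h)), Pi.single_eq_of_ne hij, hz i i.2]
  set s₂ := (Code.loop 11 0 (matVecCode 6 6)).den s₁ with hs₂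
  have f₂ : Frame (.loop 11 0 (matVecCode 6 6)) s₁ s₂ := Code.frame _ s₁
  have h₂ : Env q T s₂ := h₁.of_frame f₂ rfl
  have a₁ : s₁.rarr 4 = s.rarr 4 := f₁.rarr 4 rfl
  have v₂ : vec n (s₂.rarr 6) = (tensorMatrix T (unitize x) *ᵥ ·)^[n] (Pi.single j 1) := by
    have := Code.loop_induction (i := 11) (b := 0) (s := s₁) (P := matVecCode 6 6)
      (fun k r => vec n (r.rarr 6) = (tensorMatrix T (unitize x) *ᵥ ·)^[k] (Pi.single j 1))
      rfl (by decide) v₁ (fun k r hk hki hr hinv => by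
        have hr' : Env q T r := h₁.of_frame hr rfl
        rw [Store.bump_rarr, matVecCode_spec (by decide) (by decide) r hr'.nreg_zero hn
          (by omega) hr'.nreg_four hsymm (fun i j => by rw [hr.rarr 4 rfl, a₁]; exact hA i j),
          hinv, Function.iterate_succ_apply'])
    rwa [h₁.nreg_zero] at this
  set s₃ := (normalizeCode 6).den s₂ with hs₃
  have f₃ : Frame (normalizeCode 6) s₂ s₃ := Code.frame _ s₂
  have h₃ : Env q T s₃ := h₂.of_frame f₃ rfl
  have v₃ := normalizeCode_vec 6 s₂ h₂.nreg_zero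
  rw [v₂, ← hs₃] at v₃
  set s₄ := (matVecCode 6 7).den s₃ with hs₄
  have f₄ : Frame (matVecCode 6 7) s₃ s₄ := Code.frame _ s₃
  have h₄ : Env q T s₄ := h₃.of_frame f₄ rfl
  have a₃ : s₃.rarr 4 = s.rarr 4 := (f₃.rarr 4 rfl).trans ((f₂.rarr 4 rfl).trans a₁)
  have v₄ : vec n (s₄.rarr 7) = _ :=
    matVecCode_spec (v := 6) (v' := 7) (by decide) (by decide) s₃ h₃.nreg_zero hn
      (by omega) h₃.nreg_four hsymm (fun i j => by rw [a₃]; exact hA i j)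
  rw [v₃] at v₄
  set s₅ := (normalizeCode 7).den s₄ with hs₅
  have f₅ : Frame (normalizeCode 7) s₄ s₅ := Code.frame _ s₄
  have h₅ : Env q T s₅ := h₄.of_frame f₅ rfl
  have v₅ := normalizeCode_vec 7 s₄ h₄.nreg_zero
  rw [v₄, ← hs₅] at v₅
  have w₅ : vec n (s₅.rarr 6) =
      unitize ((tensorMatrix T (unitize x) *ᵥ ·)^[n] (Pi.single j 1)) := by
    rw [f₅.rarr 6 rfl, f₄.rarr 6 rfl]; exact v₃
  have x₅ : vec n (s₅.rarr 5) = unitize x := by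
    rw [f₅.rarr 5 rfl, f₄.rarr 5 rfl, f₃.rarr 5 rfl, f₂.rarr 5 rfl, f₁.rarr 5 rfl]; exact hx
  have hden : startCode.den s = (Code.loop 17 1 (.loop 18 1 (.loop 19 1 tryCode))).den s₅ := rfl
  have hfr : Frame ((zeroCode 6 ;; .instr (.natConst 3 1) ;; .instr (.realOfNat 0 3) ;;
    .instr (.realStore 6 16 0)) ;; .loop 11 0 (matVecCode 6 6) ;; normalizeCode 6 ;;
      matVecCode 6 7 ;; normalizeCode 7) s s₅ := Code.frame _ s
  rw [hden]
  refine Improves.of_frame hfr rfl rfl ?_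
  have hloop := Improves.loop (n := n) (F := fun x => tensorForm T fun _ => x)
    (fun k₁ => {v | ∃ k₂ < e + 2, ∃ k₃ < e + 2,
      v = |tensorForm T fun _ => candidate T x j k₁ k₂ k₃|}) (i := 17) (b := 1)
    (P := .loop 18 1 (.loop 19 1 tryCode)) (s := s₅) rfl (by decide)
    (fun k₁ r₁ hk₁ hki₁ hr₁ => by
      have E₁ : Env q T r₁ := h₅.of_frame hr₁ rfl
      have := Improves.loop (n := n) (F := fun x => tensorForm T fun _ => x)
        (fun k₂ => {v | ∃ k₃ < e + 2,
          v = |tensorForm T fun _ => candidate T x j k₁ k₂ k₃|}) (i := 18) (b := 1)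
        (P := .loop 19 1 tryCode) (s := r₁) rfl (by decide)
        (fun k₂ r₂ hk₂ hki₂ hr₂ => by
          have E₂ : Env q T r₂ := E₁.of_frame hr₂ rfl
          have := Improves.loop (n := n) (F := fun x => tensorForm T fun _ => x)
            (fun k₃ => {|tensorForm T fun _ => candidate T x j k₁ k₂ k₃|}) (i := 19) (b := 1)
            (P := tryCode) (s := r₂) rfl (by decide)
            (fun k₃ r₃ hk₃ hki₃ hr₃ => by
              have E₃ : Env q T r₃ := E₂.of_frame hr₃ rfl
              have hspec := tryCode_spec E₃ hn
              rw [hki₃, hr₃.nreg 18 rfl, hki₂, hr₃.nreg 17 rfl, hr₂.nreg 17 rfl, hki₁,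
                hr₃.rarr 6 rfl, hr₂.rarr 6 rfl, hr₁.rarr 6 rfl, hr₃.rarr 7 rfl, hr₂.rarr 7 rfl,
                hr₁.rarr 7 rfl, hr₃.rarr 5 rfl, hr₂.rarr 5 rfl, hr₁.rarr 5 rfl, w₅, v₅, x₅]
                at hspec
              exact hspec)
          rwa [E₂.nreg_one] at this)
      rwa [E₁.nreg_one] at this)
  rwa [h₅.nreg_one] at hloop

lemma pointCode_spec {s : Store} (h : Env q T s) (hn : 0 < n)
    (hT : ∀ (σ : Equiv.Perm (Fin (e + 2))) I, T (I ∘ σ) = T I) {z : ℕ} (hz : z < n ^ (2 * q))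
    (hs : s.nreg 10 = z) :
    Improves n (fun x => tensorForm T fun _ => x)
      {v | ∃ j, ∃ k₁ < e + 2, ∃ k₂ < e + 2, ∃ k₃ < e + 2,
        v = |tensorForm T fun _ => candidate T (vec n (decodeVec n z q)) j k₁ k₂ k₃|}
      s (pointCode.den s) := by
  set s₁ := decodeCode.den s with hs₁
  have h₁ : Env q T s₁ := h.den decodeCode rfl
  have v₁ : vec n (s₁.rarr 5) = vec n (decodeVec n z q) := by
    funext i
    exact decodeCode_spec n q z s h.nreg_zero hn h.nreg_two hs
      (fun c hc => h.divMod c (hc.trans_lt hz)) i.2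
  set s₂ := (normalizeCode 5).den s₁ with hs₂
  have h₂ : Env q T s₂ := h₁.den (normalizeCode 5) rfl
  have v₂ := normalizeCode_vec 5 s₁ h₁.nreg_zero
  rw [v₁, ← hs₂] at v₂
  set s₃ := (iterCode 5 6).den s₂ with hs₃
  have f₃ : Frame (iterCode 5 6) s₂ s₃ := Code.frame _ s₂
  have h₃ : Env q T s₃ := h₂.of_frame f₃ rfl
  set s₄ := (copyCode 3 4 4).den s₃ with hs₄
  have f₄ : Frame (copyCode 3 4 4) s₃ s₄ := Code.frame _ s₃
  have h₄ : Env q T s₄ := h₃.of_frame f₄ rfl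
  have x₄ : vec n (s₄.rarr 5) = unitize (vec n (decodeVec n z q)) := by
    rw [f₄.rarr 5 rfl, f₃.rarr 5 rfl]; exact v₂
  have a₄ : ∀ i j : Fin n, s₄.rarr 4 (n * j + i) =
      tensorMatrix T (unitize (vec n (decodeVec n z q))) i j := by
    intro i j
    have hlt : n * (j : ℕ) + i < s₃.nreg 4 := by
      rw [h₃.nreg_four]
      have := i.2
      have := j.2
      calc n * (j : ℕ) + i < n * (j + 1) := by rw [mul_add]; omega
        _ ≤ n * n := Nat.mul_le_mul_left _ (by omega)
        _ = n ^ 2 := (sq n).symm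
        _ ≤ n ^ (e + 2) := Nat.pow_le_pow_right hn (by omega)
    rw [hs₄, copyCode_spec (by decide) s₃ hlt, hs₃, h₂.iterCode_matrix hn (by decide), v₂]
  have hfr : Frame (decodeCode ;; normalizeCode 5 ;; iterCode 5 6 ;; copyCode 3 4 4) s s₄ :=
    Code.frame _ s
  have hden : pointCode.den s = (Code.loop 16 0 startCode).den s₄ := rfl
  rw [hden]
  refine Improves.of_frame hfr rfl rfl ?_
  have hloop := Improves.loop (n := n) (F := fun x => tensorForm T fun _ => x)
    -- The loop counter is a plain number, so the bound that makes it an index is carried inside the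
    -- set.
    (fun j => {v | ∃ hj : j < n, ∃ k₁ < e + 2, ∃ k₂ < e + 2, ∃ k₃ < e + 2,
      v = |tensorForm T fun _ => candidate T (vec n (decodeVec n z q)) ⟨j, hj⟩ k₁ k₂ k₃|})
    (i := 16) (b := 0) (P := startCode) (s := s₄) rfl (by decide)
    (fun j r hj hji hr => by
      rw [h₄.nreg_zero] at hj
      have := startCode_spec (h₄.of_frame hr rfl) hn hT (x := vec n (decodeVec n z q))
        (by rw [hr.rarr 5 rfl]; exact x₄) (by rw [hr.rarr 4 rfl]; exact a₄) ⟨j, hj⟩ hji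
      intro hg
      obtain ⟨g1, g2, g3⟩ := this hg
      exact ⟨g1, g2, fun v ⟨_, hv⟩ => g3 v hv⟩)
  rw [h₄.nreg_zero] at hloop
  intro hg
  obtain ⟨g1, g2, g3⟩ := hloop hg
  exact ⟨g1, g2, fun v ⟨j, hv⟩ => g3 v ⟨j, j.2, j.2, hv⟩⟩

lemma searchCode_spec {s : Store} (h : Env q T s) (hn : 0 < n)
    (hT : ∀ (σ : Equiv.Perm (Fin (e + 2))) I, T (I ∘ σ) = T I) :
    Improves n (fun x => tensorForm T fun _ => x)
      {v | ∃ z < n ^ (2 * q), ∃ j, ∃ k₁ < e + 2, ∃ k₂ < e + 2, ∃ k₃ < e + 2,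
        v = |tensorForm T fun _ => candidate T (vec n (decodeVec n z q)) j k₁ k₂ k₃|}
      s (searchCode.den s) := by
  have hloop := Improves.loop (n := n) (F := fun x => tensorForm T fun _ => x)
    (fun z => {v | ∃ j, ∃ k₁ < e + 2, ∃ k₂ < e + 2, ∃ k₃ < e + 2,
        v = |tensorForm T fun _ => candidate T (vec n (decodeVec n z q)) j k₁ k₂ k₃|})
    (i := 10) (b := 5) (P := pointCode) (s := s) rfl (by decide)
    (fun z r hz hzi hr => pointCode_spec (h.of_frame hr rfl) hn hT
      (by rw [← h.nreg_five]; exact hz) hzi)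
  rwa [h.nreg_five] at hloop

end

end SphereOpt
end

noncomputable section
namespace SphereOpt
open Finset Matrix MvPolynomial

local infixr:60 " ;; " => Code.seq

/-! ### Net points are decoded -/

lemma div_pow_mod_add_mul {n z c l k : ℕ} (hn : 0 < n) (h : l < k) :
    (z + n ^ k * c) / n ^ l % n = z / n ^ l % n := by
  obtain ⟨r, rfl⟩ : ∃ r, k = l + 1 + r := ⟨k - (l + 1), by omega⟩
  have : n ^ (l + 1 + r) * c = n ^ l * (n * (n ^ r * c)) := by ring
  rw [this, Nat.add_mul_div_left _ _ (Nat.pow_pos hn), Nat.add_mul_mod_self_left]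

/-- Digits beyond the length of `z` are `0`, and `1 / √0 = 0`, so padding to `q` pairs adds nothing.
-/
lemma decodeVec_of_lt {n z m q : ℕ} (hn : 0 < n) (hz : z < n ^ (2 * m)) (hmq : m ≤ q) (i : ℕ) :
    decodeVec n z q i = decodeVec n z m i := by
  unfold decodeVec
  refine (Finset.sum_subset (Finset.range_subset_range.mpr hmq) fun l _ hl => ?_).symm
  have hl' : m ≤ l := by simpa using hl
  have : z / n ^ (2 * l + 1) = 0 :=
    Nat.div_eq_of_lt (hz.trans_le (Nat.pow_le_pow_right hn (by omega)))
  simp [this]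

/-- The coordinate `k i / √(α i)` is written as `k i` summands `1 / √(α i)`, each encoded by the
digit pair `(i, α i)`. The induction takes one unit off some `k j` and places its pair above the
digits of the rest. -/
lemma exists_decodeVec_eq {n m : ℕ} (hn : 0 < n) (α k : Fin n → ℕ) (hα : ∀ i, α i < n)
    (hk : ∑ i, k i = m) : ∃ z < n ^ (2 * m), vec n (decodeVec n z m) = netPoint α k := by
  induction m generalizing k with
  | zero =>
    refine ⟨0, by simp, ?_⟩
    funext i
    have : k i = 0 := Finset.sum_eq_zero_iff.mp hk i (Finset.mem_univ i)
    simp [vec, decodeVec, netPoint, this]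
  | succ m ih =>
    obtain ⟨j, hj⟩ : ∃ j, 0 < k j := by
      by_contra! hcon
      have : ∑ i, k i = 0 := Finset.sum_eq_zero fun i _ => Nat.le_zero.mp (hcon i)
      omega
    have hkj : ∀ i, k i = (k - (Pi.single j 1 : Fin n → ℕ)) i + (Pi.single j 1 : Fin n → ℕ) i := by
      intro i
      by_cases hij : i = j
      · subst hij; simp; omega
      · simp [Pi.single_eq_of_ne hij]
    have hsum : ∑ i, (k - (Pi.single j 1 : Fin n → ℕ)) i = m := by
      have := hk
      rw [Finset.sum_congr rfl fun i _ => hkj i, Finset.sum_add_distrib] at this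
      have h1 : ∑ i, (Pi.single j 1 : Fin n → ℕ) i = 1 := by simp
      omega
    obtain ⟨z, hz, hzv⟩ := ih (k - (Pi.single j 1 : Fin n → ℕ)) hsum
    have hc : (j : ℕ) + n * α j < n * n := by
      have := j.2
      have := hα j
      calc (j : ℕ) + n * α j < n * (α j + 1) := by rw [mul_add]; omega
        _ ≤ n * n := Nat.mul_le_mul_left _ (by omega)
    refine ⟨z + n ^ (2 * m) * (j + n * α j), ?_, ?_⟩
    · calc z + n ^ (2 * m) * (j + n * α j) < n ^ (2 * m) * (j + n * α j + 1) := by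
            rw [mul_add (n ^ (2 * m)) _ 1]; omega
        _ ≤ n ^ (2 * m) * (n * n) := Nat.mul_le_mul_left _ hc
        _ = n ^ (2 * (m + 1)) := by ring
    · funext i
      have hlow : decodeVec n (z + n ^ (2 * m) * (j + n * α j)) m i = decodeVec n z m i := by
        refine Finset.sum_congr rfl fun l hl => ?_
        have hl' := Finset.mem_range.mp hl
        rw [div_pow_mod_add_mul hn (by omega), div_pow_mod_add_mul hn (by omega)]
      have htop : (z + n ^ (2 * m) * (j + n * α j)) / n ^ (2 * m) = j + n * α j := by
        rw [Nat.add_mul_div_left _ _ (Nat.pow_pos hn), Nat.div_eq_of_lt hz, zero_add]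
      have htop' : (z + n ^ (2 * m) * (j + n * α j)) / n ^ (2 * m + 1) = α j := by
        rw [pow_succ, ← Nat.div_div_eq_div_mul, htop, Nat.add_mul_div_left _ _ hn,
          Nat.div_eq_of_lt j.2, zero_add]
      have hv := congrFun hzv i
      rw [vec] at hv
      rw [vec, decodeVec, Finset.sum_range_succ, ← decodeVec, hlow, hv, htop, htop',
        Nat.add_mul_mod_self_left, Nat.mod_eq_of_lt j.2, Nat.mod_eq_of_lt (hα j)]
      simp only [netPoint]
      rw [hkj i]
      by_cases hij : i = j
      · subst hij
        simp only [if_true, Pi.single_eq_same]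
        push_cast; ring
      · have : (j : ℕ) ≠ i := fun h => hij (Fin.ext h.symm)
        simp [this, Pi.single_eq_of_ne hij]

/-! ### The whole program -/

/-- Computes the bounds of the loops. -/
def boundsCode : Code :=
  (.instr (.natAdd 7 2 2) ;; .instr (.natConst 8 2) ;; .instr (.natSub 6 1 8)) ;;
  powCode 4 1 ;; powCode 5 7

/-- Records the first unit vector. -/
def firstCode : Code :=
  .instr (.natConst 12 0) ;; .instr (.natConst 3 1) ;; .instr (.realOfNat 0 3) ;;
  .instr (.realStore 1 12 0)

/-- Fills the tables and searches. -/
def mainCode : Code := divModCode ;; tensorCode ;; firstCode ;; searchCode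

/-! ### Correctness and running time of the whole program -/

section

variable {n e q : ℕ} (f : MvPolynomial (Fin n) ℝ)

/-- The numbering of cells is the base-`n` expansion of `finFunctionFinEquiv`, so the digits of a
cell number are the indices and their counts are the exponents of the monomial. -/
lemma isTable_of_entries {t : ℕ → ℝ}
    (ht : ∀ m < n ^ (e + 2), t m = coeffTable (e + 2) f m *
      ((∏ i ∈ range n, ((digitCount n m (e + 2) i).factorial : ℝ)) / (e + 2).factorial)) :
    IsTable (symTensor (e + 2) f) t := by
  intro I
  have hm : ∑ j, (I j : ℕ) * n ^ (j : ℕ) < n ^ (e + 2) := (finFunctionFinEquiv I).2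
  have hdig : ∀ j : Fin (e + 2), (∑ j, (I j : ℕ) * n ^ (j : ℕ)) / n ^ (j : ℕ) % n = I j := by
    intro j
    exact congrArg Fin.val (congrFun (finFunctionFinEquiv.symm_apply_apply I) j)
  have hsymm : finFunctionFinEquiv.symm ⟨∑ j, (I j : ℕ) * n ^ (j : ℕ), hm⟩ = I :=
    finFunctionFinEquiv.symm_apply_apply I
  have hcount : ∀ i : Fin n, digitCount n (∑ j, (I j : ℕ) * n ^ (j : ℕ)) (e + 2) i = expo I i := by
    intro i
    rw [digitCount, Finset.sum_range, expo, Finsupp.finsetSum_apply]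
    refine Finset.sum_congr rfl fun j _ => ?_
    rw [hdig, Finsupp.single_apply]
    simp only [Fin.ext_iff]
  rw [ht _ hm, coeffTable, dif_pos hm, hsymm, symTensor, Finset.prod_range]
  simp only [hcount]
  rfl

lemma boundsCode_spec :
    (boundsCode.den (inputStore n (e + 2) q f)).nreg 4 = n ^ (e + 2) ∧
    (boundsCode.den (inputStore n (e + 2) q f)).nreg 5 = n ^ (2 * q) ∧
    (boundsCode.den (inputStore n (e + 2) q f)).nreg 6 = e := by
  set s := inputStore n (e + 2) q f with hs
  set s₁ := (Instr.natSub 6 1 8).exec ((Instr.natConst 8 2).exec ((Instr.natAdd 7 2 2).exec s))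
    with hs₁
  set s₂ := (powCode 4 1).den s₁ with hs₂
  set s₃ := (powCode 5 7).den s₂ with hs₃
  have hden : boundsCode.den s = s₃ := rfl
  have f₂ : Frame (powCode 4 1) s₁ s₂ := Code.frame _ s₁
  have f₃ : Frame (powCode 5 7) s₂ s₃ := Code.frame _ s₂
  have a0 : s₁.nreg 0 = n := by simp [hs₁, hs, Instr.exec, inputStore]
  have a1 : s₁.nreg 1 = e + 2 := by simp [hs₁, hs, Instr.exec, inputStore]
  have a6 : s₁.nreg 6 = e := by simp [hs₁, hs, Instr.exec, inputStore]
  have a7 : s₁.nreg 7 = 2 * q := by simp [hs₁, hs, Instr.exec, inputStore]; ring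
  rw [hden]
  refine ⟨?_, ?_, ?_⟩
  · rw [f₃.nreg 4 rfl, hs₂, powCode_spec (Or.inl rfl) (by decide), a0, a1]
  · rw [hs₃, powCode_spec (Or.inr rfl) (by decide), f₂.nreg 0 rfl, f₂.nreg 7 rfl, a0, a7]
  · rw [f₃.nreg 6 rfl, f₂.nreg 6 rfl, a6]

theorem mainCode_spec (hn : 0 < n) (hdq : e + 2 ≤ 2 * q) (s : Store)
    (hs : s = mainCode.den (boundsCode.den (inputStore n (e + 2) q f))) :
    tupleNorm (vec n (s.rarr 1)) = 1 ∧
      ∀ z < n ^ (2 * q), ∀ j k₁ k₂ k₃, k₁ < e + 2 → k₂ < e + 2 → k₃ < e + 2 →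
        |tensorForm (symTensor (e + 2) f) fun _ => candidate (symTensor (e + 2) f)
          (vec n (decodeVec n z q)) j k₁ k₂ k₃| ≤
        |tensorForm (symTensor (e + 2) f) fun _ => vec n (s.rarr 1)| := by
  set s₀ := inputStore n (e + 2) q f with hs₀
  set s₁ := boundsCode.den s₀ with hs₁
  set s₂ := divModCode.den s₁ with hs₂
  set s₃ := tensorCode.den s₂ with hs₃
  set s₄ := firstCode.den s₃ with hs₄
  have hden : s = searchCode.den s₄ := hs
  have f₁ : Frame boundsCode s₀ s₁ := Code.frame _ s₀
  have f₂ : Frame divModCode s₁ s₂ := Code.frame _ s₁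
  have f₃ : Frame tensorCode s₂ s₃ := Code.frame _ s₂
  have f₄ : Frame firstCode s₃ s₄ := Code.frame _ s₃
  obtain ⟨a4, a5, a6⟩ := boundsCode_spec (e := e) (q := q) f
  rw [← hs₀, ← hs₁] at a4 a5 a6
  have a0 : s₁.nreg 0 = n := f₁.nreg 0 rfl
  have a1 : s₁.nreg 1 = e + 2 := f₁.nreg 1 rfl
  have a2 : s₁.nreg 2 = q := f₁.nreg 2 rfl
  have htab : ∀ c < n ^ (2 * q), s₂.narr 0 c = c / n ∧ s₂.narr 1 c = c % n := by
    intro c hc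
    have := divModCode_spec s₁ (c := c) (by
      rw [a0, a5]; exact hc.trans_le (Nat.le_mul_of_pos_left _ hn))
    rwa [a0] at this
  have b0 : s₂.nreg 0 = n := (f₂.nreg 0 rfl).trans a0
  have b1 : s₂.nreg 1 = e + 2 := (f₂.nreg 1 rfl).trans a1
  have b4 : s₂.nreg 4 = n ^ (e + 2) := (f₂.nreg 4 rfl).trans a4
  have hten : ∀ m < n ^ (e + 2), s₃.rarr 2 m = coeffTable (e + 2) f m *
      ((∏ i ∈ range n, ((digitCount n m (e + 2) i).factorial : ℝ)) / (e + 2).factorial) := by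
    intro m hm
    -- The table of quotients and remainders covers the numbers below `n ^ (2 * q)`, which include
    -- all cells of the tensor because `e + 2 ≤ 2 * q`.
    rw [hs₃, tensorCode_spec n (e + 2) s₂ b0 hn b1 (fun c hc => htab c (by
      rw [b4] at hc; exact hc.trans_le (Nat.pow_le_pow_right hn hdq))) (by rw [b4]; exact hm),
      f₂.rarr 0 rfl, f₁.rarr 0 rfl, hs₀]
    rfl
  have henv : Env q (symTensor (e + 2) f) s₄ := by
    refine ⟨?_, ?_, ?_, ?_, ?_, ?_, ?_, ?_⟩
    · rw [f₄.nreg 0 rfl, f₃.nreg 0 rfl, b0]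
    · rw [f₄.nreg 1 rfl, f₃.nreg 1 rfl, b1]
    · rw [f₄.nreg 2 rfl, f₃.nreg 2 rfl, f₂.nreg 2 rfl, a2]
    · rw [f₄.nreg 4 rfl, f₃.nreg 4 rfl, b4]
    · rw [f₄.nreg 5 rfl, f₃.nreg 5 rfl, f₂.nreg 5 rfl, a5]
    · rw [f₄.nreg 6 rfl, f₃.nreg 6 rfl, f₂.nreg 6 rfl, a6]
    · rw [f₄.narr 0 rfl, f₄.narr 1 rfl, f₃.narr 0 rfl, f₃.narr 1 rfl]; exact htab
    · rw [f₄.rarr 2 rfl]; exact isTable_of_entries f hten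
  have hout : vec n (s₄.rarr 1) = Pi.single ⟨0, hn⟩ 1 := by
    have h1 : s₃.rarr 1 = fun _ => 0 := by
      rw [f₃.rarr 1 rfl, f₂.rarr 1 rfl, f₁.rarr 1 rfl]; rfl
    funext i
    by_cases hi : i = ⟨0, hn⟩
    · subst hi
      simp [vec, hs₄, firstCode, Code.den, Instr.exec]
    · have : (i : ℕ) ≠ 0 := fun h => hi (Fin.ext h)
      simp [vec, hs₄, firstCode, Code.den, Instr.exec, Pi.single_eq_of_ne hi, this, h1]
  have h9 : s₄.rreg 9 = 0 := by
    rw [f₄.rreg 9 rfl, f₃.rreg 9 rfl, f₂.rreg 9 rfl, f₁.rreg 9 rfl]; rfl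
  -- The record starts at `0` with the first basis vector. It only has to be a lower bound, so `f`
  -- need not be evaluated there.
  have hgood : Good n (fun x => tensorForm (symTensor (e + 2) f) fun _ => x) s₄ := by
    refine ⟨h9.ge, by rw [h9]; positivity, ?_⟩
    rw [hout, tupleNorm]
    simp [Pi.single_apply]
  obtain ⟨g1, -, g3⟩ := searchCode_spec henv hn (symTensor_comp_perm f) hgood
  rw [← hden] at g1 g3
  exact ⟨g1.norm, fun z hz j k₁ k₂ k₃ h₁ h₂ h₃ =>
    (g3 _ ⟨z, hz, j, k₁, h₁, k₂, h₂, k₃, h₃, rfl⟩).trans g1.le⟩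

end

/-- The running time is at most `n ^ (C * q)`. -/
lemma exists_runs : ∃ (C : ℕ) (P : Program), ∀ (n e q : ℕ) (f : MvPolynomial (Fin n) ℝ),
    e + 2 ≤ q → 2 * q ≤ n ^ 2 → 2 ≤ n → ∃ t, Runs P (inputStore n (e + 2) q f)
      (mainCode.den (boundsCode.den (inputStore n (e + 2) q f))) t ∧ t ≤ n ^ (C * q) := by
  -- Timing requires that a phase does not write its own loop bounds. Register `7` is set before the
  -- powers are computed, and registers `4`, `5`, `6` before the search, so three phases are timed
  -- separately.
  obtain ⟨P₁, hP₁⟩ : ∃ P : Code,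
    P = .instr (.natAdd 7 2 2) ;; .instr (.natConst 8 2) ;; .instr (.natSub 6 1 8) := ⟨_, rfl⟩
  obtain ⟨P₂, hP₂⟩ : ∃ P, P = powCode 4 1 ;; powCode 5 7 := ⟨_, rfl⟩
  refine ⟨P₁.weight + P₂.weight + mainCode.weight + 2 * (P₁.depth + P₂.depth + mainCode.depth),
    Program.seq (Program.seq P₁.compile P₂.compile) mainCode.compile,
    fun n e q f hdq hqn hn => ?_⟩
  set s₀ := inputStore n (e + 2) q f with hs₀
  set L := n ^ (2 * q) with hL
  have hq : 1 ≤ q := by omega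
  have hL0 : 0 < L := Nat.pow_pos (by omega)
  have hle : ∀ k, k ≤ 2 * q → n ^ k ≤ L := fun k hk => Nat.pow_le_pow_right (by omega) hk
  have hnL : n ≤ L := by simpa using hle 1 (by omega)
  have hqL : 2 * q ≤ L := hqn.trans (hle 2 (by omega))
  obtain ⟨t₁, r₁, u₁⟩ := Code.runs_compile (B := []) hL0 P₁ (by rw [hP₁]; rfl) s₀ (by simp)
  have b1 : ∀ b ∈ [0, 1, 7], (P₁.den s₀).nreg b ≤ L := by
    intro b hb
    simp only [List.mem_cons, List.not_mem_nil, or_false] at hb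
    rcases hb with rfl | rfl | rfl
    · simpa [hP₁, Code.den, Instr.exec, hs₀, inputStore] using hnL
    · simp [hP₁, Code.den, Instr.exec, hs₀, inputStore]; omega
    · simp [hP₁, Code.den, Instr.exec, hs₀, inputStore]; omega
  obtain ⟨t₂, r₂, u₂⟩ := Code.runs_compile (B := [0, 1, 7]) hL0 P₂ (by rw [hP₂]; rfl)
    (P₁.den s₀) b1
  have hden : P₂.den (P₁.den s₀) = boundsCode.den s₀ := by rw [hP₁, hP₂]; rfl
  rw [hden] at r₂
  have hfr : Frame boundsCode s₀ (boundsCode.den s₀) := Code.frame _ s₀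
  obtain ⟨a4, a5, a6⟩ := boundsCode_spec (e := e) (q := q) f
  have b2 : ∀ b ∈ [0, 1, 2, 4, 5, 6], (boundsCode.den s₀).nreg b ≤ L := by
    intro b hb
    simp only [List.mem_cons, List.not_mem_nil, or_false] at hb
    rcases hb with rfl | rfl | rfl | rfl | rfl | rfl
    · rw [hfr.nreg 0 rfl]; simpa [hs₀, inputStore] using hnL
    · rw [hfr.nreg 1 rfl]; simp [hs₀, inputStore]; omega
    · rw [hfr.nreg 2 rfl]; simp [hs₀, inputStore]; omega
    · rw [hs₀, a4]; exact hle _ (by omega)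
    · rw [hs₀, a5]
    · rw [hs₀, a6]; omega
  obtain ⟨t₃, r₃, u₃⟩ := Code.runs_compile (B := [0, 1, 2, 4, 5, 6]) hL0 mainCode rfl
    (boundsCode.den s₀) b2
  refine ⟨t₁ + t₂ + t₃, .seq (.seq r₁ r₂) r₃, ?_⟩
  set D := P₁.depth + P₂.depth + mainCode.depth with hD
  set W := P₁.weight + P₂.weight + mainCode.weight with hW
  have v₁ := u₁.trans (Nat.mul_le_mul_left P₁.weight
    (Nat.pow_le_pow_right hL0 (show P₁.depth ≤ D by omega)))
  have v₂ := u₂.trans (Nat.mul_le_mul_left P₂.weight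
    (Nat.pow_le_pow_right hL0 (show P₂.depth ≤ D by omega)))
  have v₃ := u₃.trans (Nat.mul_le_mul_left mainCode.weight
    (Nat.pow_le_pow_right hL0 (show mainCode.depth ≤ D by omega)))
  calc t₁ + t₂ + t₃ ≤ W * L ^ D := by rw [hW, add_mul, add_mul]; omega
    -- The constant factor is absorbed into the exponent, using `n ≥ 2` and `q ≥ 1`.
    _ ≤ n ^ (W * q) * L ^ D := by
        refine Nat.mul_le_mul_right _ ?_
        calc W ≤ n ^ W := (Nat.lt_pow_self (by omega)).le
          _ ≤ n ^ (W * q) := Nat.pow_le_pow_right (by omega) (Nat.le_mul_of_pos_right _ hq)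
    _ = n ^ ((W + 2 * D) * q) := by rw [hL, ← pow_mul, ← pow_add]; congr 1; ring

end SphereOpt
end

noncomputable section
namespace SphereOpt
open Finset MvPolynomial

variable {n : ℕ}

/-! ### The bounds on the relaxation -/

lemma isPseudoExpectation_aeval (q : ℕ) {x : Fin n → ℝ} (hx : ∑ i, x i ^ 2 = 1) :
    IsPseudoExpectation q (aeval x : MvPolynomial (Fin n) ℝ →ₐ[ℝ] ℝ).toLinearMap where
  one := by simp
  sq_nonneg p _ := by simpa using sq_nonneg _
  sphere p _ := by simp [hx]

lemma sosValues_nonempty (hn : 0 < n) (q : ℕ) (g : MvPolynomial (Fin n) ℝ) :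
    (sosValues q g).Nonempty :=
  ⟨_, _, isPseudoExpectation_aeval q (x := Pi.single ⟨0, hn⟩ 1) (by simp [Pi.single_apply]), rfl⟩

lemma bddAbove_abs_eval (f : MvPolynomial (Fin n) ℝ) :
    BddAbove {v : ℝ | ∃ x : EuclideanSpace ℝ (Fin n), ‖x‖ = 1 ∧ v = |eval (fun i => x i) f|} := by
  have hcont : Continuous fun x : EuclideanSpace ℝ (Fin n) => |eval (fun i => x i) f| :=
    ((MvPolynomial.continuous_eval f).comp
      (PiLp.continuous_ofLp 2 fun _ : Fin n => ℝ)).abs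
  refine ((isCompact_sphere (0 : EuclideanSpace ℝ (Fin n)) 1).bddAbove_image
    hcont.continuousOn).mono ?_
  rintro _ ⟨x, hx, rfl⟩
  exact ⟨x, by simpa using hx, rfl⟩

lemma abs_eval_le_sphereNorm (f : MvPolynomial (Fin n) ℝ) {x : EuclideanSpace ℝ (Fin n)}
    (hx : ‖x‖ = 1) : |eval (fun i => x i) f| ≤ sphereNorm f :=
  le_csSup (bddAbove_abs_eval f) ⟨x, hx, rfl⟩

/-- The exponent on the left is `1 / (2 * l)`, and `e * l / (2 * l) = (e + 2) / 2 - 1`. -/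
lemma rpow_le_of_le_pow {e l q : ℕ} {S K y : ℝ} (hl : 0 < l) (hq : q = (e + 2) * (2 * l))
    (hS : 0 ≤ S) (hK : 0 ≤ K) (hy : 0 ≤ y) (h : S ≤ K ^ (2 * l) * y ^ (e * l)) :
    S ^ (((e + 2 : ℕ) : ℝ) / (q : ℝ)) ≤ K * y ^ (((e + 2 : ℕ) : ℝ) / 2 - 1) := by
  have hl' : (l : ℝ) ≠ 0 := by positivity
  have h1 : ((e + 2 : ℕ) : ℝ) / (q : ℝ) = ((2 * l : ℕ) : ℝ)⁻¹ := by
    rw [hq]; push_cast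
    have : (e : ℝ) + 2 ≠ 0 := by positivity
    field_simp
  have h2 : K ^ (2 * l) * y ^ (e * l) = (K * y ^ (((e + 2 : ℕ) : ℝ) / 2 - 1)) ^ (2 * l) := by
    rw [mul_pow, ← Real.rpow_mul_natCast hy, ← Real.rpow_natCast y (e * l)]
    congr 2
    push_cast; ring
  rw [h1, ← Real.pow_rpow_inv_natCast (x := K * y ^ (((e + 2 : ℕ) : ℝ) / 2 - 1)) (by positivity)
    (show 2 * l ≠ 0 by omega), ← h2]
  exact Real.rpow_le_rpow hS h (by positivity)

/-- A net point takes `∑ k i ≤ ∑ α i ≤ q` digit pairs, so the search over the numbers below `n ^ (2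
* q)` meets it. -/
lemma tensorForm_candidate_netPoint_le {e q : ℕ} (hn : 0 < n)
    {T : (Fin (e + 2) → Fin n) → ℝ} {V : ℝ}
    (hV : ∀ z < n ^ (2 * q), ∀ j k₁ k₂ k₃, k₁ < e + 2 → k₂ < e + 2 → k₃ < e + 2 →
      |tensorForm T fun _ => candidate T (vec n (decodeVec n z q)) j k₁ k₂ k₃| ≤ V)
    (α k : Fin n → ℕ) (hα : ∑ i, α i ≤ q) (hk : ∀ i, k i ≤ α i) (hαn : ∀ i, α i < n)
    (j : Fin n) (k₁ k₂ k₃ : ℕ) (h₁ : k₁ < e + 2) (h₂ : k₂ < e + 2) (h₃ : k₃ < e + 2) :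
    |tensorForm T fun _ => candidate T (netPoint α k) j k₁ k₂ k₃| ≤ V := by
  have hkq : ∑ i, k i ≤ q := (Finset.sum_le_sum fun i _ => hk i).trans hα
  obtain ⟨z, hz, hzv⟩ := exists_decodeVec_eq hn α k hαn rfl
  have hzq : vec n (decodeVec n z q) = netPoint α k := by
    rw [← hzv]
    exact funext fun i => decodeVec_of_lt hn hz hkq i
  rw [← hzq]
  exact hV z (hz.trans_le (Nat.pow_le_pow_right hn (by omega))) j k₁ k₂ k₃ h₁ h₂ h₃

end SphereOpt
end

/-- There are an absolute constant `C` and a single real-RAM program `P` such that for all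
`d ≥ 2`, all positive multiples `q ≤ n` of `2 * d` and every form `f` of degree `d` in `n`
variables: the level-`q` optimum of `f ^ (q / d)` is a genuine (finite) supremum, its root of order
`q / d` is at most `C ^ d * (n / q) ^ (d / 2 - 1)` times the norm of `f`,
and `P` finds, in at most `n ^ (C * q)` steps, a unit vector that achieves this ratio. -/
theorem mainTheorem5 :
    ∃ (C : ℕ) (P : SphereOpt.Program),
      ∀ (n d q : ℕ) (f : MvPolynomial (Fin n) ℝ),
        2 ≤ d → 0 < q → 2 * d ∣ q → q ≤ n → f.IsHomogeneous d →
          IsLUB (SphereOpt.sosValues q (f ^ (q / d))) (SphereOpt.sosOpt q (f ^ (q / d))) ∧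
          SphereOpt.sosOpt q (f ^ (q / d)) ^ ((d : ℝ) / (q : ℝ)) ≤
            (C : ℝ) ^ d * ((n : ℝ) / (q : ℝ)) ^ ((d : ℝ) / 2 - 1) * SphereOpt.sphereNorm f ∧
          ∃ (s : SphereOpt.Store) (t : ℕ),
            SphereOpt.Runs P (SphereOpt.inputStore n d q f) s t ∧
            t ≤ n ^ (C * q) ∧
            ‖SphereOpt.outputVector n s‖ = 1 ∧
            SphereOpt.sosOpt q (f ^ (q / d)) ^ ((d : ℝ) / (q : ℝ)) ≤
              (C : ℝ) ^ d * ((n : ℝ) / (q : ℝ)) ^ ((d : ℝ) / 2 - 1) *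
                |MvPolynomial.eval (fun i => SphereOpt.outputVector n s i) f| := by
  obtain ⟨C₀, P, hruns⟩ := SphereOpt.exists_runs
  -- One constant serves both as base of the approximation ratio (`936`) and as exponent of the
  -- running time (`C₀`).
  refine ⟨C₀ + 936, P, fun n d q f hd hq0 hdvd hqn hf => ?_⟩
  obtain ⟨e, rfl⟩ : ∃ e, d = e + 2 := ⟨d - 2, by omega⟩
  obtain ⟨l, hl⟩ := hdvd
  have hq : q = (e + 2) * (2 * l) := by rw [hl]; ring
  have hl0 : 0 < l := Nat.pos_of_ne_zero fun h => by simp [h] at hl; omega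
  have hdq : 2 * (e + 2) ≤ q := by rw [hl]; exact Nat.le_mul_of_pos_right _ hl0
  have hqd : q / (e + 2) = 2 * l := by rw [hq]; exact Nat.mul_div_cancel_left _ (by omega)
  have hn : 0 < n := by omega
  obtain ⟨t, hrun, ht⟩ := hruns n e q f (by omega) (by nlinarith) (by omega)
  obtain ⟨s, hs⟩ : ∃ s, s = SphereOpt.mainCode.den
    (SphereOpt.boundsCode.den (SphereOpt.inputStore n (e + 2) q f)) := ⟨_, rfl⟩
  rw [← hs] at hrun
  obtain ⟨hnorm, hcand⟩ := SphereOpt.mainCode_spec f hn (by omega) s hs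
  have hout : ‖SphereOpt.outputVector n s‖ = 1 := by
    rw [← hnorm, SphereOpt.tupleNorm_eq]; rfl
  set V := |MvPolynomial.eval (fun i => SphereOpt.outputVector n s i) f| with hVdef
  have hV : V = |SphereOpt.tensorForm (SphereOpt.symTensor (e + 2) f)
      fun _ => SphereOpt.vec n (s.rarr 1)| := by
    rw [hVdef, SphereOpt.eval_eq_tensorForm hf]; rfl
  have hV0 : 0 ≤ V := abs_nonneg _
  rw [← hV] at hcand
  rw [hqd]
  -- The bound uses the value `V` at the output; it proves both that the supremum is finite and the
  -- guarantee of the algorithm.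
  have hbound : ∀ v ∈ SphereOpt.sosValues q (f ^ (2 * l)),
      v ≤ (936 ^ (e + 2) * V) ^ (2 * l) * ((n : ℝ) / q) ^ (e * l) := by
    rintro _ ⟨E, hE, rfl⟩
    have := hE.pow_le hq hq0 hqn (SphereOpt.symTensor_comp_perm f) hV0
      (SphereOpt.tensorForm_candidate_netPoint_le hn hcand)
    rwa [← SphereOpt.eq_sum_symTensor hf] at this
  have hne := SphereOpt.sosValues_nonempty hn q (f ^ (2 * l))
  have hlub := isLUB_csSup hne ⟨_, hbound⟩
  -- Taking real powers monotonically needs a nonnegative base; `f ^ (2 * l)` is the square of `f ^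
  -- l`, whose degree is at most `q / 2`.
  have hnonneg : 0 ≤ SphereOpt.sosOpt q (f ^ (2 * l)) := by
    obtain ⟨_, E, hE, rfl⟩ := hne
    refine le_trans ?_ (hlub.1 ⟨E, hE, rfl⟩)
    rw [mul_comm 2 l, pow_mul]
    refine hE.sq_nonneg _ ?_
    calc 2 * (f ^ l).totalDegree ≤ 2 * (l * (e + 2)) := by
          have := (MvPolynomial.totalDegree_pow f l).trans
            (Nat.mul_le_mul_left l hf.totalDegree_le)
          omega
      _ = q := by rw [hl]; ring
  have hmain : SphereOpt.sosOpt q (f ^ (2 * l)) ^ (((e + 2 : ℕ) : ℝ) / (q : ℝ)) ≤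
      ((C₀ + 936 : ℕ) : ℝ) ^ (e + 2) * ((n : ℝ) / (q : ℝ)) ^ (((e + 2 : ℕ) : ℝ) / 2 - 1) * V := by
    refine (SphereOpt.rpow_le_of_le_pow hl0 hq hnonneg (by positivity) (by positivity)
      (csSup_le hne hbound)).trans ?_
    rw [mul_right_comm]
    gcongr
    push_cast
    linarith [(Nat.cast_nonneg C₀ : (0 : ℝ) ≤ C₀)]
  refine ⟨hlub, hmain.trans ?_, s, t, hrun, ht.trans ?_, hout, hmain⟩
  · gcongr
    exact SphereOpt.abs_eval_le_sphereNorm f hout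
  · exact Nat.pow_le_pow_right hn (Nat.mul_le_mul_right q (by omega))
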